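/- Let $M$ be a smooth manifold and let $(E,g)$ be a sub-Riemannian structure on $M$: $E\subseteq TM$ is a smooth subbundle and $g=\langle\cdot,\cdot\rangle$ is a smooth metric tensor on $E$. Let $E^{-k}_x\subseteq T_xM$ be the span of the values at $x$ of all iterated brackets $[X_1,[X_2,\dots[X_{j-1},X_j]\dots]]$ of length $j\le k$ of (local) smooth sections of $E$. Assume that $E$ has growth vector $(2,3,5)$, i.e. $E=E^{-1}$, $E^{-2}$ and $E^{-3}=TM$ are subbundles of ranks $2$, $3$ and $5$. An $E$-grading over an open set $U\subseteq M$ is a decomposition $TM|_U=(TM)_{-1}\oplus(TM)_{-2}\oplus(TM)_{-3}$ into smooth subbundles such that $E^{-k}=\bigoplus_{j\le k}(TM)_{-j}$ for $k=1,2,3$. The bundle $E$ is orientable over a neighborhood of each point. If $E|_U$ is oriented, let $J:E|_U\to E|_U$ be the endomorphism such that $(u,Ju)$ is a positively oriented orthonormal basis for every unit vector $u\in E|_U$. There is a unique smooth $E$-valued one-form $\varphi:TM\to E$ on $M$ such that $\ker\varphi=E^{-2}$ and $$\varphi([X,[X,JX]])=\|X\|_g^2\,JX$$ for every local section $X$ of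 $E$ and every choice of local orientation. On an oriented open set $U$ define the two-form $\Psi(v,w)=\langle J\varphi(v),\varphi(w)\rangle$. For every $E$-grading over an oriented open set $U$ there is a unique smooth one-form $\theta$ on $U$ such that $\ker\theta=(TM)_{-3}\oplus(TM)_{-1}$ and $d\theta(u,v)=\langle u,Jv\rangle$ for all $u,v\in E$. Then over every oriented open set $U$ there is a unique $E$-grading $TM|_U=(TM)'_{-1}\oplus(TM)'_{-2}\oplus(TM)'_{-3}$ such that (i) $d\Psi(u,w_1,w_2)=0$ for all $u\in E$ and $w_1,w_2\in(TM)'_{-3}$; (ii) $d\theta(u,w)=0$ for all $u\in E$ and $w\in(TM)'_{-2}\oplus(TM)'_{-3}$, where $\theta$ is the one-form of this grading. Moreover, this grading is canonical and global: there is a unique $E$-grading $I'$ of $TM$ over all of $M$ which satisfies (i) and (ii) over every open set $U\subseteq M$ and for every orientation of $E|_U$. -/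

import Mathlib

open scoped Manifold ContDiff Topology

noncomputable section

namespace SubRiem

variable {n : ℕ} {M : Type*} [TopologicalSpace M] [ChartedSpace (EuclideanSpace ℝ (Fin n)) M]
  [IsManifold (𝓡 n) ∞ M]

/-- The vector field `X` is smooth on the set `U`. -/
def SmoothFieldOn (U : Set M) (X : Π x : M, TangentSpace (𝓡 n) x) : Prop :=
  ContMDiffOn (𝓡 n) (𝓡 n).tangent ∞ (fun x => (⟨x, X x⟩ : TangentBundle (𝓡 n) M)) U

/-- Over the open set `U`, the family of subspaces `F` is a smooth subbundle of `TM` of rank `r`: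
locally it is spanned by `r` linearly independent smooth vector fields. -/
def IsSubbundleOn (U : Set M) (F : Π x : M, Submodule ℝ (TangentSpace (𝓡 n) x)) (r : ℕ) : Prop :=
  ∀ x ∈ U, ∃ W : Set M, IsOpen W ∧ x ∈ W ∧ W ⊆ U ∧
    ∃ X : Fin r → Π y : M, TangentSpace (𝓡 n) y, (∀ i, SmoothFieldOn W (X i)) ∧
      ∀ y ∈ W, LinearIndependent ℝ (fun i => X i y) ∧
        Submodule.span ℝ (Set.range fun i => X i y) = F y

/-- The differential form `α` is smooth on the open set `U`: it takes smooth vector fields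
on open subsets of `U` to smooth functions. -/
def SmoothFormOn {k : ℕ} (U : Set M) (α : Π x : M, TangentSpace (𝓡 n) x [⋀^Fin k]→L[ℝ] ℝ) : Prop :=
  ∀ W ⊆ U, IsOpen W → ∀ X : Fin k → Π x : M, TangentSpace (𝓡 n) x,
    (∀ i, SmoothFieldOn W (X i)) →
      ContMDiffOn (𝓡 n) 𝓘(ℝ, ℝ) ∞ (fun x => α x (fun i => X i x)) W

/-- The exterior derivative of a differential form on `M` at the point `x`, computed in the
preferred chart at `x`: pull the form back to the model space by the inverse of the chart, take
the exterior derivative there, and pull the result back by the chart. Normalization: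
`dα(X, Y) = X α(Y) - Y α(X) - α([X, Y])` for one-forms. -/
def mextDeriv {k : ℕ} (α : Π x : M, TangentSpace (𝓡 n) x [⋀^Fin k]→L[ℝ] ℝ) (x : M) :
    TangentSpace (𝓡 n) x [⋀^Fin (k + 1)]→L[ℝ] ℝ :=
  (extDeriv (fun y : EuclideanSpace ℝ (Fin n) =>
      (α ((extChartAt (𝓡 n) x).symm y)).compContinuousLinearMap
        (mfderiv 𝓘(ℝ, EuclideanSpace ℝ (Fin n)) (𝓡 n) (extChartAt (𝓡 n) x).symm y :
          EuclideanSpace ℝ (Fin n) →L[ℝ] TangentSpace (𝓡 n) ((extChartAt (𝓡 n) x).symm y)))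
    (extChartAt (𝓡 n) x x)).compContinuousLinearMap
      (mfderiv (𝓡 n) 𝓘(ℝ, EuclideanSpace ℝ (Fin n)) (extChartAt (𝓡 n) x) x :
        TangentSpace (𝓡 n) x →L[ℝ] EuclideanSpace ℝ (Fin n))

variable (n M) in
/-- A sub-Riemannian structure `(E, g)` on `M`: a smooth subbundle `E` of `TM` and a smooth
metric tensor `g` on `E`. -/
structure Structure where
  /-- the horizontal bundle -/
  E : Π x : M, Submodule ℝ (TangentSpace (𝓡 n) x)
  isSubbundle : ∃ r : ℕ, IsSubbundleOn Set.univ E r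
  /-- the metric tensor -/
  g : Π x : M, E x →ₗ[ℝ] E x →ₗ[ℝ] ℝ
  symm : ∀ x u v, g x u v = g x v u
  pos : ∀ x u, u ≠ 0 → 0 < g x u u
  smooth : ∀ U : Set M, IsOpen U → ∀ X Y : Π x : M, E x,
    SmoothFieldOn U (fun x => (X x : TangentSpace (𝓡 n) x)) →
    SmoothFieldOn U (fun x => (Y x : TangentSpace (𝓡 n) x)) →
      ContMDiffOn (𝓡 n) 𝓘(ℝ, ℝ) ∞ (fun x => g x (X x) (Y x)) U

namespace Structure

variable (S : Structure n M)

/-- `X` is a smooth section of `E` over `U`. -/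
def IsSection (U : Set M) (X : Π x : M, S.E x) : Prop :=
  SmoothFieldOn U (fun x => (X x : TangentSpace (𝓡 n) x))

/-- `S.IsIterBracket U j Z`: over `U`, `Z` is an iterated bracket
`[X₁, [X₂, ⋯ [X_{j-1}, X_j] ⋯ ]]` of length `j` of smooth sections of `E` over `U`. -/
inductive IsIterBracket (U : Set M) : ℕ → (Π x : M, TangentSpace (𝓡 n) x) → Prop
  | base (X : Π x : M, S.E x) (hX : S.IsSection U X) :
      IsIterBracket U 1 (fun x => (X x : TangentSpace (𝓡 n) x))
  | step (X : Π x : M, S.E x) (hX : S.IsSection U X) (j : ℕ) (Z : Π x : M, TangentSpace (𝓡 n) x)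
      (hZ : IsIterBracket U j Z) :
      IsIterBracket U (j + 1)
        (VectorField.mlieBracket (𝓡 n) (fun x => (X x : TangentSpace (𝓡 n) x)) Z)

/-- The subspace `E^{-k}_x`: the span of the values at `x` of all iterated brackets of length at
most `k` of sections of `E` defined near `x`. -/
def flag (k : ℕ) (x : M) : Submodule ℝ (TangentSpace (𝓡 n) x) :=
  Submodule.span ℝ {v | ∃ U : Set M, IsOpen U ∧ x ∈ U ∧ ∃ j ≤ k,
    ∃ Z : Π y : M, TangentSpace (𝓡 n) y, S.IsIterBracket U j Z ∧ v = Z x}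

/-- `E` is bracket-generating and equiregular of step `s`, with growth vector
`(r 0, …, r (s - 1))`. -/
def HasGrowthVector {s : ℕ} (r : Fin s → ℕ) : Prop :=
  (∀ i : Fin s, IsSubbundleOn Set.univ (S.flag (i + 1)) (r i)) ∧
  (∀ x, S.flag s x = ⊤) ∧ ∀ k < s, ¬ ∀ x, S.flag k x = ⊤

/-- Over the open set `U`, `TM = ⊕ₖ (TM)_{-k}` (`1 ≤ k ≤ s`) is an `E`-grading. Here
`V i = (TM)_{-(i+1)}` for `i = 0, …, s - 1`. -/
structure IsGradingOn {s : ℕ} (U : Set M)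
    (V : Fin s → Π x : M, Submodule ℝ (TangentSpace (𝓡 n) x)) : Prop where
  isSubbundle : ∀ i, ∃ r : ℕ, IsSubbundleOn U (V i) r
  isInternal : ∀ x ∈ U, DirectSum.IsInternal (fun i => V i x)
  flag_eq : ∀ x ∈ U, ∀ k ≤ s, S.flag k x = ⨆ i : {i : Fin s // (i : ℕ) < k}, V i x

/-- For `E` of rank two, an orientation of `E` over `U`, given by its rotation `J`, so that
for each unit vector `u` the positively oriented orthonormal basis starting with `u` is
`(u, J u)`. -/
structure IsRotationOn (U : Set M) (J : Π x : M, S.E x →ₗ[ℝ] S.E x) : Prop where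
  smooth : ∀ W ⊆ U, IsOpen W → ∀ X : Π x : M, S.E x, S.IsSection W X →
    S.IsSection W (fun x => J x (X x))
  orthonormal : ∀ x ∈ U, ∀ u : S.E x, S.g x u u = 1 →
    S.g x u (J x u) = 0 ∧ S.g x (J x u) (J x u) = 1

/-- The defining properties of the `E`-valued one-form `φ`: it is smooth, `ker φ = E^{-2}`, and
`φ([X, [X, J X]]) = ‖X‖² J X` for local sections `X` of `E`, and either local orientation. -/
structure IsPhi (φ : Π x : M, TangentSpace (𝓡 n) x →ₗ[ℝ] S.E x) : Prop where
  smooth : ∀ U : Set M, IsOpen U → ∀ X : Π x : M, TangentSpace (𝓡 n) x, SmoothFieldOn U X →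
    S.IsSection U (fun x => φ x (X x))
  ker_eq : ∀ x, LinearMap.ker (φ x) = S.flag 2 x
  bracket : ∀ U : Set M, IsOpen U → ∀ J : Π x : M, S.E x →ₗ[ℝ] S.E x, S.IsRotationOn U J →
    ∀ X : Π x : M, S.E x, S.IsSection U X → ∀ x ∈ U,
      φ x (VectorField.mlieBracket (𝓡 n) (fun y => (X y : TangentSpace (𝓡 n) y))
        (VectorField.mlieBracket (𝓡 n) (fun y => (X y : TangentSpace (𝓡 n) y))
          (fun y => (J y (X y) : TangentSpace (𝓡 n) y))) x) = S.g x (X x) (X x) • J x (X x)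

variable {S} in
/-- A rotation is skew-symmetric. -/
theorem IsRotationOn.self_eq_zero {U : Set M} {J : Π x : M, S.E x →ₗ[ℝ] S.E x}
    (hJ : S.IsRotationOn U J) {x : M} (hx : x ∈ U) (u : S.E x) : S.g x (J x u) u = 0 := by
  by_cases hu : u = 0
  · simp [hu]
  have hp := S.pos x u hu
  have hs : 0 < Real.sqrt (S.g x u u) := Real.sqrt_pos.2 hp
  have h := (hJ.orthonormal x hx ((Real.sqrt (S.g x u u))⁻¹ • u) (by
    simp only [map_smul, LinearMap.smul_apply, smul_eq_mul]
    field_simp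
    rw [Real.sq_sqrt hp.le])).1
  rw [S.symm]
  simpa [hs.ne'] using h

/-- The two-form `Ψ(v, w) = ⟨J φ(v), φ(w)⟩` on the set `U` where `J` is given
(extended by zero outside of `U`). -/
def Psi {U : Set M} {J : Π x : M, S.E x →ₗ[ℝ] S.E x} (hJ : S.IsRotationOn U J)
    (φ : Π x : M, TangentSpace (𝓡 n) x →ₗ[ℝ] S.E x) (x : M) :
    TangentSpace (𝓡 n) x [⋀^Fin 2]→L[ℝ] ℝ :=
  open Classical in
  if hx : x ∈ U then
    { toFun := fun v => S.g x (J x (φ x (v 0))) (φ x (v 1))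
      map_update_add' := by
        intro _ m i v w
        fin_cases i <;> simp [Function.update]
      map_update_smul' := by
        intro _ m i c v
        fin_cases i <;> simp [Function.update]
      cont := by
        have : FiniteDimensional ℝ (TangentSpace (𝓡 n) x) :=
          inferInstanceAs (FiniteDimensional ℝ (EuclideanSpace ℝ (Fin n)))
        let B : EuclideanSpace ℝ (Fin n) →ₗ[ℝ] EuclideanSpace ℝ (Fin n) →ₗ[ℝ] ℝ :=
          (S.g x).compl₁₂ (J x ∘ₗ φ x) (φ x)
        let L : EuclideanSpace ℝ (Fin n) →L[ℝ] EuclideanSpace ℝ (Fin n) →L[ℝ] ℝ :=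
          LinearMap.toContinuousLinearMap (LinearMap.toContinuousLinearMap.toLinearMap ∘ₗ B)
        have h : Continuous fun v : Fin 2 → EuclideanSpace ℝ (Fin n) => L (v 0) (v 1) := by
          fun_prop
        exact h
      map_eq_zero_of_eq' := by
        intro v i j hv hij
        have h01 : v 0 = v 1 := by
          fin_cases i <;> fin_cases j <;> simp_all
        show S.g x (J x (φ x (v 0))) (φ x (v 1)) = 0
        rw [h01]
        exact hJ.self_eq_zero hx _ }
  else 0

/-- Over `U`, `θ` is the smooth one-form with `ker θ = (TM)_{-3} ⊕ (TM)_{-1}` and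
`dθ(u, v) = ⟨u, J v⟩` for `u, v ∈ E`. -/
structure IsThetaOn (U : Set M) (J : Π x : M, S.E x →ₗ[ℝ] S.E x)
    (V : Fin 3 → Π x : M, Submodule ℝ (TangentSpace (𝓡 n) x))
    (θ : Π x : M, TangentSpace (𝓡 n) x [⋀^Fin 1]→L[ℝ] ℝ) : Prop where
  smooth : SmoothFormOn U θ
  ker_eq : ∀ x ∈ U, ∀ w : TangentSpace (𝓡 n) x, θ x ![w] = 0 ↔ w ∈ V 2 x ⊔ V 0 x
  normalized : ∀ x ∈ U, ∀ u v : S.E x,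
    mextDeriv θ x ![(u : TangentSpace (𝓡 n) x), (v : TangentSpace (𝓡 n) x)] = S.g x u (J x v)

/-- Over `U`, the grading `V` satisfies: `dΨ(u, w₁, w₂) = 0` for `u ∈ E`,
`w₁, w₂ ∈ (TM)_{-3}`. -/
def CondI {U : Set M} {J : Π x : M, S.E x →ₗ[ℝ] S.E x} (hJ : S.IsRotationOn U J)
    (φ : Π x : M, TangentSpace (𝓡 n) x →ₗ[ℝ] S.E x)
    (V : Fin 3 → Π x : M, Submodule ℝ (TangentSpace (𝓡 n) x)) : Prop :=
  ∀ x ∈ U, ∀ u ∈ S.E x, ∀ w₁ ∈ V 2 x, ∀ w₂ ∈ V 2 x, mextDeriv (S.Psi hJ φ) x ![u, w₁, w₂] = 0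

/-- Over `U`, the grading `V` satisfies: `dθ(u, w) = 0` for `u ∈ E`,
`w ∈ (TM)_{-2} ⊕ (TM)_{-3}`. -/
def CondII (U : Set M) (V : Fin 3 → Π x : M, Submodule ℝ (TangentSpace (𝓡 n) x))
    (θ : Π x : M, TangentSpace (𝓡 n) x [⋀^Fin 1]→L[ℝ] ℝ) : Prop :=
  ∀ x ∈ U, ∀ u ∈ S.E x, ∀ w ∈ V 1 x ⊔ V 2 x, mextDeriv θ x ![u, w] = 0

end Structure

end SubRiem

end

/-!
Near every point, an orthonormal frame `e₀, e₁` of `E` yields the frame `X₀ = e₀`, `X₁ = e₁`,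
`X₂ = [X₀, X₁]`, `X₃ = [X₀, X₂]`, `X₄ = [X₁, X₂]` of `TM`; let `α₀, …, α₄` be the dual coframe.
The condition on `φ` is quadratic in `X`, and polarizing it forces `φ(X₃) = e₁` and `φ(X₄) = -e₀`,
so that `Ψ = α₃ ∧ α₄`. For the one-form `θ` of a grading, `θ(X₂) = 1` and `θ` vanishes on `E`;
hence `θ` is determined by `θ(X₃)` and `θ(X₄)`.

The space `(TM)_{-3}` is spanned by `X₃ + Z₃` and `X₄ + Z₄` with `Z₃, Z₄ ∈ E^{-2}`, and modulo `E`
these corrections are `-θ(X₃) X₂` and `-θ(X₄) X₂`. Since `dΨ(E, E, ·) = 0`, condition (i) only sees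
the class modulo `E`, and it amounts to two linear equations which express `θ(X₃)` and `θ(X₄)` by
the values of `dΨ` on the frame. Condition (ii) then says that the grading consists of `E` and of
the `dθ`-orthogonal complements of `E` in `E^{-2}` and in `ker θ`; they are complementary because
`dθ` is nondegenerate on `E`. This proves local existence and uniqueness.

Uniqueness allows the local gradings to be glued. Reversing the orientation changes the signs of
`J`, `Ψ` and `θ`, which affects neither condition, so the resulting grading is global even if `E`
is not orientable.
-/

noncomputable section

namespace SubRiem

open VectorField Set Filter Module

section Calculus

theorem differentiableAt_of_forall_apply {𝕜 E F G : Type*} [NontriviallyNormedField 𝕜]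
    [CompleteSpace 𝕜] [NormedAddCommGroup E] [NormedSpace 𝕜 E] [NormedAddCommGroup F]
    [NormedSpace 𝕜 F] [FiniteDimensional 𝕜 F] [NormedAddCommGroup G] [NormedSpace 𝕜 G]
    [FiniteDimensional 𝕜 G] {ι : Type*} [Finite ι] {f : E → F [⋀^ι]→L[𝕜] G} {p : E}
    (h : ∀ v : ι → F, DifferentiableAt 𝕜 (fun y => f y v) p) : DifferentiableAt 𝕜 f p := by
  classical
  have := Fintype.ofFinite ι
  let b := finBasis 𝕜 F
  let evalOnBasis : (F [⋀^ι]→L[𝕜] G) →ₗ[𝕜] ((ι → Fin (finrank 𝕜 F)) → G) :=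
    { toFun := fun w s => w (fun i => b (s i))
      map_add' := fun _ _ => rfl
      map_smul' := fun _ _ => rfl }
  have evalOnBasis_injective : Function.Injective evalOnBasis := by
    intro w₁ w₂ h12
    have : w₁.toMultilinearMap = w₂.toMultilinearMap :=
      Basis.ext_multilinear (fun _ => b) fun s => congrFun h12 s
    ext v
    exact congrArg (fun m : MultilinearMap 𝕜 (fun _ : ι => F) G => m v) this
  have : FiniteDimensional 𝕜 (F [⋀^ι]→L[𝕜] G) :=
    FiniteDimensional.of_injective evalOnBasis evalOnBasis_injective
  obtain ⟨g, hg⟩ :=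
    evalOnBasis.exists_leftInverse_of_injective (LinearMap.ker_eq_bot.2 evalOnBasis_injective)
  have f_eq : f = fun y => LinearMap.toContinuousLinearMap g (evalOnBasis (f y)) :=
    funext fun y => (LinearMap.congr_fun hg (f y)).symm
  rw [f_eq]
  exact (LinearMap.toContinuousLinearMap g).differentiableAt.comp p
    (differentiableAt_pi.2 fun s => h _)

variable {𝕜 E H F M : Type*} [NontriviallyNormedField 𝕜] [NormedAddCommGroup E] [NormedSpace 𝕜 E]
  [TopologicalSpace H] {I : ModelWithCorners 𝕜 E H} [NormedAddCommGroup F] [NormedSpace 𝕜 F]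
  [TopologicalSpace M] [ChartedSpace H M] {f : M → F} {x : M}

theorem differentiableAt_comp_extChartAt_symm [I.Boundaryless]
    (hf : MDifferentiableAt I 𝓘(𝕜, F) f x) :
    DifferentiableAt 𝕜 (fun y => f ((extChartAt I x).symm y)) (extChartAt I x x) := by
  have h := (mdifferentiableWithinAt_univ.2 hf).differentiableWithinAt_comp_extChartAt_symm
  rwa [I.range_eq_univ, preimage_univ, univ_inter, differentiableWithinAt_univ] at h

theorem fderiv_comp_extChartAt_symm [I.Boundaryless] [IsManifold I 1 M]
    (hf : MDifferentiableAt I 𝓘(𝕜, F) f x) (v : TangentSpace I x) :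
    fderiv 𝕜 (fun y => f ((extChartAt I x).symm y)) (extChartAt I x x)
      (mfderiv I 𝓘(𝕜, E) (extChartAt I x) x v) = mvfderiv I f x v := by
  have hcomp := mfderiv_comp x (differentiableAt_comp_extChartAt_symm hf).mdifferentiableAt
    (mdifferentiableAt_extChartAt (mem_chart_source _ x))
  have heq : (fun y => f ((extChartAt I x).symm y)) ∘ extChartAt I x =ᶠ[𝓝 x] f := by
    filter_upwards [extChartAt_source_mem_nhds (I := I) x] with y hy
    exact congrArg f ((extChartAt I x).left_inv hy)
  rw [heq.mfderiv_eq, mfderiv_eq_fderiv] at hcomp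
  exact (DFunLike.congr_fun hcomp v).symm

end Calculus

section LocalFrames

open Bundle

variable {𝕜 F ι : Type*} [NontriviallyNormedField 𝕜] [CompleteSpace 𝕜] [NormedAddCommGroup F]
  [NormedSpace 𝕜 F] [Fintype ι]

theorem sum_smulRight_basis (b : Basis ι 𝕜 F) :
    ∑ i, (ContinuousLinearMap.proj (R := 𝕜) (φ := fun _ : ι => 𝕜) i).smulRight (b i) =
      (b.equivFunL.symm : (ι → 𝕜) →L[𝕜] F) := by
  ext c
  refine Eq.trans ?_ (b.equivFun_symm_apply c).symm
  simp

theorem contDiffAt_inverse_sum_smulRight (b : Basis ι 𝕜 F) {k : ℕ∞ω} :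
    ContDiffAt 𝕜 k (fun s : ι → F => (∑ i, (ContinuousLinearMap.proj (R := 𝕜)
      (φ := fun _ : ι => 𝕜) i).smulRight (s i)).inverse) b := by
  refine ContDiffAt.comp (g := ContinuousLinearMap.inverse) _ ?_
    (ContDiff.sum fun i _ => contDiff_const.smulRight (contDiff_apply _ _ i)).contDiffAt
  rw [sum_smulRight_basis]
  exact contDiffAt_map_inverse _

variable {E H M : Type*} [NormedAddCommGroup E] [NormedSpace 𝕜 E] [TopologicalSpace H]
  {I : ModelWithCorners 𝕜 E H} [TopologicalSpace M] [ChartedSpace H M] {V : M → Type*}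
  [TopologicalSpace (TotalSpace F V)] [∀ x, AddCommGroup (V x)] [∀ x, Module 𝕜 (V x)]
  [∀ x, TopologicalSpace (V x)] [FiberBundle F V] [VectorBundle 𝕜 F V]
  {s : ι → Π x : M, V x} {u : Set M} {x : M} {k : ℕ∞ω}

omit [Fintype ι] in
theorem contMDiffAt_coeff_of_isLocalFrameOn [Finite ι] [ContMDiffVectorBundle k F V I]
    (hs : IsLocalFrameOn I F k s u) (hu : u ∈ 𝓝 x) {t : Π x : M, V x}
    (ht : ContMDiffAt I (I.prod 𝓘(𝕜, F)) k (fun y => (⟨y, t y⟩ : TotalSpace F V)) x) (i : ι) :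
    ContMDiffAt I 𝓘(𝕜, 𝕜) k (fun y => hs.coeff i y (t y)) x := by
  cases nonempty_fintype ι
  let e := trivializationAt F V x
  have hxe : x ∈ e.baseSet := mem_baseSet_trivializationAt F V x
  let basisInTrivialization {y : M} (hy : y ∈ u) (hye : y ∈ e.baseSet) : Basis ι 𝕜 F :=
    (hs.toBasisAt hy).map (e.linearEquivAt 𝕜 y hye)
  have basis_apply {y : M} (hy : y ∈ u) (hye : y ∈ e.baseSet) (j : ι) :
      basisInTrivialization hy hye j = (e ⟨y, s j y⟩).2 := by
    simp [basisInTrivialization]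
  have hs_smooth : ContMDiffAt I 𝓘(𝕜, ι → F) k (fun y i => (e ⟨y, s i y⟩).2) x :=
    contMDiffAt_pi_space.2 fun i =>
      (e.contMDiffAt_section_iff hxe).1 ((hs.contMDiffOn i).contMDiffAt hu)
  have hinverse := contDiffAt_inverse_sum_smulRight (k := k)
    (basisInTrivialization (mem_of_mem_nhds hu) hxe)
  rw [funext (basis_apply (mem_of_mem_nhds hu) hxe)] at hinverse
  have hcoeff := (hinverse.contMDiffAt.comp x hs_smooth).clm_apply
    ((e.contMDiffAt_section_iff hxe).1 ht)
  refine (contMDiffAt_pi_space.1 hcoeff i).congr_of_eventuallyEq ?_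
  filter_upwards [hu, e.open_baseSet.mem_nhds hxe] with y hy hye
  change _ = (∑ i, (ContinuousLinearMap.proj (R := 𝕜)
    (φ := fun _ : ι => 𝕜) i).smulRight (e ⟨y, s i y⟩).2).inverse (e ⟨y, t y⟩).2 i
  simp only [← basis_apply hy hye]
  rw [sum_smulRight_basis, ContinuousLinearMap.inverse_equiv]
  simp [basisInTrivialization, hy, hye]

omit [Fintype ι] in
theorem eventually_linearIndependent_of_continuousAt [Finite ι]
    (hs : ∀ i, ContinuousAt (fun y => (⟨y, s i y⟩ : TotalSpace F V)) x)
    (hli : LinearIndependent 𝕜 (s · x)) : ∀ᶠ y in 𝓝 x, LinearIndependent 𝕜 (s · y) := by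
  let e := trivializationAt F V x
  have hxe : x ∈ e.baseSet := mem_baseSet_trivializationAt F V x
  have linearIndependent_iff {y : M} (hye : y ∈ e.baseSet) :
      LinearIndependent 𝕜 (fun i => (e ⟨y, s i y⟩).2) ↔ LinearIndependent 𝕜 (s · y) := by
    rw [← LinearMap.linearIndependent_iff (e.linearEquivAt 𝕜 y hye).toLinearMap
      (LinearEquiv.ker _)]
    simp [Function.comp_def]
  have hcont : ContinuousAt (fun y i => (e ⟨y, s i y⟩).2) x := continuousAt_pi.2 fun i =>
    continuous_snd.continuousAt.comp (((e.continuousOn_toFun).continuousAt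
      (e.open_source.mem_nhds (e.mem_source.2 hxe))).comp (hs i))
  filter_upwards [hcont.eventually ((linearIndependent_iff hxe).2 hli).eventually,
    e.open_baseSet.mem_nhds hxe] with y hy hye
  exact (linearIndependent_iff hye).1 hy

end LocalFrames

theorem exists_of_locally_unique {M : Type*} [TopologicalSpace M] {A : M → Type*}
    [∀ x, Nonempty (A x)] {P : Set M → (Π x, A x) → Prop}
    (hmono : ∀ {U W f}, IsOpen U → IsOpen W → W ⊆ U → P U f → P W f)
    (hunique : ∀ {U f f'}, IsOpen U → P U f → P U f' → ∀ x ∈ U, f x = f' x)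
    (hlocal : ∀ {U f},
      (∀ x ∈ U, ∃ W ⊆ U, IsOpen W ∧ x ∈ W ∧ ∃ f', P W f' ∧ ∀ y ∈ W, f y = f' y) → P U f)
    {U : Set M} (h : ∀ x ∈ U, ∃ W ⊆ U, IsOpen W ∧ x ∈ W ∧ ∃ f, P W f) : ∃ f, P U f := by
  classical
  choose! W hWU hW hxW f hf using h
  refine ⟨fun x => if x ∈ U then f x x else Classical.arbitrary _, hlocal fun x hx =>
    ⟨W x, hWU x hx, hW x hx, hxW x hx, f x, hf x hx, fun y hy => ?_⟩⟩
  have hyU := hWU x hx hy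
  have hopen := (hW y hyU).inter (hW x hx)
  rw [if_pos hyU]
  exact hunique hopen (hmono (hW y hyU) hopen inter_subset_left (hf y hyU))
    (hmono (hW x hx) hopen inter_subset_right (hf x hx)) y ⟨hxW y hyU, hy⟩

variable {n : ℕ} {M : Type*} [TopologicalSpace M] [ChartedSpace (EuclideanSpace ℝ (Fin n)) M]
  [IsManifold (𝓡 n) ∞ M]

section Fields

variable {U W : Set M} {X Y : Π x : M, TangentSpace (𝓡 n) x} {x : M}

theorem SmoothFieldOn.mono (hX : SmoothFieldOn U X) (h : W ⊆ U) : SmoothFieldOn W X :=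
  ContMDiffOn.mono hX h

theorem SmoothFieldOn.contMDiffAt (hX : SmoothFieldOn U X) (hU : IsOpen U) (hx : x ∈ U) :
    ContMDiffAt (𝓡 n) (𝓡 n).tangent ∞ (fun x => (⟨x, X x⟩ : TangentBundle (𝓡 n) M)) x :=
  ContMDiffOn.contMDiffAt hX (hU.mem_nhds hx)

theorem SmoothFieldOn.congr (hX : SmoothFieldOn U X) (h : ∀ x ∈ U, Y x = X x) :
    SmoothFieldOn U Y :=
  ContMDiffOn.congr hX fun x hx => by rw [h x hx]

theorem smoothFieldOn_of_locally (h : ∀ x ∈ U, ∃ W, IsOpen W ∧ x ∈ W ∧ SmoothFieldOn W X) :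
    SmoothFieldOn U X := by
  intro x hx
  obtain ⟨W, hW, hxW, hX⟩ := h x hx
  exact (hX.contMDiffAt hW hxW).contMDiffWithinAt

theorem SmoothFieldOn.add (hX : SmoothFieldOn U X) (hY : SmoothFieldOn U Y) :
    SmoothFieldOn U (fun x => X x + Y x) :=
  ContMDiffOn.add_section hX hY

theorem SmoothFieldOn.smul {f : M → ℝ} (hf : ContMDiffOn (𝓡 n) 𝓘(ℝ, ℝ) ∞ f U)
    (hX : SmoothFieldOn U X) : SmoothFieldOn U (fun x => f x • X x) :=
  ContMDiffOn.smul_section hf hX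

theorem SmoothFieldOn.sum {ι : Type*} (s : Finset ι) {X : ι → Π x : M, TangentSpace (𝓡 n) x}
    (hX : ∀ i ∈ s, SmoothFieldOn U (X i)) : SmoothFieldOn U (fun x => ∑ i ∈ s, X i x) :=
  ContMDiffOn.sum_section hX

theorem SmoothFieldOn.mlieBracket (hU : IsOpen U) (hX : SmoothFieldOn U X)
    (hY : SmoothFieldOn U Y) : SmoothFieldOn U (mlieBracket (𝓡 n) X Y) := by
  have hM : IsManifold (𝓡 n) 2 M := inferInstance
  have : IsManifold (𝓡 n) (minSmoothness ℝ 2) M := by simpa using hM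
  have : IsManifold (𝓡 n) (((⊤ : ℕ∞) : ℕ∞ω) + 1) M := inferInstanceAs (IsManifold (𝓡 n) ∞ M)
  intro x hx
  exact ((hX.contMDiffAt hU hx).mlieBracket_vectorField (m := (⊤ : ℕ∞)) (n := (⊤ : ℕ∞))
    (hY.contMDiffAt hU hx) (by simp)).contMDiffWithinAt

theorem SmoothFieldOn.contMDiffOn_mvfderiv (hU : IsOpen U) (hX : SmoothFieldOn U X) {f : M → ℝ}
    (hf : ContMDiffOn (𝓡 n) 𝓘(ℝ, ℝ) ∞ f U) :
    ContMDiffOn (𝓡 n) 𝓘(ℝ, ℝ) ∞ (fun x => mvfderiv (𝓡 n) f x (X x)) U := by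
  have htangent := ContMDiffOn.contMDiffOn_tangentMapWithin (m := ∞) hf (by simp) hU.uniqueMDiffOn
  have hsnd := (contMDiff_snd_tangentBundle_modelSpace (n := ∞) ℝ 𝓘(ℝ, ℝ)).comp_contMDiffOn
    (htangent.comp hX fun x hx => hx)
  refine hsnd.congr fun x hx => ?_
  change mvfderiv (𝓡 n) f x (X x) = (mfderivWithin (𝓡 n) 𝓘(ℝ, ℝ) f U x) (X x)
  rw [mfderivWithin_of_isOpen hU hx]
  rfl

end Fields

section Charts

omit [IsManifold (𝓡 n) ∞ M] in
theorem eventually_exists_extChartAt_eq (x : M) : ∀ᶠ y in 𝓝 (extChartAt (𝓡 n) x x),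
    ∃ z ∈ (extChartAt (𝓡 n) x).source, extChartAt (𝓡 n) x z = y := by
  filter_upwards [extChartAt_target_mem_nhds (I := 𝓡 n) x] with y hy
  exact ⟨_, (extChartAt (𝓡 n) x).map_target hy, (extChartAt (𝓡 n) x).right_inv hy⟩

/-- The vector field which is constant, equal to `v`, in the preferred chart at `x`. -/
def chartField (x : M) (v : EuclideanSpace ℝ (Fin n)) : Π y : M, TangentSpace (𝓡 n) y :=
  mpullback (𝓡 n) 𝓘(ℝ, EuclideanSpace ℝ (Fin n)) (extChartAt (𝓡 n) x) (fun _ => v)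

theorem smoothFieldOn_chartField (x : M) (v : EuclideanSpace ℝ (Fin n)) :
    SmoothFieldOn (extChartAt (𝓡 n) x).source (chartField x v) := by
  intro y hy
  have hchart : ContMDiffAt (𝓡 n) 𝓘(ℝ, EuclideanSpace ℝ (Fin n)) ∞ (extChartAt (𝓡 n) x) y :=
    contMDiffAt_extChartAt' (by simpa using hy)
  have hconst : ContMDiffAt 𝓘(ℝ, EuclideanSpace ℝ (Fin n))
      𝓘(ℝ, EuclideanSpace ℝ (Fin n)).tangent ∞ (fun z =>
        (⟨z, v⟩ : TangentBundle 𝓘(ℝ, EuclideanSpace ℝ (Fin n)) (EuclideanSpace ℝ (Fin n))))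
      (extChartAt (𝓡 n) x y) :=
    contMDiffAt_vectorSpace_iff_contDiffAt.2 (contDiffAt_const (c := v))
  exact (ContMDiffAt.mpullback_vectorField_preimage hconst hchart
    (isInvertible_mfderiv_extChartAt hy) (by simp)).contMDiffWithinAt

theorem mfderiv_extChartAt_chartField (x : M) (v : EuclideanSpace ℝ (Fin n)) {z : M}
    (hz : z ∈ (extChartAt (𝓡 n) x).source) :
    mfderiv (𝓡 n) 𝓘(ℝ, EuclideanSpace ℝ (Fin n)) (extChartAt (𝓡 n) x) z (chartField x v z) = v := by
  obtain ⟨e, he⟩ := isInvertible_mfderiv_extChartAt (I := 𝓡 n) hz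
  change mfderiv (𝓡 n) 𝓘(ℝ, EuclideanSpace ℝ (Fin n)) (extChartAt (𝓡 n) x) z
    ((mfderiv (𝓡 n) 𝓘(ℝ, EuclideanSpace ℝ (Fin n)) (extChartAt (𝓡 n) x) z).inverse v) = v
  rw [← he, ContinuousLinearMap.inverse_equiv]
  exact e.apply_symm_apply _

theorem exists_smoothFieldOn_eq (x : M) (v : TangentSpace (𝓡 n) x) :
    ∃ X : Π y : M, TangentSpace (𝓡 n) y, SmoothFieldOn (extChartAt (𝓡 n) x).source X ∧ X x = v := by
  refine ⟨chartField x (mfderiv (𝓡 n) 𝓘(ℝ, EuclideanSpace ℝ (Fin n)) (extChartAt (𝓡 n) x) x v),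
    smoothFieldOn_chartField x _, ?_⟩
  have hx := mem_extChartAt_source (I := 𝓡 n) x
  exact (isInvertible_mfderiv_extChartAt hx).injective (mfderiv_extChartAt_chartField x _ hx)

/-- A vector field read in the preferred chart at `x`. -/
def fieldInChart (X : Π x : M, TangentSpace (𝓡 n) x) (x : M) :
    EuclideanSpace ℝ (Fin n) → EuclideanSpace ℝ (Fin n) :=
  mpullbackWithin 𝓘(ℝ, EuclideanSpace ℝ (Fin n)) (𝓡 n) (extChartAt (𝓡 n) x).symm X (range (𝓡 n))

theorem fieldInChart_extChartAt (X : Π x : M, TangentSpace (𝓡 n) x) (x : M) {z : M}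
    (hz : z ∈ (extChartAt (𝓡 n) x).source) :
    fieldInChart X x (extChartAt (𝓡 n) x z) =
      mfderiv (𝓡 n) 𝓘(ℝ, EuclideanSpace ℝ (Fin n)) (extChartAt (𝓡 n) x) z (X z) := by
  have cast_eq : ∀ z', z' = z → (X z' : EuclideanSpace ℝ (Fin n)) = X z := by rintro _ rfl; rfl
  have h := mfderivWithin_extChartAt_symm_comp_mfderiv_extChartAt' (I := 𝓡 n) hz
  obtain ⟨e, he⟩ := isInvertible_mfderivWithin_extChartAt_symm (I := 𝓡 n)
    ((extChartAt (𝓡 n) x).map_source hz)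
  rw [fieldInChart, mpullbackWithin_apply, ← he, ContinuousLinearMap.inverse_equiv]
  refine e.injective ((e.apply_symm_apply _).trans ?_)
  rw [← he] at h
  exact (cast_eq _ ((extChartAt (𝓡 n) x).left_inv hz)).trans (DFunLike.congr_fun h (X z)).symm

theorem mfderiv_extChartAt_mlieBracket (X Y : Π x : M, TangentSpace (𝓡 n) x) (x : M) :
    mfderiv (𝓡 n) 𝓘(ℝ, EuclideanSpace ℝ (Fin n)) (extChartAt (𝓡 n) x) x (mlieBracket (𝓡 n) X Y x) =
      lieBracket ℝ (fieldInChart X x) (fieldInChart Y x) (extChartAt (𝓡 n) x x) := by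
  have hr : (extChartAt (𝓡 n) x).symm ⁻¹' univ ∩ range (𝓡 n) = univ := by
    rw [preimage_univ, univ_inter, ModelWithCorners.range_eq_univ]
  rw [← lieBracketWithin_univ, ← hr, ← mlieBracketWithin_univ, mlieBracketWithin_apply]
  obtain ⟨e, he⟩ := isInvertible_mfderiv_extChartAt (I := 𝓡 n) (mem_extChartAt_source (I := 𝓡 n) x)
  rw [← he, ContinuousLinearMap.inverse_equiv]
  exact e.apply_symm_apply _

theorem SmoothFieldOn.differentiableAt_fieldInChart {U : Set M} (hU : IsOpen U)
    {X : Π x : M, TangentSpace (𝓡 n) x} (hX : SmoothFieldOn U X) {x : M} (hx : x ∈ U) :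
    DifferentiableAt ℝ (fieldInChart X x) (extChartAt (𝓡 n) x x) := by
  have h := (mdifferentiableWithinAt_univ.2 ((hX.contMDiffAt hU hx).mdifferentiableAt
    (by simp))).differentiableWithinAt_mpullbackWithin_vectorField
  rw [preimage_univ, univ_inter] at h
  exact h.differentiableAt (by simp)

end Charts

section ExteriorDerivative

variable {k : ℕ} {U W : Set M}

/-- The representative of a differential form in the preferred chart at `x`, so that `mextDeriv`
is the exterior derivative of `formInChart α x`, read on `T_xM`. -/
def formInChart (α : Π x : M, TangentSpace (𝓡 n) x [⋀^Fin k]→L[ℝ] ℝ) (x : M)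
    (y : EuclideanSpace ℝ (Fin n)) : EuclideanSpace ℝ (Fin n) [⋀^Fin k]→L[ℝ] ℝ :=
  (α ((extChartAt (𝓡 n) x).symm y)).compContinuousLinearMap
    (mfderiv 𝓘(ℝ, EuclideanSpace ℝ (Fin n)) (𝓡 n) (extChartAt (𝓡 n) x).symm y :
      EuclideanSpace ℝ (Fin n) →L[ℝ] TangentSpace (𝓡 n) ((extChartAt (𝓡 n) x).symm y))

omit [IsManifold (𝓡 n) ∞ M] in
theorem mextDeriv_eq_extDeriv_formInChart (α : Π x : M, TangentSpace (𝓡 n) x [⋀^Fin k]→L[ℝ] ℝ)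
    (x : M) (v : Fin (k + 1) → TangentSpace (𝓡 n) x) :
    mextDeriv α x v = extDeriv (formInChart α x) (extChartAt (𝓡 n) x x) (fun i =>
      mfderiv (𝓡 n) 𝓘(ℝ, EuclideanSpace ℝ (Fin n)) (extChartAt (𝓡 n) x) x (v i)) := rfl

theorem formInChart_mfderiv_extChartAt (α : Π x : M, TangentSpace (𝓡 n) x [⋀^Fin k]→L[ℝ] ℝ)
    (x : M) {z : M} (hz : z ∈ (extChartAt (𝓡 n) x).source) (u : Fin k → TangentSpace (𝓡 n) z) :
    formInChart α x (extChartAt (𝓡 n) x z)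
      (fun i => mfderiv (𝓡 n) 𝓘(ℝ, EuclideanSpace ℝ (Fin n)) (extChartAt (𝓡 n) x) z (u i)) =
      α z u := by
  have cast_eq : ∀ z', z' = z → ∀ w w' : Fin k → EuclideanSpace ℝ (Fin n), w = w' →
      (α z' : EuclideanSpace ℝ (Fin n) [⋀^Fin k]→L[ℝ] ℝ) w =
        (α z : EuclideanSpace ℝ (Fin n) [⋀^Fin k]→L[ℝ] ℝ) w' := by
    rintro _ rfl _ _ rfl; rfl
  refine cast_eq _ ((extChartAt (𝓡 n) x).left_inv hz) _ _ (funext fun i => ?_)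
  have h := mfderivWithin_extChartAt_symm_comp_mfderiv_extChartAt' (I := 𝓡 n) hz
  rw [ModelWithCorners.range_eq_univ, mfderivWithin_univ] at h
  exact DFunLike.congr_fun h (u i)

theorem SmoothFormOn.mono {α : Π x : M, TangentSpace (𝓡 n) x [⋀^Fin k]→L[ℝ] ℝ}
    (hα : SmoothFormOn U α) (h : W ⊆ U) : SmoothFormOn W α :=
  fun W' hW' => hα W' (hW'.trans h)

theorem SmoothFormOn.mdifferentiableAt (hU : IsOpen U)
    {α : Π x : M, TangentSpace (𝓡 n) x [⋀^Fin k]→L[ℝ] ℝ} (hα : SmoothFormOn U α)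
    {X : Fin k → Π x : M, TangentSpace (𝓡 n) x} (hX : ∀ i, SmoothFieldOn U (X i)) {x : M}
    (hx : x ∈ U) : MDifferentiableAt (𝓡 n) 𝓘(ℝ, ℝ) (fun y => α y (fun i => X i y)) x :=
  ((hα U subset_rfl hU X hX).contMDiffAt (hU.mem_nhds hx)).mdifferentiableAt (by simp)

theorem SmoothFormOn.differentiableAt_formInChart (hU : IsOpen U)
    {α : Π x : M, TangentSpace (𝓡 n) x [⋀^Fin k]→L[ℝ] ℝ} (hα : SmoothFormOn U α) {x : M}
    (hx : x ∈ U) : DifferentiableAt ℝ (formInChart α x) (extChartAt (𝓡 n) x x) := by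
  refine differentiableAt_of_forall_apply fun v => ?_
  have hdiff := (hα.mono inter_subset_left).mdifferentiableAt
    (hU.inter (isOpen_extChartAt_source (I := 𝓡 n) x))
    (fun i => (smoothFieldOn_chartField x (v i)).mono inter_subset_right)
    ⟨hx, mem_extChartAt_source x⟩
  refine (differentiableAt_comp_extChartAt_symm hdiff).congr_of_eventuallyEq ?_
  filter_upwards [extChartAt_target_mem_nhds (I := 𝓡 n) x] with y hy
  have hz := (extChartAt (𝓡 n) x).map_target hy
  rw [← formInChart_mfderiv_extChartAt α x hz, (extChartAt (𝓡 n) x).right_inv hy]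
  exact congrArg _ (funext fun i => (mfderiv_extChartAt_chartField x (v i) hz).symm)

theorem formInChart_fieldInChart (α : Π x : M, TangentSpace (𝓡 n) x [⋀^Fin k]→L[ℝ] ℝ)
    (X : Fin k → Π x : M, TangentSpace (𝓡 n) x) (x : M) {z : M}
    (hz : z ∈ (extChartAt (𝓡 n) x).source) :
    formInChart α x (extChartAt (𝓡 n) x z)
      (fun i => fieldInChart (X i) x (extChartAt (𝓡 n) x z)) = α z (fun i => X i z) := by
  rw [← formInChart_mfderiv_extChartAt α x hz]
  exact congrArg _ (funext fun i => fieldInChart_extChartAt _ x hz)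

theorem fderiv_formInChart_fieldInChart (hU : IsOpen U)
    {α : Π x : M, TangentSpace (𝓡 n) x [⋀^Fin k]→L[ℝ] ℝ} (hα : SmoothFormOn U α)
    {X : Fin k → Π x : M, TangentSpace (𝓡 n) x} (hX : ∀ i, SmoothFieldOn U (X i)) {x : M}
    (hx : x ∈ U) (Y : Π x : M, TangentSpace (𝓡 n) x) :
    fderiv ℝ (fun y => formInChart α x y (fun i => fieldInChart (X i) x y))
        (extChartAt (𝓡 n) x x) (fieldInChart Y x (extChartAt (𝓡 n) x x)) =
      mvfderiv (𝓡 n) (fun y => α y (fun i => X i y)) x (Y x) := by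
  rw [fieldInChart_extChartAt Y x (mem_extChartAt_source (I := 𝓡 n) x),
    ← fderiv_comp_extChartAt_symm (hα.mdifferentiableAt hU hX hx)]
  congr 1
  refine Filter.EventuallyEq.fderiv_eq ?_
  filter_upwards [eventually_exists_extChartAt_eq (n := n) x] with y hy
  obtain ⟨z, hz, rfl⟩ := hy
  rw [formInChart_fieldInChart α X x hz]
  exact congrArg (fun z => α z fun j => X j z) ((extChartAt (𝓡 n) x).left_inv hz).symm

theorem mextDeriv_apply_vectorField (hU : IsOpen U)
    {α : Π x : M, TangentSpace (𝓡 n) x [⋀^Fin (k + 1)]→L[ℝ] ℝ} (hα : SmoothFormOn U α)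
    {V : Fin (k + 2) → Π x : M, TangentSpace (𝓡 n) x} (hV : ∀ i, SmoothFieldOn U (V i)) {x : M}
    (hx : x ∈ U) :
    mextDeriv α x (V · x) =
      (∑ i : Fin (k + 2), (-1) ^ i.val •
        mvfderiv (𝓡 n) (fun y ↦ α y (i.removeNth (V · y))) x (V i x)) -
        ∑ i : Fin (k + 1), ∑ j ≥ i, (-1) ^ (i + j : ℕ) •
          α x (Matrix.vecCons (mlieBracket (𝓡 n) (V i.castSucc) (V j.succ) x)
              (j.removeNth <| i.castSucc.removeNth (V · x))) := by
  have hxs := mem_extChartAt_source (I := 𝓡 n) x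
  rw [mextDeriv_eq_extDeriv_formInChart]
  simp only [← fun i => fieldInChart_extChartAt (V i) x hxs]
  rw [extDeriv_apply_vectorField (hα.differentiableAt_formInChart hU hx)
    (V := fun i => fieldInChart (V i) x) fun i => (hV i).differentiableAt_fieldInChart hU hx]
  congr 1
  · refine Finset.sum_congr rfl fun i _ => congrArg _ ?_
    exact fderiv_formInChart_fieldInChart hU hα (fun j => hV (i.succAbove j)) hx (V i)
  · refine Finset.sum_congr rfl fun i _ => Finset.sum_congr rfl fun j _ => congrArg _ ?_
    rw [← formInChart_mfderiv_extChartAt α x hxs]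
    refine congrArg _ (funext fun l => ?_)
    refine Fin.cases ?_ (fun l => ?_) l
    · exact (mfderiv_extChartAt_mlieBracket _ _ x).symm
    · exact fieldInChart_extChartAt _ x hxs

end ExteriorDerivative

section LowDegreeExteriorDerivative

variable {U : Set M} {x : M} {X Y Z : Π x : M, TangentSpace (𝓡 n) x}

omit [IsManifold (𝓡 n) ∞ M] in
theorem vec_apply_two (X Y : Π x : M, TangentSpace (𝓡 n) x) (x : M) :
    (fun i => (![X, Y] : Fin 2 → Π x : M, TangentSpace (𝓡 n) x) i x) = ![X x, Y x] := by
  funext i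
  fin_cases i <;> rfl

omit [IsManifold (𝓡 n) ∞ M] in
theorem vec_apply_three (X Y Z : Π x : M, TangentSpace (𝓡 n) x) (x : M) :
    (fun i => (![X, Y, Z] : Fin 3 → Π x : M, TangentSpace (𝓡 n) x) i x) = ![X x, Y x, Z x] := by
  funext i
  fin_cases i <;> rfl

theorem removeNth_zero_vec_two {β : Type*} (a b : β) :
    (0 : Fin 2).removeNth (α := fun _ => β) ![a, b] = ![b] := rfl

theorem removeNth_one_vec_two {β : Type*} (a b : β) :
    (1 : Fin 2).removeNth (α := fun _ => β) ![a, b] = ![a] := by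
  funext i
  fin_cases i
  rfl

theorem removeNth_zero_vec_three {β : Type*} (a b c : β) :
    (0 : Fin 3).removeNth (α := fun _ => β) ![a, b, c] = ![b, c] := rfl

theorem removeNth_one_vec_three {β : Type*} (a b c : β) :
    (1 : Fin 3).removeNth (α := fun _ => β) ![a, b, c] = ![a, c] := by
  funext i
  fin_cases i <;> rfl

theorem removeNth_two_vec_three {β : Type*} (a b c : β) :
    (2 : Fin 3).removeNth (α := fun _ => β) ![a, b, c] = ![a, b] := by
  funext i
  fin_cases i <;> rfl

theorem mextDeriv_oneForm (hU : IsOpen U)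
    {α : Π x : M, TangentSpace (𝓡 n) x [⋀^Fin 1]→L[ℝ] ℝ} (hα : SmoothFormOn U α)
    (hX : SmoothFieldOn U X) (hY : SmoothFieldOn U Y) (hx : x ∈ U) :
    mextDeriv α x ![X x, Y x] = mvfderiv (𝓡 n) (fun y => α y ![Y y]) x (X x) -
      mvfderiv (𝓡 n) (fun y => α y ![X y]) x (Y x) - α x ![mlieBracket (𝓡 n) X Y x] := by
  have h := mextDeriv_apply_vectorField hU hα (V := ![X, Y])
    (by simp [Fin.forall_fin_succ, hX, hY]) hx
  simp only [vec_apply_two] at h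
  have Ici_zero : Finset.Ici (0 : Fin 1) = {0} := rfl
  have cons_empty (a : TangentSpace (𝓡 n) x) (w : Fin 0 → TangentSpace (𝓡 n) x) :
      Matrix.vecCons a w = ![a] := congrArg _ (Subsingleton.elim _ _)
  rw [h, Fin.sum_univ_two, Fin.sum_univ_one, Ici_zero, Finset.sum_singleton, cons_empty]
  simp only [removeNth_one_vec_two, removeNth_zero_vec_two]
  simp [sub_eq_add_neg]

theorem mextDeriv_twoForm (hU : IsOpen U)
    {α : Π x : M, TangentSpace (𝓡 n) x [⋀^Fin 2]→L[ℝ] ℝ} (hα : SmoothFormOn U α)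
    (hX : SmoothFieldOn U X) (hY : SmoothFieldOn U Y) (hZ : SmoothFieldOn U Z) (hx : x ∈ U) :
    mextDeriv α x ![X x, Y x, Z x] = mvfderiv (𝓡 n) (fun y => α y ![Y y, Z y]) x (X x) -
      mvfderiv (𝓡 n) (fun y => α y ![X y, Z y]) x (Y x) +
      mvfderiv (𝓡 n) (fun y => α y ![X y, Y y]) x (Z x)
      - α x ![mlieBracket (𝓡 n) X Y x, Z x] + α x ![mlieBracket (𝓡 n) X Z x, Y x]
      - α x ![mlieBracket (𝓡 n) Y Z x, X x] := by
  have h := mextDeriv_apply_vectorField hU hα (V := ![X, Y, Z])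
    (by simp [Fin.forall_fin_succ, hX, hY, hZ]) hx
  have Ici_zero : Finset.Ici (0 : Fin 2) = {0, 1} := rfl
  have Ici_one : Finset.Ici (1 : Fin 2) = {1} := rfl
  simp only [vec_apply_three] at h
  rw [h, Fin.sum_univ_three, Fin.sum_univ_two, Ici_zero, Ici_one, Finset.sum_singleton,
    Finset.sum_pair zero_ne_one]
  simp only [Fin.castSucc_zero, Fin.castSucc_one,
    removeNth_zero_vec_three, removeNth_one_vec_three, removeNth_two_vec_three,
    removeNth_zero_vec_two, removeNth_one_vec_two, Fin.succ_zero_eq_one, Fin.succ_one_eq_two]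
  have vec_two : (![X, Y, Z] : Fin 3 → Π x : M, TangentSpace (𝓡 n) x) 2 = Z := rfl
  simp only [Fin.coe_ofNat_eq_mod, Nat.zero_mod, Nat.one_mod, Nat.mod_succ, pow_zero, pow_one,
    one_smul, neg_smul, even_two, Even.neg_pow, one_pow, add_zero, zero_add, one_add_one_eq_two,
    Matrix.cons_val_zero, Matrix.cons_val_one, vec_two]
  ring

omit [IsManifold (𝓡 n) ∞ M] in
theorem mextDeriv_congr {k : ℕ} {α β : Π x : M, TangentSpace (𝓡 n) x [⋀^Fin k]→L[ℝ] ℝ}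
    (h : ∀ᶠ y in 𝓝 x, α y = β y) : mextDeriv α x = mextDeriv β x := by
  have hsymm := continuousAt_extChartAt_symm (I := 𝓡 n) x
  rw [ContinuousAt, extChartAt_to_inv] at hsymm
  have hchart : formInChart α x =ᶠ[𝓝 (extChartAt (𝓡 n) x x)] formInChart β x := by
    filter_upwards [hsymm.eventually h] with y hy
    rw [formInChart, formInChart, hy]
  ext v
  rw [mextDeriv_eq_extDeriv_formInChart, mextDeriv_eq_extDeriv_formInChart, hchart.extDeriv_eq]

omit [IsManifold (𝓡 n) ∞ M] in
theorem mextDeriv_const_smul {k : ℕ} (c : ℝ) (α : Π x : M, TangentSpace (𝓡 n) x [⋀^Fin k]→L[ℝ] ℝ)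
    (x : M) : mextDeriv (fun y => c • α y) x = c • mextDeriv α x := by
  ext v
  rw [ContinuousAlternatingMap.smul_apply, mextDeriv_eq_extDeriv_formInChart,
    mextDeriv_eq_extDeriv_formInChart]
  exact DFunLike.congr_fun (extDeriv_smul c (formInChart α x)) _

theorem SmoothFormOn.contMDiffOn_vecCons {k : ℕ} (hU : IsOpen U)
    {α : Π x : M, TangentSpace (𝓡 n) x [⋀^Fin (k + 1)]→L[ℝ] ℝ} (hα : SmoothFormOn U α)
    (hZ : SmoothFieldOn U Z) {V : Fin k → Π x : M, TangentSpace (𝓡 n) x}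
    (hV : ∀ i, SmoothFieldOn U (V i)) :
    ContMDiffOn (𝓡 n) 𝓘(ℝ, ℝ) ∞ (fun x => α x (Matrix.vecCons (Z x) (fun i => V i x))) U := by
  refine (hα U subset_rfl hU (Matrix.vecCons Z V) (Fin.cases hZ hV)).congr fun x _ => ?_
  exact congrArg _ (funext (Fin.cases rfl fun i => rfl))

theorem SmoothFormOn.mextDeriv {k : ℕ} {α : Π x : M, TangentSpace (𝓡 n) x [⋀^Fin (k + 1)]→L[ℝ] ℝ}
    (hα : SmoothFormOn U α) : SmoothFormOn U (mextDeriv α) := by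
  intro W hWU hW V hV
  have hαW := hα.mono hWU
  refine ContMDiffOn.congr ?_ fun x hx => mextDeriv_apply_vectorField hW hαW hV hx
  simp only [zsmul_eq_mul]
  refine ContMDiffOn.sub ?_ ?_
  · refine contMDiffOn_finsetSum fun i _ => contMDiffOn_const.mul ?_
    exact (hV i).contMDiffOn_mvfderiv hW
      (hαW W subset_rfl hW (fun j => V (i.succAbove j)) fun j => hV _)
  · refine contMDiffOn_finsetSum fun i _ => contMDiffOn_finsetSum fun j _ =>
      contMDiffOn_const.mul ?_
    exact hαW.contMDiffOn_vecCons hW (SmoothFieldOn.mlieBracket hW (hV _) (hV _))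
      (V := fun l => V (i.castSucc.succAbove (j.succAbove l))) fun l => hV _

omit [IsManifold (𝓡 n) ∞ M] in
theorem mvfderiv_eq_zero_of_eqOn_const (hU : IsOpen U) (hx : x ∈ U) {f : M → ℝ} {c : ℝ}
    (hf : ∀ y ∈ U, f y = c) : mvfderiv (𝓡 n) f x = 0 := by
  have hconst : f =ᶠ[𝓝 x] fun _ => c := by
    filter_upwards [hU.mem_nhds hx] with y hy using hf y hy
  rw [mvfderiv, hconst.mfderiv_eq, mfderiv_const]
  rfl

theorem SmoothFormOn.apply_mlieBracket_of_const (hU : IsOpen U)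
    {α : Π x : M, TangentSpace (𝓡 n) x [⋀^Fin 1]→L[ℝ] ℝ} (hα : SmoothFormOn U α)
    (hX : SmoothFieldOn U X) (hY : SmoothFieldOn U Y) (hx : x ∈ U) {a b : ℝ}
    (hXa : ∀ y ∈ U, α y ![X y] = a) (hYb : ∀ y ∈ U, α y ![Y y] = b) :
    α x ![mlieBracket (𝓡 n) X Y x] = -SubRiem.mextDeriv α x ![X x, Y x] := by
  rw [mextDeriv_oneForm hU hα hX hY hx, mvfderiv_eq_zero_of_eqOn_const hU hx hXa,
    mvfderiv_eq_zero_of_eqOn_const hU hx hYb]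
  simp

end LowDegreeExteriorDerivative

section LowDegreeForms

variable {R T : Type*} [CommRing R] [AddCommGroup T] [Module R T]

theorem vec_one_eta {T : Type*} (v : Fin 1 → T) : ![v 0] = v :=
  funext fun i => by rw [Subsingleton.elim i 0]; rfl

variable [TopologicalSpace R] [TopologicalSpace T]

/-- A one-form as a linear functional. -/
def lin (w : T [⋀^Fin 1]→L[R] R) : T →ₗ[R] R :=
  AlternatingMap.constLinearEquivOfIsEmpty.symm.toLinearMap ∘ₗ w.toAlternatingMap.curryLeft

/-- A two-form as a bilinear map. -/
def bilin (w : T [⋀^Fin 2]→L[R] R) : T →ₗ[R] T →ₗ[R] R :=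
  LinearMap.compRight R AlternatingMap.constLinearEquivOfIsEmpty.symm.toLinearMap ∘ₗ
    AlternatingMap.curryLeftLinearMap ∘ₗ w.toAlternatingMap.curryLeft

/-- A three-form as a trilinear map. -/
def trilin (w : T [⋀^Fin 3]→L[R] R) : T →ₗ[R] T →ₗ[R] T →ₗ[R] R :=
  LinearMap.compRight R (LinearMap.compRight R
      AlternatingMap.constLinearEquivOfIsEmpty.symm.toLinearMap ∘ₗ
    AlternatingMap.curryLeftLinearMap) ∘ₗ
    AlternatingMap.curryLeftLinearMap ∘ₗ w.toAlternatingMap.curryLeft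

theorem lin_apply (w : T [⋀^Fin 1]→L[R] R) (u : T) : lin w u = w ![u] :=
  congrArg (fun e => w (Matrix.vecCons u e)) (Subsingleton.elim _ _)

theorem bilin_apply (w : T [⋀^Fin 2]→L[R] R) (u v : T) : bilin w u v = w ![u, v] :=
  congrArg (fun e => w (Matrix.vecCons u (Matrix.vecCons v e))) (Subsingleton.elim _ _)

theorem trilin_apply (w : T [⋀^Fin 3]→L[R] R) (u v v' : T) : trilin w u v v' = w ![u, v, v'] :=
  congrArg (fun e => w (Matrix.vecCons u (Matrix.vecCons v (Matrix.vecCons v' e))))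
    (Subsingleton.elim _ _)

theorem lin_injective : Function.Injective (lin : (T [⋀^Fin 1]→L[R] R) → T →ₗ[R] R) := by
  intro w w' h
  ext v
  simpa only [lin_apply, vec_one_eta] using LinearMap.congr_fun h (v 0)

theorem bilin_isAlt (w : T [⋀^Fin 2]→L[R] R) : (bilin w).IsAlt := fun u => by
  rw [bilin_apply]
  exact w.map_eq_zero_of_eq _ (i := 0) (j := 1) rfl (by decide)

theorem trilin_isAlt (w : T [⋀^Fin 3]→L[R] R) (u : T) : (trilin w u).IsAlt := fun v => by
  rw [trilin_apply]
  exact w.map_eq_zero_of_eq _ (i := 1) (j := 2) rfl (by decide)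

end LowDegreeForms

section Frames

open Bundle

variable {ι : Type*} {W : Set M} {X : ι → Π x : M, TangentSpace (𝓡 n) x} {x : M}

instance finiteDimensional_tangentSpace (x : M) : FiniteDimensional ℝ (TangentSpace (𝓡 n) x) :=
  inferInstanceAs (FiniteDimensional ℝ (EuclideanSpace ℝ (Fin n)))

instance t2Space_tangentSpace (x : M) : T2Space (TangentSpace (𝓡 n) x) :=
  inferInstanceAs (T2Space (EuclideanSpace ℝ (Fin n)))

omit [IsManifold (𝓡 n) ∞ M] in
theorem finrank_tangentSpace (x : M) : finrank ℝ (TangentSpace (𝓡 n) x) = n :=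
  finrank_euclideanSpace_fin (𝕜 := ℝ) (n := n)

theorem isLocalFrameOn_of_linearIndependent [Fintype ι] (hcard : Fintype.card ι = n)
    (hX : ∀ i, SmoothFieldOn W (X i)) (hli : ∀ x ∈ W, LinearIndependent ℝ (X · x)) :
    IsLocalFrameOn (𝓡 n) (EuclideanSpace ℝ (Fin n)) ∞ X W where
  linearIndependent := fun hx => hli _ hx
  generating := fun {x} hx =>
    ((hli x hx).span_eq_top_of_card_eq_finrank' (by rw [finrank_tangentSpace, hcard])).ge
  contMDiffOn := hX

theorem eventually_linearIndependent [Finite ι] (hW : IsOpen W) (hX : ∀ i, SmoothFieldOn W (X i))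
    (hx : x ∈ W) (hli : LinearIndependent ℝ (X · x)) :
    ∀ᶠ y in 𝓝 x, LinearIndependent ℝ (X · y) :=
  eventually_linearIndependent_of_continuousAt (F := EuclideanSpace ℝ (Fin n))
    (fun i => ((hX i).contMDiffAt hW hx).continuousAt) hli

variable [Finite ι] (hs : IsLocalFrameOn (𝓡 n) (EuclideanSpace ℝ (Fin n)) ∞ X W)

theorem contMDiffOn_coeff (hW : IsOpen W) {W' : Set M} (hW' : IsOpen W') (hW'W : W' ⊆ W)
    {Y : Π x : M, TangentSpace (𝓡 n) x} (hY : SmoothFieldOn W' Y) (i : ι) :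
    ContMDiffOn (𝓡 n) 𝓘(ℝ, ℝ) ∞ (fun x => hs.coeff i x (Y x)) W' := fun _ hx =>
  (contMDiffAt_coeff_of_isLocalFrameOn hs (hW.mem_nhds (hW'W hx)) (hY.contMDiffAt hW' hx)
    i).contMDiffWithinAt

omit [Finite ι] in
theorem coeff_apply_self [DecidableEq ι] (hx : x ∈ W) (i j : ι) :
    hs.coeff i x (X j x) = if j = i then 1 else 0 := by
  rw [hs.coeff_apply_of_mem hx (X j), ← hs.toBasisAt_coe hx j, Basis.repr_self,
    Finsupp.single_apply]

omit [Finite ι] in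
theorem eq_sum_coeff_smul [Fintype ι] (hx : x ∈ W) (v : TangentSpace (𝓡 n) x) :
    v = ∑ i, hs.coeff i x v • X i x := by
  simpa [IsLocalFrameOn.coeff, hx] using ((hs.toBasisAt hx).sum_repr v).symm

theorem mem_span_image_iff_coeff (hx : x ∈ W) {s : Set ι} {v : TangentSpace (𝓡 n) x} :
    v ∈ Submodule.span ℝ ((X · x) '' s) ↔ ∀ i ∉ s, hs.coeff i x v = 0 := by
  classical
  cases nonempty_fintype ι
  constructor
  · intro hv i hi
    suffices hle : Submodule.span ℝ ((X · x) '' s) ≤ LinearMap.ker (hs.coeff i x) from hle hv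
    rw [Submodule.span_le]
    rintro _ ⟨j, hj, rfl⟩
    exact (coeff_apply_self hs hx i j).trans (if_neg (ne_of_mem_of_not_mem hj hi))
  · intro hv
    rw [eq_sum_coeff_smul hs hx v]
    refine Submodule.sum_mem _ fun i _ => ?_
    by_cases hi : i ∈ s
    · exact Submodule.smul_mem _ _ (Submodule.subset_span ⟨i, hi, rfl⟩)
    · rw [hv i hi, zero_smul]
      exact Submodule.zero_mem _

end Frames

section FrameExtension

variable {ι : Type*} {U W : Set M} {x : M} {A X : ι → Π x : M, TangentSpace (𝓡 n) x}

/-- The one-form given by a family of linear functionals on the tangent spaces. -/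
def oneForm (l : Π x : M, TangentSpace (𝓡 n) x →ₗ[ℝ] ℝ) (x : M) :
    TangentSpace (𝓡 n) x [⋀^Fin 1]→L[ℝ] ℝ :=
  ContinuousAlternatingMap.ofSubsingleton ℝ (TangentSpace (𝓡 n) x) ℝ (0 : Fin 1)
    (LinearMap.toContinuousLinearMap (l x))

omit [IsManifold (𝓡 n) ∞ M] in
theorem oneForm_apply (l : Π x : M, TangentSpace (𝓡 n) x →ₗ[ℝ] ℝ) (x : M)
    (v : TangentSpace (𝓡 n) x) : oneForm l x ![v] = l x v := rfl

theorem smoothFormOn_oneForm {l : Π x : M, TangentSpace (𝓡 n) x →ₗ[ℝ] ℝ}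
    (hl : ∀ W ⊆ U, IsOpen W → ∀ X : Π x : M, TangentSpace (𝓡 n) x, SmoothFieldOn W X →
      ContMDiffOn (𝓡 n) 𝓘(ℝ, ℝ) ∞ (fun x => l x (X x)) W) : SmoothFormOn U (oneForm l) :=
  fun W hWU hW X hX => hl W hWU hW (X 0) (hX 0)

theorem smoothFormOn_oneForm_sum_smul_coeff [Fintype ι] (hW : IsOpen W)
    (hs : IsLocalFrameOn (𝓡 n) (EuclideanSpace ℝ (Fin n)) ∞ X W) {c : ι → M → ℝ}
    (hc : ∀ i, ContMDiffOn (𝓡 n) 𝓘(ℝ, ℝ) ∞ (c i) W) :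
    SmoothFormOn W (oneForm fun x => ∑ i, c i x • hs.coeff i x) := by
  refine smoothFormOn_oneForm fun W' hW'W hW' Y hY => ?_
  simp only [LinearMap.sum_apply, LinearMap.smul_apply, smul_eq_mul]
  exact contMDiffOn_finsetSum fun i _ =>
    ((hc i).mono hW'W).mul (contMDiffOn_coeff hs hW hW' hW'W hY i)

theorem exists_isLocalFrameOn_sumElim [Finite ι] (hW : IsOpen W) (hA : ∀ i, SmoothFieldOn W (A i))
    (hx : x ∈ W) (hli : LinearIndependent ℝ (A · x)) :
    ∃ W' ⊆ W, IsOpen W' ∧ x ∈ W' ∧ ∃ (m : ℕ) (B : Fin m → Π y : M, TangentSpace (𝓡 n) y),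
      IsLocalFrameOn (𝓡 n) (EuclideanSpace ℝ (Fin n)) ∞ (Sum.elim A B) W' := by
  cases nonempty_fintype ι
  obtain ⟨C, hC⟩ := Submodule.exists_isCompl (Submodule.span ℝ (range (A · x)))
  let c := finBasis ℝ C
  choose B hB hBx using fun k => exists_smoothFieldOn_eq x (c k : TangentSpace (𝓡 n) x)
  have hW₁ : IsOpen (W ∩ (extChartAt (𝓡 n) x).source) := hW.inter (isOpen_extChartAt_source x)
  have hxW₁ : x ∈ W ∩ (extChartAt (𝓡 n) x).source := ⟨hx, mem_extChartAt_source x⟩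
  have hsmooth : ∀ i, SmoothFieldOn (W ∩ (extChartAt (𝓡 n) x).source) (Sum.elim A B i) := by
    rintro (i | k)
    exacts [(hA i).mono inter_subset_left, (hB k).mono inter_subset_right]
  have hindep : LinearIndependent ℝ (Sum.elim A B · x) := by
    have hAB : (Sum.elim A B · x) = Sum.elim (A · x) fun k => (c k : TangentSpace (𝓡 n) x) := by
      funext i
      cases i
      exacts [rfl, hBx _]
    rw [hAB]
    refine hli.sum_type (c.linearIndependent.map' C.subtype (Submodule.ker_subtype C))
      (hC.disjoint.mono_right (Submodule.span_le.2 ?_))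
    rintro _ ⟨k, rfl⟩
    exact (c k).2
  have hcard : Fintype.card (ι ⊕ Fin (finrank ℝ C)) = n := by
    have hrank := Submodule.finrank_add_eq_of_isCompl hC
    rw [finrank_span_eq_card hli, finrank_tangentSpace] at hrank
    simpa using hrank
  obtain ⟨W₂, hindep', hW₂, hxW₂⟩ := eventually_nhds_iff.1
    (eventually_linearIndependent hW₁ hsmooth hxW₁ hindep)
  exact ⟨_ ∩ W₂, inter_subset_left.trans inter_subset_left, hW₁.inter hW₂, ⟨hxW₁, hxW₂⟩, _, B,
    isLocalFrameOn_of_linearIndependent hcard (fun i => (hsmooth i).mono inter_subset_left)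
      fun y hy => hindep' y hy.2⟩

theorem exists_smoothFormOn_extension [Finite ι] (hW : IsOpen W)
    (hA : ∀ i, SmoothFieldOn W (A i)) (hx : x ∈ W) (hli : LinearIndependent ℝ (A · x))
    (l : TangentSpace (𝓡 n) x →ₗ[ℝ] ℝ) (hl : ∀ i, l (A i x) = 0) :
    ∃ W' ⊆ W, IsOpen W' ∧ x ∈ W' ∧ ∃ α : Π y : M, TangentSpace (𝓡 n) y [⋀^Fin 1]→L[ℝ] ℝ,
      SmoothFormOn W' α ∧ (∀ y ∈ W', ∀ i, lin (α y) (A i y) = 0) ∧ lin (α x) = l := by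
  classical
  cases nonempty_fintype ι
  obtain ⟨W', hW'W, hW', hxW', m, B, hs⟩ := exists_isLocalFrameOn_sumElim hW hA hx hli
  refine ⟨W', hW'W, hW', hxW', oneForm fun y => ∑ i, l (Sum.elim A B i x) • hs.coeff i y,
    smoothFormOn_oneForm_sum_smul_coeff hW' hs fun i => contMDiffOn_const, fun y hy i => ?_, ?_⟩
  · have hcoeff : ∀ j, hs.coeff j y (A i y) = if Sum.inl i = j then 1 else 0 := fun j =>
      coeff_apply_self hs hy j (Sum.inl i)
    simp [lin_apply, oneForm_apply, hcoeff, hl]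
  · ext v
    conv_rhs => rw [eq_sum_coeff_smul hs hxW' v]
    simp [lin_apply, oneForm_apply, mul_comm]

/-- The obstruction to `[Y, Z] ∈ K` is a one-form `α` which annihilates the span of the `A i` nearby
and `K` at the point: then `α([Y, Z]) = -dα(Y, Z)`, which is bilinear over functions. -/
theorem mlieBracket_mem_of_mem_span [Finite ι] (hW : IsOpen W) (hA : ∀ i, SmoothFieldOn W (A i))
    (hx : x ∈ W) (hli : LinearIndependent ℝ (A · x)) {Y Z : Π x : M, TangentSpace (𝓡 n) x}
    (hY : SmoothFieldOn W Y) (hZ : SmoothFieldOn W Z)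
    (hYA : ∀ y ∈ W, Y y ∈ Submodule.span ℝ (range (A · y)))
    (hZA : ∀ y ∈ W, Z y ∈ Submodule.span ℝ (range (A · y)))
    {K : Submodule ℝ (TangentSpace (𝓡 n) x)} (hAK : ∀ i, A i x ∈ K)
    (hbracket : ∀ i j, mlieBracket (𝓡 n) (A i) (A j) x ∈ K) : mlieBracket (𝓡 n) Y Z x ∈ K := by
  by_contra hYZ
  obtain ⟨l, hlYZ, hlK⟩ := Submodule.exists_le_ker_of_notMem hYZ
  obtain ⟨W', hW'W, hW', hxW', α, hα, hαA, hαl⟩ :=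
    exists_smoothFormOn_extension hW hA hx hli l fun i => hlK (hAK i)
  have hαspan : ∀ y ∈ W', Submodule.span ℝ (range (A · y)) ≤ LinearMap.ker (lin (α y)) :=
    fun y hy => Submodule.span_le.2 (range_subset_iff.2 (hαA y hy))
  have hαbracket : ∀ {P Q : Π x : M, TangentSpace (𝓡 n) x}, SmoothFieldOn W P →
      SmoothFieldOn W Q → (∀ y ∈ W, P y ∈ Submodule.span ℝ (range (A · y))) →
      (∀ y ∈ W, Q y ∈ Submodule.span ℝ (range (A · y))) →
      l (mlieBracket (𝓡 n) P Q x) = -bilin (mextDeriv α x) (P x) (Q x) := by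
    intro P Q hP hQ hPA hQA
    rw [← hαl, lin_apply, bilin_apply, hα.apply_mlieBracket_of_const hW' (hP.mono hW'W)
      (hQ.mono hW'W) hxW' (fun y hy => (lin_apply _ _).symm.trans (hαspan y hy (hPA y (hW'W hy))))
      fun y hy => (lin_apply _ _).symm.trans (hαspan y hy (hQA y (hW'W hy)))]
  have hAmem : ∀ i, ∀ y ∈ W, A i y ∈ Submodule.span ℝ (range (A · y)) := fun i y _ =>
    Submodule.subset_span (mem_range_self i)
  have hvanish : Submodule.map₂ (bilin (mextDeriv α x)) (Submodule.span ℝ (range (A · x)))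
      (Submodule.span ℝ (range (A · x))) ≤ ⊥ := by
    rw [Submodule.map₂_span_span, Submodule.span_le]
    rintro _ ⟨_, ⟨i, rfl⟩, _, ⟨j, rfl⟩, rfl⟩
    have hlij : l (mlieBracket (𝓡 n) (A i) (A j) x) = 0 := hlK (hbracket i j)
    rw [hαbracket (hA i) (hA j) (hAmem i) (hAmem j)] at hlij
    exact neg_eq_zero.1 hlij
  have hYZ_zero : bilin (mextDeriv α x) (Y x) (Z x) = 0 :=
    hvanish (Submodule.apply_mem_map₂ _ (hYA x hx) (hZA x hx))
  exact hlYZ (by rw [hαbracket hY hZ hYA hZA, hYZ_zero, neg_zero])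

end FrameExtension

theorem IsSubbundleOn.finrank_eq {U : Set M} {F : Π x : M, Submodule ℝ (TangentSpace (𝓡 n) x)}
    {r : ℕ} (h : IsSubbundleOn U F r) {x : M} (hx : x ∈ U) : finrank ℝ (F x) = r := by
  obtain ⟨W, -, hxW, -, X, -, hX⟩ := h x hx
  rw [← (hX x hxW).2, finrank_span_eq_card (hX x hxW).1, Fintype.card_fin]

namespace Structure

variable {S : Structure n M} {U W : Set M}

section Flag

theorem IsIterBracket.pos {j : ℕ} {Z : Π x : M, TangentSpace (𝓡 n) x}
    (h : S.IsIterBracket U j Z) : 0 < j := by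
  cases h <;> omega

theorem IsIterBracket.smoothFieldOn (hU : IsOpen U) {j : ℕ} {Z : Π x : M, TangentSpace (𝓡 n) x}
    (h : S.IsIterBracket U j Z) : SmoothFieldOn U Z := by
  induction h with
  | base _ hX => exact hX
  | step _ hX _ _ _ ih => exact SmoothFieldOn.mlieBracket hU hX ih

theorem IsIterBracket.mem_flag (hU : IsOpen U) {j k : ℕ} (hjk : j ≤ k)
    {Z : Π x : M, TangentSpace (𝓡 n) x} (h : S.IsIterBracket U j Z) {x : M} (hx : x ∈ U) :
    Z x ∈ S.flag k x :=
  Submodule.subset_span ⟨U, hU, hx, j, hjk, Z, h, rfl⟩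

theorem flag_zero (S : Structure n M) (x : M) : S.flag 0 x = ⊥ := by
  rw [flag, Submodule.span_eq_bot]
  rintro _ ⟨U, -, -, j, hj, Z, hZ, -⟩
  exact absurd hZ.pos (by omega)

theorem IsSection.mono {X : Π x : M, S.E x} (hX : S.IsSection U X) (h : W ⊆ U) :
    S.IsSection W X :=
  SmoothFieldOn.mono hX h

theorem IsSection.smul {f : M → ℝ} (hf : ContMDiffOn (𝓡 n) 𝓘(ℝ, ℝ) ∞ f U) {X : Π x : M, S.E x}
    (hX : S.IsSection U X) : S.IsSection U (fun x => f x • X x) :=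
  SmoothFieldOn.smul hf hX

theorem IsSection.add {X Y : Π x : M, S.E x} (hX : S.IsSection U X) (hY : S.IsSection U Y) :
    S.IsSection U (fun x => X x + Y x) :=
  SmoothFieldOn.add hX hY

theorem IsSection.sub {X Y : Π x : M, S.E x} (hX : S.IsSection U X) (hY : S.IsSection U Y) :
    S.IsSection U (fun x => X x - Y x) := by
  simpa [sub_eq_add_neg] using hX.add (hY.smul (f := fun _ => (-1 : ℝ)) contMDiffOn_const)

theorem exists_isSection_eq (S : Structure n M) (x : M) (u : S.E x) :
    ∃ W : Set M, IsOpen W ∧ x ∈ W ∧ ∃ X : Π y : M, S.E y, S.IsSection W X ∧ X x = u := by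
  classical
  obtain ⟨r, hr⟩ := S.isSubbundle
  obtain ⟨W, hW, hxW, -, X, hX, hspan⟩ := hr x (mem_univ x)
  have hu : (u : TangentSpace (𝓡 n) x) ∈ Submodule.span ℝ (range (X · x)) := by
    rw [(hspan x hxW).2]
    exact u.2
  obtain ⟨c, hc⟩ := (Submodule.mem_span_range_iff_exists_fun ℝ).1 hu
  let Y : Π y : M, TangentSpace (𝓡 n) y := fun y => ∑ i, c i • X i y
  have hYE : ∀ y ∈ W, Y y ∈ S.E y := by
    intro y hy
    rw [← (hspan y hy).2]
    exact Submodule.sum_mem _ fun i _ => Submodule.smul_mem _ _ (Submodule.subset_span ⟨i, rfl⟩)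
  have hY : SmoothFieldOn W Y :=
    SmoothFieldOn.sum Finset.univ fun i _ => (hX i).smul (f := fun _ => c i) contMDiffOn_const
  exact ⟨W, hW, hxW, fun y => if h : Y y ∈ S.E y then ⟨Y y, h⟩ else 0,
    hY.congr fun y hy => congrArg Subtype.val (dif_pos (hYE y hy)),
    (dif_pos (hYE x hxW)).trans (Subtype.ext hc)⟩

theorem flag_one (S : Structure n M) (x : M) : S.flag 1 x = S.E x := by
  apply le_antisymm
  · rw [flag, Submodule.span_le]
    rintro _ ⟨U, -, -, j, hj, Z, hZ, rfl⟩
    cases hZ with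
    | base X hX => exact (X x).2
    | step X hX j Z hZ => exact absurd hZ.pos (by omega)
  · intro u hu
    obtain ⟨W, hW, hxW, X, hX, hXx⟩ := S.exists_isSection_eq x ⟨u, hu⟩
    simpa only [hXx] using (IsIterBracket.base X hX).mem_flag hW le_rfl hxW

theorem HasGrowthVector.finrank_flag {s : ℕ} {r : Fin s → ℕ} (hS : S.HasGrowthVector r)
    (i : Fin s) (x : M) : finrank ℝ (S.flag (i + 1) x) = r i :=
  (hS.1 i).finrank_eq (mem_univ x)

theorem HasGrowthVector.finrank_E {s : ℕ} {r : Fin (s + 1) → ℕ} (hS : S.HasGrowthVector r)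
    (x : M) : finrank ℝ (S.E x) = r 0 :=
  S.flag_one x ▸ hS.finrank_flag 0 x

theorem HasGrowthVector.dim_eq {s : ℕ} {r : Fin (s + 1) → ℕ} (hS : S.HasGrowthVector r)
    (x : M) : n = r (Fin.last s) := by
  have hrank := hS.finrank_flag (Fin.last s) x
  rwa [Fin.val_last, hS.2.1 x, finrank_top, finrank_tangentSpace] at hrank

end Flag

section OrthonormalFrames

variable {e₀ e₁ : Π x : M, S.E x} {J : Π x : M, S.E x →ₗ[ℝ] S.E x} {x : M}

theorem exists_normalized {Z : Π x : M, S.E x} (hW : IsOpen W) (hZ : S.IsSection W Z)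
    (hx : x ∈ W) (hZx : Z x ≠ 0) : ∃ W' ⊆ W, IsOpen W' ∧ x ∈ W' ∧ ∃ f : M → ℝ,
      S.IsSection W' (fun y => f y • Z y) ∧ ∀ y ∈ W', S.g y (f y • Z y) (f y • Z y) = 1 := by
  have hg := S.smooth W hW Z Z hZ hZ
  let W' := W ∩ (fun y => S.g y (Z y) (Z y)) ⁻¹' Ioi 0
  have hW' : IsOpen W' := hg.continuousOn.isOpen_inter_preimage hW isOpen_Ioi
  have hpos : ∀ y ∈ W', 0 < S.g y (Z y) (Z y) := fun y hy => hy.2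
  have hsqrt : ContMDiffOn (𝓡 n) 𝓘(ℝ, ℝ) ∞ (fun y => Real.sqrt (S.g y (Z y) (Z y))) W' :=
    fun y hy => (Real.contDiffAt_sqrt (n := ∞) (hpos y hy).ne').contMDiffAt.comp_contMDiffWithinAt
      (I := 𝓡 n) y ((hg y hy.1).mono inter_subset_left)
  have hne : ∀ y ∈ W', Real.sqrt (S.g y (Z y) (Z y)) ≠ 0 := fun y hy =>
    (Real.sqrt_pos.2 (hpos y hy)).ne'
  refine ⟨W', inter_subset_left, hW', ⟨hx, S.pos x _ hZx⟩,
    fun y => (Real.sqrt (S.g y (Z y) (Z y)))⁻¹,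
    (hZ.mono inter_subset_left).smul (hsqrt.inv₀ hne), fun y hy => ?_⟩
  have hney := hne y hy
  simp only [map_smul, LinearMap.smul_apply, smul_eq_mul]
  field_simp
  rw [Real.sq_sqrt (hpos y hy).le]

theorem exists_unit_section (hU : IsOpen U) (hx : x ∈ U) [Nontrivial (S.E x)] :
    ∃ W ⊆ U, IsOpen W ∧ x ∈ W ∧ ∃ e : Π y : M, S.E y,
      S.IsSection W e ∧ ∀ y ∈ W, S.g y (e y) (e y) = 1 := by
  obtain ⟨u, hu⟩ := exists_ne (0 : S.E x)
  obtain ⟨W, hW, hxW, X, hX, hXx⟩ := S.exists_isSection_eq x u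
  obtain ⟨W', hW'W, hW', hxW', f, hf, hnorm⟩ :=
    exists_normalized (hU.inter hW) (hX.mono inter_subset_right) ⟨hx, hxW⟩ (by rwa [hXx])
  exact ⟨W', hW'W.trans inter_subset_left, hW', hxW', _, hf, hnorm⟩

/-- The sections `e₀, e₁` of `E` are smooth and orthonormal over `W`. -/
structure IsOrthonormalOn (S : Structure n M) (W : Set M) (e₀ e₁ : Π x : M, S.E x) : Prop where
  isSection₀ : S.IsSection W e₀
  isSection₁ : S.IsSection W e₁
  norm₀ : ∀ y ∈ W, S.g y (e₀ y) (e₀ y) = 1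
  norm₁ : ∀ y ∈ W, S.g y (e₁ y) (e₁ y) = 1
  orth : ∀ y ∈ W, S.g y (e₀ y) (e₁ y) = 0

theorem IsOrthonormalOn.mono (h : S.IsOrthonormalOn U e₀ e₁) (hWU : W ⊆ U) :
    S.IsOrthonormalOn W e₀ e₁ where
  isSection₀ := h.isSection₀.mono hWU
  isSection₁ := h.isSection₁.mono hWU
  norm₀ y hy := h.norm₀ y (hWU hy)
  norm₁ y hy := h.norm₁ y (hWU hy)
  orth y hy := h.orth y (hWU hy)

theorem IsOrthonormalOn.orth' (h : S.IsOrthonormalOn W e₀ e₁) (hx : x ∈ W) :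
    S.g x (e₁ x) (e₀ x) = 0 := by
  rw [S.symm, h.orth x hx]

theorem IsOrthonormalOn.linearIndependent (h : S.IsOrthonormalOn W e₀ e₁) (hx : x ∈ W) :
    LinearIndependent ℝ ![e₀ x, e₁ x] := by
  rw [LinearIndependent.pair_iff]
  intro a b hab
  constructor
  · simpa [h.norm₀ x hx, h.orth x hx] using congrArg (S.g x (e₀ x)) hab
  · simpa [h.norm₁ x hx, h.orth' hx] using congrArg (S.g x (e₁ x)) hab

theorem IsOrthonormalOn.eq_sum (hE : finrank ℝ (S.E x) = 2) (h : S.IsOrthonormalOn W e₀ e₁)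
    (hx : x ∈ W) (u : S.E x) : u = S.g x (e₀ x) u • e₀ x + S.g x (e₁ x) u • e₁ x := by
  have hu : u ∈ Submodule.span ℝ (range ![e₀ x, e₁ x]) := by
    rw [(h.linearIndependent hx).span_eq_top_of_card_eq_finrank (by rw [hE, Fintype.card_fin])]
    trivial
  rw [Matrix.range_cons_cons_empty, Submodule.mem_span_pair] at hu
  obtain ⟨a, b, rfl⟩ := hu
  simp [h.norm₀ x hx, h.norm₁ x hx, h.orth x hx, h.orth' hx]

theorem exists_isOrthonormalOn (hE : finrank ℝ (S.E x) = 2) :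
    ∃ W : Set M, IsOpen W ∧ x ∈ W ∧ ∃ e₀ e₁ : Π y : M, S.E y, S.IsOrthonormalOn W e₀ e₁ := by
  have : Nontrivial (S.E x) := nontrivial_of_finrank_pos (R := ℝ) (by omega)
  obtain ⟨W, -, hW, hxW, e₀, he₀, hnorm₀⟩ := exists_unit_section (S := S) isOpen_univ (mem_univ x)
  obtain ⟨v, hv⟩ : ∃ v : S.E x, v ∉ Submodule.span ℝ {e₀ x} := by
    by_contra! hspan
    have hle := finrank_span_le_card (R := ℝ) ({e₀ x} : Set (S.E x))
    rw [(Submodule.eq_top_iff'.2 hspan : Submodule.span ℝ {e₀ x} = ⊤), finrank_top, hE] at hle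
    simp at hle
  obtain ⟨W₁, hW₁, hxW₁, Y, hY, hYx⟩ := S.exists_isSection_eq x v
  have he₀' := he₀.mono (inter_subset_left (t := W₁))
  have hY' := hY.mono (inter_subset_right (s := W))
  let Z : Π y : M, S.E y := fun y => Y y - S.g y (e₀ y) (Y y) • e₀ y
  have hZ : S.IsSection (W ∩ W₁) Z :=
    hY'.sub (he₀'.smul (S.smooth _ (hW.inter hW₁) e₀ Y he₀' hY'))
  have hZx : Z x ≠ 0 := fun hzero => hv <| Submodule.mem_span_singleton.2
    ⟨S.g x (e₀ x) (Y x), (sub_eq_zero.1 hzero).symm.trans hYx⟩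
  obtain ⟨W', hW'W, hW', hxW', f, hf, hnorm₁⟩ :=
    exists_normalized (hW.inter hW₁) hZ ⟨hxW, hxW₁⟩ hZx
  exact ⟨W', hW', hxW', e₀, _, he₀'.mono hW'W, hf, fun y hy => hnorm₀ y (hW'W hy).1, hnorm₁,
    fun y hy => by simp [Z, hnorm₀ y (hW'W hy).1]⟩

/-- The rotation by a right angle for which the orthonormal frame `e₀, e₁` is positively
oriented. -/
def rotation (S : Structure n M) (e₀ e₁ : Π y : M, S.E y) (y : M) : S.E y →ₗ[ℝ] S.E y :=
  (S.g y (e₀ y)).smulRight (e₁ y) - (S.g y (e₁ y)).smulRight (e₀ y)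

theorem rotation_apply (e₀ e₁ : Π y : M, S.E y) (y : M) (u : S.E y) :
    S.rotation e₀ e₁ y u = S.g y (e₀ y) u • e₁ y - S.g y (e₁ y) u • e₀ y := rfl

theorem IsOrthonormalOn.isRotationOn (hE : ∀ x, finrank ℝ (S.E x) = 2)
    (h : S.IsOrthonormalOn W e₀ e₁) : S.IsRotationOn W (S.rotation e₀ e₁) where
  smooth W' hW'W hW' X hX := by
    have he₀ := h.isSection₀.mono hW'W
    have he₁ := h.isSection₁.mono hW'W
    exact (he₁.smul (S.smooth W' hW' e₀ X he₀ hX)).sub (he₀.smul (S.smooth W' hW' e₁ X he₁ hX))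
  orthonormal y hy u hu := by
    have hsum := h.eq_sum (hE y) hy u
    rw [rotation_apply]
    set a := S.g y (e₀ y) u
    set b := S.g y (e₁ y) u
    rw [hsum] at hu ⊢
    simp only [map_add, map_sub, map_smul, LinearMap.add_apply, LinearMap.sub_apply,
      LinearMap.smul_apply, smul_eq_mul, h.norm₀ y hy, h.norm₁ y hy, h.orth y hy,
      h.orth' hy] at hu ⊢
    constructor <;> linarith

theorem IsRotationOn.mono (hJ : S.IsRotationOn U J) (hWU : W ⊆ U) : S.IsRotationOn W J where
  smooth W' hW' := hJ.smooth W' (hW'.trans hWU)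
  orthonormal x hx := hJ.orthonormal x (hWU hx)

theorem IsRotationOn.skew (hJ : S.IsRotationOn U J) (hx : x ∈ U) (u v : S.E x) :
    S.g x (J x u) v = -S.g x (J x v) u := by
  have hself := hJ.self_eq_zero hx (u + v)
  simp only [map_add, LinearMap.add_apply, hJ.self_eq_zero hx] at hself
  linarith

theorem IsRotationOn.isOrthonormalOn (hJ : S.IsRotationOn U J) (hWU : W ⊆ U) (hW : IsOpen W)
    (he₀ : S.IsSection W e₀) (hnorm : ∀ y ∈ W, S.g y (e₀ y) (e₀ y) = 1) :
    S.IsOrthonormalOn W e₀ (fun y => J y (e₀ y)) where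
  isSection₀ := he₀
  isSection₁ := hJ.smooth W hWU hW e₀ he₀
  norm₀ := hnorm
  norm₁ y hy := (hJ.orthonormal y (hWU hy) _ (hnorm y hy)).2
  orth y hy := (hJ.orthonormal y (hWU hy) _ (hnorm y hy)).1

theorem IsRotationOn.exists_isOrthonormalOn (hU : IsOpen U) (hJ : S.IsRotationOn U J)
    (hx : x ∈ U) [Nontrivial (S.E x)] : ∃ W ⊆ U, IsOpen W ∧ x ∈ W ∧ ∃ e₀ : Π y : M, S.E y,
      S.IsOrthonormalOn W e₀ (fun y => J y (e₀ y)) := by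
  obtain ⟨W, hWU, hW, hxW, e₀, he₀, hnorm⟩ := exists_unit_section (S := S) hU hx
  exact ⟨W, hWU, hW, hxW, e₀, hJ.isOrthonormalOn hWU hW he₀ hnorm⟩

theorem IsRotationOn.eq_rotation (hE : finrank ℝ (S.E x) = 2) (hJ : S.IsRotationOn U J)
    (hWU : W ⊆ U) (h : S.IsOrthonormalOn W e₀ (fun y => J y (e₀ y))) (hx : x ∈ W) :
    J x = S.rotation e₀ (fun y => J y (e₀ y)) x := by
  ext1 u
  have hcomp₀ : S.g x (e₀ x) (J x u) = -S.g x (J x (e₀ x)) u := by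
    rw [S.symm, hJ.skew (hWU hx)]
  have hcomp₁ : S.g x (J x (e₀ x)) (J x u) = S.g x (e₀ x) u := by
    conv_lhs => rw [h.eq_sum hE hx u]
    simp [h.norm₁ x hx, S.symm x (J x (e₀ x)) (J x (J x (e₀ x))), hJ.self_eq_zero (hWU hx)]
  rw [rotation_apply, h.eq_sum hE hx (J x u), hcomp₀, hcomp₁]
  module

theorem IsOrthonormalOn.g_rotation (hE : finrank ℝ (S.E x) = 2) (h : S.IsOrthonormalOn W e₀ e₁)
    (hx : x ∈ W) (u v : S.E x) :
    S.g x (S.rotation e₀ e₁ x u) (S.rotation e₀ e₁ x v) = S.g x u v := by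
  conv_rhs => rw [h.eq_sum hE hx u]
  simp [rotation_apply, h.norm₀ x hx, h.norm₁ x hx, h.orth x hx, h.orth' hx]

theorem IsRotationOn.eq_or_eq_neg (hE : finrank ℝ (S.E x) = 2) (hU : IsOpen U) (hW : IsOpen W)
    (hJ : S.IsRotationOn U J) {J' : Π x : M, S.E x →ₗ[ℝ] S.E x} (hJ' : S.IsRotationOn W J')
    (hxU : x ∈ U) (hxW : x ∈ W) : J' x = J x ∨ J' x = -J x := by
  have : Nontrivial (S.E x) := nontrivial_of_finrank_pos (R := ℝ) (by omega)
  obtain ⟨V, hV, hVo, hxV, e₀, he₀, hnorm⟩ :=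
    exists_unit_section (S := S) (hU.inter hW) ⟨hxU, hxW⟩
  have hVU := hV.trans inter_subset_left
  have hVW := hV.trans inter_subset_right
  have h := hJ.isOrthonormalOn hVU hVo he₀ hnorm
  have h' := hJ'.isOrthonormalOn hVW hVo he₀ hnorm
  have hmul : J' x (e₀ x) = S.g x (J x (e₀ x)) (J' x (e₀ x)) • J x (e₀ x) := by
    conv_lhs => rw [h.eq_sum hE hxV (J' x (e₀ x)), h'.orth x hxV, zero_smul, zero_add]
  have hsq := h'.norm₁ x hxV
  rw [hmul, map_smul, map_smul, LinearMap.smul_apply, h.norm₁ x hxV, smul_eq_mul, smul_eq_mul,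
    mul_one, mul_self_eq_one_iff] at hsq
  rw [hJ.eq_rotation hE hVU h hxV, hJ'.eq_rotation hE hVW h' hxV]
  refine hsq.imp (fun hone => ?_) fun hneg => ?_
  · rw [hone, one_smul] at hmul
    ext1 u
    rw [rotation_apply, rotation_apply, hmul]
  · rw [hneg, neg_one_smul] at hmul
    ext1 u
    rw [LinearMap.neg_apply, rotation_apply, rotation_apply, hmul]
    simp only [map_neg, LinearMap.neg_apply]
    module

end OrthonormalFrames

end Structure

namespace Structure

variable {S : Structure n M} {U W : Set M} {e₀ e₁ : Π y : M, S.E y} {x : M}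

section DerivedFrame

/-- A section of `E`, regarded as a vector field. -/
def field (e : Π y : M, S.E y) : Π y : M, TangentSpace (𝓡 n) y :=
  fun y => (e y : TangentSpace (𝓡 n) y)

/-- The fields `X₀ = e₀`, `X₁ = e₁`, `X₂ = [X₀, X₁]`, `X₃ = [X₀, X₂]`, `X₄ = [X₁, X₂]` derived from
two sections of `E`. -/
def derivedFrame (e₀ e₁ : Π y : M, S.E y) : Fin 5 → Π y : M, TangentSpace (𝓡 n) y :=
  ![field e₀, field e₁, mlieBracket (𝓡 n) (field e₀) (field e₁),
    mlieBracket (𝓡 n) (field e₀) (mlieBracket (𝓡 n) (field e₀) (field e₁)),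
    mlieBracket (𝓡 n) (field e₁) (mlieBracket (𝓡 n) (field e₀) (field e₁))]

theorem smoothFieldOn_derivedFrame (hW : IsOpen W) (he₀ : S.IsSection W e₀)
    (he₁ : S.IsSection W e₁) (i : Fin 5) : SmoothFieldOn W (derivedFrame e₀ e₁ i) := by
  have hX₂ := SmoothFieldOn.mlieBracket hW he₀ he₁
  fin_cases i
  exacts [he₀, he₁, hX₂, SmoothFieldOn.mlieBracket hW he₀ hX₂, SmoothFieldOn.mlieBracket hW he₁ hX₂]

omit [IsManifold (𝓡 n) ∞ M] in
theorem mlieBracket_mem_of_forall_lt {ι : Type*} [LinearOrder ι] {s : Set ι}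
    {X : ι → Π y : M, TangentSpace (𝓡 n) y} {K : Submodule ℝ (TangentSpace (𝓡 n) x)}
    (h : ∀ i ∈ s, ∀ j ∈ s, i < j → mlieBracket (𝓡 n) (X i) (X j) x ∈ K) {i j : ι} (hi : i ∈ s)
    (hj : j ∈ s) : mlieBracket (𝓡 n) (X i) (X j) x ∈ K := by
  rcases lt_trichotomy i j with hij | rfl | hij
  · exact h i hi j hj hij
  · rw [mlieBracket_self]
    exact K.zero_mem
  · rw [mlieBracket_swap_apply]
    exact K.neg_mem (h j hj i hi hij)

theorem flag_succ_le {ι : Type*} [Finite ι] {X : ι → Π y : M, TangentSpace (𝓡 n) y} {s : Set ι}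
    {k : ℕ} (hk : 1 ≤ k) (hW : IsOpen W) (hX : ∀ i, SmoothFieldOn W (X i))
    (hli : ∀ y ∈ W, LinearIndepOn ℝ (X · y) s)
    (hflag : ∀ y ∈ W, S.flag k y = Submodule.span ℝ ((X · y) '' s)) (hx : x ∈ W)
    {K : Submodule ℝ (TangentSpace (𝓡 n) x)} (hXK : ∀ i ∈ s, X i x ∈ K)
    (hbracket : ∀ i ∈ s, ∀ j ∈ s, mlieBracket (𝓡 n) (X i) (X j) x ∈ K) :
    S.flag (k + 1) x ≤ K := by
  simp only [image_eq_range] at hflag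
  rw [flag, Submodule.span_le]
  rintro _ ⟨V, hV, hxV, j, hj, Z, hZ, rfl⟩
  have hflagK : S.flag k x ≤ K := by
    rw [hflag x hx, Submodule.span_le]
    rintro _ ⟨i, rfl⟩
    exact hXK i i.2
  cases hZ with
  | base Y hY => exact hflagK ((IsIterBracket.base Y hY).mem_flag hV hk hxV)
  | step Y hY j Z hZ =>
    refine mlieBracket_mem_of_mem_span (A := fun i : s => X i) (hW.inter hV)
      (fun i => (hX i).mono inter_subset_left) ⟨hx, hxV⟩ (hli x hx)
      (SmoothFieldOn.mono hY inter_subset_right)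
      ((hZ.smoothFieldOn hV).mono inter_subset_right) (fun y hy => ?_) (fun y hy => ?_)
      (fun i => hXK i i.2) fun i j => hbracket i i.2 j j.2
    · exact hflag y hy.1 ▸ (IsIterBracket.base Y hY).mem_flag hV hk hy.2
    · exact hflag y hy.1 ▸ hZ.mem_flag hV (by omega) hy.2

theorem IsOrthonormalOn.E_eq_span (hE : finrank ℝ (S.E x) = 2) (h : S.IsOrthonormalOn W e₀ e₁)
    (hx : x ∈ W) : S.E x = Submodule.span ℝ ((derivedFrame e₀ e₁ · x) '' Iio 2) := by
  apply le_antisymm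
  · intro u hu
    have hsum : u = _ • field e₀ x + _ • field e₁ x :=
      congrArg Subtype.val (h.eq_sum hE hx ⟨u, hu⟩)
    exact hsum ▸ Submodule.add_mem _
      (Submodule.smul_mem _ _ (Submodule.subset_span ⟨0, by decide, rfl⟩))
      (Submodule.smul_mem _ _ (Submodule.subset_span ⟨1, by decide, rfl⟩))
  · rw [Submodule.span_le]
    rintro _ ⟨i, hi, rfl⟩
    fin_cases i <;> first | exact absurd hi (by decide) | exact Subtype.property _

theorem linearIndepOn_of_card_eq_finrank_span {ι K V : Type*} [DivisionRing K] [AddCommGroup V]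
    [Module K V] {v : ι → V} {s : Set ι} [Fintype s] {F : Submodule K V}
    (hF : F = Submodule.span K (v '' s)) (hcard : Fintype.card s = finrank K F) :
    LinearIndepOn K v s :=
  linearIndependent_iff_card_eq_finrank_span.2
    (by rw [Set.finrank, ← image_eq_range, ← hF, hcard])

theorem IsOrthonormalOn.flag_two_eq_span (hE : ∀ x, finrank ℝ (S.E x) = 2) (hW : IsOpen W)
    (h : S.IsOrthonormalOn W e₀ e₁) (hx : x ∈ W) :
    S.flag 2 x = Submodule.span ℝ ((derivedFrame e₀ e₁ · x) '' Iio 3) := by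
  apply le_antisymm
  · have hmem : ∀ i < (3 : Fin 5), derivedFrame e₀ e₁ i x ∈
        Submodule.span ℝ ((derivedFrame e₀ e₁ · x) '' Iio 3) := fun i hi =>
      Submodule.subset_span ⟨i, hi, rfl⟩
    refine flag_succ_le le_rfl hW (smoothFieldOn_derivedFrame hW h.isSection₀ h.isSection₁)
      (fun y hy => linearIndepOn_of_card_eq_finrank_span (h.E_eq_span (hE y) hy)
        (by rw [hE y]; rfl))
      (fun y hy => by rw [S.flag_one, h.E_eq_span (hE y) hy]) hx
      (fun i hi => hmem i (lt_trans hi (by decide)))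
      fun i hi j hj => mlieBracket_mem_of_forall_lt (fun i hi j hj hij => ?_) hi hj
    obtain ⟨rfl, rfl⟩ : i = 0 ∧ j = 1 := by simp only [mem_Iio] at hi hj; omega
    exact hmem 2 (by decide)
  · have hX₁ := IsIterBracket.base e₁ h.isSection₁
    rw [Submodule.span_le]
    rintro _ ⟨i, hi, rfl⟩
    fin_cases i <;> first
      | exact absurd hi (by decide)
      | exact (IsIterBracket.base e₀ h.isSection₀).mem_flag hW (by norm_num) hx
      | exact hX₁.mem_flag hW (by norm_num) hx
      | exact (IsIterBracket.step e₀ h.isSection₀ 1 _ hX₁).mem_flag hW le_rfl hx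

theorem IsOrthonormalOn.flag_three_le_span (hE : ∀ x, finrank ℝ (S.E x) = 2)
    (hflag : ∀ x, finrank ℝ (S.flag 2 x) = 3) (hW : IsOpen W) (h : S.IsOrthonormalOn W e₀ e₁)
    (hx : x ∈ W) : S.flag 3 x ≤ Submodule.span ℝ (range (derivedFrame e₀ e₁ · x)) := by
  have hmem : ∀ i, derivedFrame e₀ e₁ i x ∈ Submodule.span ℝ (range (derivedFrame e₀ e₁ · x)) :=
    fun i => Submodule.subset_span ⟨i, rfl⟩
  refine flag_succ_le (k := 2) (s := Iio 3) (by norm_num) hW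
    (smoothFieldOn_derivedFrame hW h.isSection₀ h.isSection₁)
    (fun y hy => linearIndepOn_of_card_eq_finrank_span (h.flag_two_eq_span hE hW hy)
      (by rw [hflag y]; rfl))
    (fun y hy => h.flag_two_eq_span hE hW hy) hx (fun i _ => hmem i)
    fun i hi j hj => mlieBracket_mem_of_forall_lt (fun i hi j hj hij => ?_) hi hj
  obtain ⟨rfl, rfl⟩ | ⟨rfl, rfl⟩ | ⟨rfl, rfl⟩ :
      i = 0 ∧ j = 1 ∨ i = 0 ∧ j = 2 ∨ i = 1 ∧ j = 2 := by
    simp only [mem_Iio] at hi hj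
    omega
  exacts [hmem 2, hmem 3, hmem 4]

/-- An orthonormal frame of `E` over an open set whose derived fields form a frame of `TM` adapted
to the flag. -/
structure IsAdapted (S : Structure n M) (W : Set M) (e₀ e₁ : Π y : M, S.E y) : Prop
    extends S.IsOrthonormalOn W e₀ e₁ where
  isOpen : IsOpen W
  frame : IsLocalFrameOn (𝓡 n) (EuclideanSpace ℝ (Fin n)) ∞ (derivedFrame e₀ e₁) W
  E_eq_span : ∀ y ∈ W, S.E y = Submodule.span ℝ ((derivedFrame e₀ e₁ · y) '' Iio 2)
  flag_two_eq_span : ∀ y ∈ W, S.flag 2 y = Submodule.span ℝ ((derivedFrame e₀ e₁ · y) '' Iio 3)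

theorem IsOrthonormalOn.isAdapted (hS : S.HasGrowthVector ![2, 3, 5]) (hW : IsOpen W)
    (h : S.IsOrthonormalOn W e₀ e₁) : S.IsAdapted W e₀ e₁ := by
  have hspan : ∀ y ∈ W, ⊤ ≤ Submodule.span ℝ (range (derivedFrame e₀ e₁ · y)) := fun y hy =>
    hS.2.1 y ▸ h.flag_three_le_span hS.finrank_E (hS.finrank_flag 1) hW hy
  have hcard : ∀ y : M, Fintype.card (Fin 5) = finrank ℝ (TangentSpace (𝓡 n) y) := fun y =>
    ((finrank_tangentSpace y).trans (hS.dim_eq y)).symm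
  exact { h with
    isOpen := hW
    frame :=
      { linearIndependent := fun hy =>
          linearIndependent_of_top_le_span_of_card_eq_finrank (hspan _ hy) (hcard _)
        generating := fun hy => hspan _ hy
        contMDiffOn := smoothFieldOn_derivedFrame hW h.isSection₀ h.isSection₁ }
    E_eq_span := fun y hy => h.E_eq_span (hS.finrank_E y) hy
    flag_two_eq_span := fun y hy => h.flag_two_eq_span hS.finrank_E hW hy }

theorem exists_isAdapted (hS : S.HasGrowthVector ![2, 3, 5]) (hU : IsOpen U) (hx : x ∈ U) :
    ∃ W ⊆ U, IsOpen W ∧ x ∈ W ∧ ∃ e₀ e₁ : Π y : M, S.E y, S.IsAdapted W e₀ e₁ := by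
  obtain ⟨W, hW, hxW, e₀, e₁, h⟩ := exists_isOrthonormalOn (hS.finrank_E x)
  exact ⟨W ∩ U, inter_subset_right, hW.inter hU, ⟨hxW, hx⟩, e₀, e₁,
    (h.mono inter_subset_left).isAdapted hS (hW.inter hU)⟩

end DerivedFrame

end Structure

namespace Structure

variable {S : Structure n M} {U W : Set M} {e₀ e₁ : Π y : M, S.E y} {x : M}

section Coframe

theorem IsAdapted.mem_E_iff (h : S.IsAdapted W e₀ e₁) (hx : x ∈ W) {v : TangentSpace (𝓡 n) x} :
    v ∈ S.E x ↔ ∀ i ≥ 2, h.frame.coeff i x v = 0 := by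
  simp only [h.E_eq_span x hx, mem_span_image_iff_coeff h.frame hx, mem_Iio, not_lt, ge_iff_le]

theorem IsAdapted.mem_flag_two_iff (h : S.IsAdapted W e₀ e₁) (hx : x ∈ W)
    {v : TangentSpace (𝓡 n) x} : v ∈ S.flag 2 x ↔ ∀ i ≥ 3, h.frame.coeff i x v = 0 := by
  simp only [h.flag_two_eq_span x hx, mem_span_image_iff_coeff h.frame hx, mem_Iio, not_lt,
    ge_iff_le]

theorem IsAdapted.eq_sum_of_mem_E (h : S.IsAdapted W e₀ e₁) (hx : x ∈ W)
    {v : TangentSpace (𝓡 n) x} (hv : v ∈ S.E x) :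
    v = h.frame.coeff 0 x v • derivedFrame e₀ e₁ 0 x +
      h.frame.coeff 1 x v • derivedFrame e₀ e₁ 1 x := by
  rw [h.mem_E_iff hx] at hv
  conv_lhs => rw [eq_sum_coeff_smul h.frame hx v, Fin.sum_univ_five, hv 2 le_rfl,
    hv 3 (by decide), hv 4 (by decide)]
  module

theorem IsAdapted.eq_sum_of_mem_flag_two (h : S.IsAdapted W e₀ e₁) (hx : x ∈ W)
    {v : TangentSpace (𝓡 n) x} (hv : v ∈ S.flag 2 x) :
    v = h.frame.coeff 0 x v • derivedFrame e₀ e₁ 0 x +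
      h.frame.coeff 1 x v • derivedFrame e₀ e₁ 1 x +
      h.frame.coeff 2 x v • derivedFrame e₀ e₁ 2 x := by
  rw [h.mem_flag_two_iff hx] at hv
  conv_lhs => rw [eq_sum_coeff_smul h.frame hx v, Fin.sum_univ_five, hv 3 le_rfl,
    hv 4 (by decide)]
  module

theorem IsAdapted.coeff_zero_coe (hE : finrank ℝ (S.E x) = 2) (h : S.IsAdapted W e₀ e₁)
    (hx : x ∈ W) (u : S.E x) :
    h.frame.coeff 0 x (u : TangentSpace (𝓡 n) x) = S.g x (e₀ x) u := by
  have hsum : (u : TangentSpace (𝓡 n) x) = S.g x (e₀ x) u • derivedFrame e₀ e₁ 0 x +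
      S.g x (e₁ x) u • derivedFrame e₀ e₁ 1 x := congrArg Subtype.val (h.eq_sum hE hx u)
  rw [hsum]
  simp [coeff_apply_self h.frame hx]

theorem IsAdapted.coeff_one_coe (hE : finrank ℝ (S.E x) = 2) (h : S.IsAdapted W e₀ e₁)
    (hx : x ∈ W) (u : S.E x) :
    h.frame.coeff 1 x (u : TangentSpace (𝓡 n) x) = S.g x (e₁ x) u := by
  have hsum : (u : TangentSpace (𝓡 n) x) = S.g x (e₀ x) u • derivedFrame e₀ e₁ 0 x +
      S.g x (e₁ x) u • derivedFrame e₀ e₁ 1 x := congrArg Subtype.val (h.eq_sum hE hx u)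
  rw [hsum]
  simp [coeff_apply_self h.frame hx]

/-- The one-forms dual to an adapted frame. -/
def IsAdapted.coform (h : S.IsAdapted W e₀ e₁) (i : Fin 5) :
    Π x : M, TangentSpace (𝓡 n) x [⋀^Fin 1]→L[ℝ] ℝ :=
  oneForm (h.frame.coeff i)

theorem IsAdapted.coform_apply (h : S.IsAdapted W e₀ e₁) (i : Fin 5) (v : TangentSpace (𝓡 n) x) :
    h.coform i x ![v] = h.frame.coeff i x v := rfl

theorem IsAdapted.smoothFormOn_coform (h : S.IsAdapted W e₀ e₁) (i : Fin 5) :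
    SmoothFormOn W (h.coform i) :=
  smoothFormOn_oneForm fun _ hW'W hW' _ hY => contMDiffOn_coeff h.frame h.isOpen hW' hW'W hY i

theorem IsAdapted.bilin_mextDeriv_coform (h : S.IsAdapted W e₀ e₁) (i j k : Fin 5) (hx : x ∈ W) :
    bilin (mextDeriv (h.coform i) x) (derivedFrame e₀ e₁ j x) (derivedFrame e₀ e₁ k x) =
      -h.frame.coeff i x
        (mlieBracket (𝓡 n) (derivedFrame e₀ e₁ j) (derivedFrame e₀ e₁ k) x) := by
  rw [← h.coform_apply, (h.smoothFormOn_coform i).apply_mlieBracket_of_const h.isOpen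
    (h.frame.contMDiffOn j) (h.frame.contMDiffOn k) hx
    (fun y hy => coeff_apply_self h.frame hy i j) (fun y hy => coeff_apply_self h.frame hy i k),
    bilin_apply, neg_neg]

theorem IsAdapted.bilin_mextDeriv_coform_of_mem (h : S.IsAdapted W e₀ e₁) (i : Fin 5)
    (hx : x ∈ W) {u v : TangentSpace (𝓡 n) x} (hu : u ∈ S.E x) (hv : v ∈ S.flag 2 x) :
    bilin (mextDeriv (h.coform i) x) u v = -h.frame.coeff i x
      ((h.frame.coeff 0 x u * h.frame.coeff 1 x v - h.frame.coeff 1 x u * h.frame.coeff 0 x v) •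
          derivedFrame e₀ e₁ 2 x +
        h.frame.coeff 2 x v • (h.frame.coeff 0 x u • derivedFrame e₀ e₁ 3 x +
          h.frame.coeff 1 x u • derivedFrame e₀ e₁ 4 x)) := by
  have hX₂ := h.bilin_mextDeriv_coform i 0 1 hx
  have hX₃ := h.bilin_mextDeriv_coform i 0 2 hx
  have hX₄ := h.bilin_mextDeriv_coform i 1 2 hx
  change _ = -h.frame.coeff i x (derivedFrame e₀ e₁ 2 x) at hX₂
  change _ = -h.frame.coeff i x (derivedFrame e₀ e₁ 3 x) at hX₃
  change _ = -h.frame.coeff i x (derivedFrame e₀ e₁ 4 x) at hX₄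
  have hswap := (bilin_isAlt (mextDeriv (h.coform i) x)).neg (derivedFrame e₀ e₁ 0 x)
    (derivedFrame e₀ e₁ 1 x)
  conv_lhs => rw [h.eq_sum_of_mem_E hx hu, h.eq_sum_of_mem_flag_two hx hv]
  simp only [map_add, map_smul, LinearMap.add_apply, LinearMap.smul_apply,
    (bilin_isAlt _).self_eq_zero, smul_eq_mul, hX₂, hX₃, hX₄, ← hswap]
  ring

theorem IsAdapted.coeff_mlieBracket (h : S.IsAdapted W e₀ e₁) (hU : IsOpen U) (hUW : U ⊆ W)
    {Y Z : Π x : M, TangentSpace (𝓡 n) x} (hY : SmoothFieldOn U Y) (hZ : SmoothFieldOn U Z)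
    (hYE : ∀ y ∈ U, Y y ∈ S.E y) (hZE : ∀ y ∈ U, Z y ∈ S.flag 2 y) (hx : x ∈ U) {i : Fin 5}
    (hYi : ∀ y ∈ U, h.frame.coeff i y (Y y) = 0) (hZi : ∀ y ∈ U, h.frame.coeff i y (Z y) = 0) :
    h.frame.coeff i x (mlieBracket (𝓡 n) Y Z x) = h.frame.coeff i x
      ((h.frame.coeff 0 x (Y x) * h.frame.coeff 1 x (Z x) -
          h.frame.coeff 1 x (Y x) * h.frame.coeff 0 x (Z x)) • derivedFrame e₀ e₁ 2 x +
        h.frame.coeff 2 x (Z x) • (h.frame.coeff 0 x (Y x) • derivedFrame e₀ e₁ 3 x +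
          h.frame.coeff 1 x (Y x) • derivedFrame e₀ e₁ 4 x)) := by
  rw [← h.coform_apply, ((h.smoothFormOn_coform i).mono hUW).apply_mlieBracket_of_const hU hY hZ hx
    hYi hZi, ← bilin_apply,
    h.bilin_mextDeriv_coform_of_mem i (hUW hx) (hYE x hx) (hZE x hx), neg_neg]

theorem IsAdapted.coeff_two_mlieBracket (hE : ∀ x, finrank ℝ (S.E x) = 2)
    (h : S.IsAdapted W e₀ e₁) (hU : IsOpen U) (hUW : U ⊆ W) {Y Z : Π x : M, S.E x}
    (hY : S.IsSection U Y) (hZ : S.IsSection U Z) (hx : x ∈ U) :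
    h.frame.coeff 2 x (mlieBracket (𝓡 n) (field Y) (field Z) x) =
      S.g x (S.rotation e₀ e₁ x (Y x)) (Z x) := by
  have hzero : ∀ {y}, y ∈ U → ∀ u : S.E y, h.frame.coeff 2 y (u : TangentSpace (𝓡 n) y) = 0 :=
    fun hy u => (h.mem_E_iff (hUW hy)).1 u.2 2 le_rfl
  rw [h.coeff_mlieBracket (Y := field Y) (Z := field Z) hU hUW hY hZ (fun y _ => (Y y).2)
    (fun y hy => (IsIterBracket.base Z hZ).mem_flag hU one_le_two hy) hx
    (fun y hy => hzero hy (Y y)) (fun y hy => hzero hy (Z y))]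
  have hY₀ : h.frame.coeff 0 x (field Y x) = _ := h.coeff_zero_coe (hE x) (hUW hx) (Y x)
  have hY₁ : h.frame.coeff 1 x (field Y x) = _ := h.coeff_one_coe (hE x) (hUW hx) (Y x)
  have hZ₀ : h.frame.coeff 0 x (field Z x) = _ := h.coeff_zero_coe (hE x) (hUW hx) (Z x)
  have hZ₁ : h.frame.coeff 1 x (field Z x) = _ := h.coeff_one_coe (hE x) (hUW hx) (Z x)
  rw [hY₀, hY₁, hZ₀, hZ₁, rotation_apply]
  simp [coeff_apply_self h.frame (hUW hx)]

end Coframe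

section Phi

/-- The form `φ` in an adapted frame: it maps `X₃` to `e₁` and `X₄` to `-e₀`. -/
def IsAdapted.phi (h : S.IsAdapted W e₀ e₁) (x : M) : TangentSpace (𝓡 n) x →ₗ[ℝ] S.E x :=
  (h.frame.coeff 3 x).smulRight (e₁ x) - (h.frame.coeff 4 x).smulRight (e₀ x)

theorem IsAdapted.phi_apply (h : S.IsAdapted W e₀ e₁) (x : M) (v : TangentSpace (𝓡 n) x) :
    h.phi x v = h.frame.coeff 3 x v • e₁ x - h.frame.coeff 4 x v • e₀ x := rfl

theorem IsAdapted.ker_phi (h : S.IsAdapted W e₀ e₁) (hx : x ∈ W) :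
    LinearMap.ker (h.phi x) = S.flag 2 x := by
  ext v
  rw [LinearMap.mem_ker, h.phi_apply, h.mem_flag_two_iff hx]
  constructor
  · intro hzero
    obtain ⟨hfour, hthree⟩ := LinearIndependent.pair_iff.1 (h.linearIndependent hx)
      (-h.frame.coeff 4 x v) (h.frame.coeff 3 x v) (by rw [← hzero]; module)
    intro i hi
    obtain rfl | rfl : i = 3 ∨ i = 4 := by omega
    exacts [hthree, neg_eq_zero.1 hfour]
  · intro hv
    rw [hv 3 le_rfl, hv 4 (by decide), zero_smul, zero_smul, sub_zero]

theorem IsAdapted.phi_mlieBracket (hE : ∀ x, finrank ℝ (S.E x) = 2) (h : S.IsAdapted W e₀ e₁)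
    (hU : IsOpen U) (hUW : U ⊆ W) {Y : Π x : M, S.E x} {Z : Π x : M, TangentSpace (𝓡 n) x}
    (hY : S.IsSection U Y) (hZ : SmoothFieldOn U Z) (hZE : ∀ y ∈ U, Z y ∈ S.flag 2 y)
    (hx : x ∈ U) : h.phi x (mlieBracket (𝓡 n) (field Y) Z x) =
      h.frame.coeff 2 x (Z x) • S.rotation e₀ e₁ x (Y x) := by
  have hY₀ : h.frame.coeff 0 x (field Y x) = _ := h.coeff_zero_coe (hE x) (hUW hx) (Y x)
  have hY₁ : h.frame.coeff 1 x (field Y x) = _ := h.coeff_one_coe (hE x) (hUW hx) (Y x)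
  have hcoeff : ∀ i ≥ (3 : Fin 5), _ := fun i hi =>
    h.coeff_mlieBracket (i := i) (Y := field Y) hU hUW hY hZ
    (fun y _ => (Y y).2) hZE hx
    (fun y hy => (h.mem_E_iff (hUW hy)).1 (Y y).2 i (le_trans (by decide) hi))
    (fun y hy => (h.mem_flag_two_iff (hUW hy)).1 (hZE y hy) i hi)
  rw [h.phi_apply, hcoeff 3 le_rfl, hcoeff 4 (by decide), rotation_apply, hY₀, hY₁]
  simp only [map_add, map_smul, coeff_apply_self h.frame (hUW hx), Fin.reduceEq, ↓reduceIte,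
    smul_eq_mul, mul_zero, mul_one, add_zero, zero_add]
  module

/-- The defining properties of `φ` over the open set `U`. -/
structure IsPhiOn (S : Structure n M) (U : Set M)
    (φ : Π x : M, TangentSpace (𝓡 n) x →ₗ[ℝ] S.E x) : Prop where
  smooth : ∀ W ⊆ U, IsOpen W → ∀ X : Π x : M, TangentSpace (𝓡 n) x, SmoothFieldOn W X →
    S.IsSection W (fun x => φ x (X x))
  ker_eq : ∀ x ∈ U, LinearMap.ker (φ x) = S.flag 2 x
  bracket : ∀ W ⊆ U, IsOpen W → ∀ J : Π x : M, S.E x →ₗ[ℝ] S.E x, S.IsRotationOn W J →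
    ∀ X : Π x : M, S.E x, S.IsSection W X → ∀ x ∈ W,
      φ x (mlieBracket (𝓡 n) (field X) (mlieBracket (𝓡 n) (field X)
        (field fun y => J y (X y))) x) = S.g x (X x) (X x) • J x (X x)

variable {φ φ' : Π x : M, TangentSpace (𝓡 n) x →ₗ[ℝ] S.E x}

theorem isPhiOn_univ_iff : S.IsPhiOn univ φ ↔ S.IsPhi φ :=
  ⟨fun h => ⟨fun W hW => h.1 W (subset_univ W) hW, fun x => h.2 x (mem_univ x),
    fun W hW => h.3 W (subset_univ W) hW⟩,
   fun h => ⟨fun W _ hW => h.1 W hW, fun x _ => h.2 x, fun W _ hW => h.3 W hW⟩⟩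

theorem IsPhiOn.mono (h : S.IsPhiOn U φ) (hWU : W ⊆ U) : S.IsPhiOn W φ :=
  ⟨fun W' hW' => h.1 W' (hW'.trans hWU), fun x hx => h.2 x (hWU hx),
    fun W' hW' => h.3 W' (hW'.trans hWU)⟩

theorem IsAdapted.isPhiOn (hE : ∀ x, finrank ℝ (S.E x) = 2) (h : S.IsAdapted W e₀ e₁) :
    S.IsPhiOn W h.phi where
  smooth W' hW'W hW' X hX :=
    ((h.isSection₁.mono hW'W).smul (contMDiffOn_coeff h.frame h.isOpen hW' hW'W hX 3)).sub
      ((h.isSection₀.mono hW'W).smul (contMDiffOn_coeff h.frame h.isOpen hW' hW'W hX 4))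
  ker_eq _ hx := h.ker_phi hx
  bracket W' hW'W hW' J hJ X hX x hx := by
    have hJX := hJ.smooth W' subset_rfl hW' X hX
    have hbracket : S.IsIterBracket W' 2
        (mlieBracket (𝓡 n) (field X) (field fun y => J y (X y))) :=
      .step X hX 1 _ (.base _ hJX)
    rw [h.phi_mlieBracket hE hW' hW'W hX (hbracket.smoothFieldOn hW')
      (fun y hy => hbracket.mem_flag hW' le_rfl hy) hx]
    refine (congrArg (· • _) (h.coeff_two_mlieBracket hE hW' hW'W hX hJX hx)).trans ?_
    -- Both sides are invariant under `J ↦ -J`, so `J` may be taken to be the rotation of the frame.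
    have hg := h.g_rotation (hE x) (hW'W hx) (X x) (X x)
    obtain hJx | hJx := (h.isRotationOn hE).eq_or_eq_neg (hE x) h.isOpen hW' hJ (hW'W hx) hx
    · rw [hJx, hg]
    · rw [hJx, LinearMap.neg_apply, map_neg, hg, neg_smul, smul_neg]

theorem eq_of_ker_eq_of_map_eqLocus_eq_top {R V V' : Type*} [Ring R] [AddCommGroup V] [Module R V]
    [AddCommGroup V'] [Module R V'] {f f' : V →ₗ[R] V'} (hker : LinearMap.ker f = LinearMap.ker f')
    (hmap : (LinearMap.eqLocus f f').map f = ⊤) : f = f' := by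
  have hle : LinearMap.ker f ≤ LinearMap.eqLocus f f' := fun v hv => by
    rw [LinearMap.mem_eqLocus, LinearMap.mem_ker.1 hv, LinearMap.mem_ker.1 (hker ▸ hv)]
  rw [← LinearMap.eqLocus_eq_top, ← sup_eq_left.2 hle, ← Submodule.comap_map_eq, hmap,
    Submodule.comap_top]

theorem IsPhiOn.eq_of_isOpen (hE : ∀ x, finrank ℝ (S.E x) = 2) (hU : IsOpen U)
    (hφ : S.IsPhiOn U φ) (hφ' : S.IsPhiOn U φ') (hx : x ∈ U) : φ x = φ' x := by
  obtain ⟨W, hW, hxW, e₀, e₁, h⟩ := exists_isOrthonormalOn (hE x)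
  have hmem : ∀ X : Π y : M, S.E y, S.IsSection W X → S.g x (X x) (X x) = 1 →
      S.rotation e₀ e₁ x (X x) ∈ (LinearMap.eqLocus (φ x) (φ' x)).map (φ x) := by
    intro X hX hnorm
    have hrot := (h.isRotationOn hE).mono (inter_subset_left (t := U))
    have hXφ := fun {φ} (hφ : S.IsPhiOn U φ) => hφ.bracket (W ∩ U) inter_subset_right
      (hW.inter hU) _ hrot X (hX.mono inter_subset_left) x ⟨hxW, hx⟩
    rw [hnorm, one_smul] at hXφ
    exact ⟨_, (hXφ hφ).trans (hXφ hφ').symm, hXφ hφ⟩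
  have he₀ := hmem e₀ h.isSection₀ (h.norm₀ x hxW)
  have he₁ := hmem e₁ h.isSection₁ (h.norm₁ x hxW)
  rw [rotation_apply, h.norm₀ x hxW, h.orth' hxW, one_smul, zero_smul, sub_zero] at he₀
  rw [rotation_apply, h.norm₁ x hxW, h.orth x hxW, one_smul, zero_smul, zero_sub] at he₁
  refine eq_of_ker_eq_of_map_eqLocus_eq_top ((hφ.ker_eq x hx).trans (hφ'.ker_eq x hx).symm)
    (Submodule.eq_top_iff'.2 fun u => ?_)
  rw [h.eq_sum (hE x) hxW u]
  exact add_mem (Submodule.smul_mem _ _ (neg_mem_iff.1 he₁)) (Submodule.smul_mem _ _ he₀)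

theorem isPhiOn_of_locally
    (h : ∀ x ∈ U, ∃ W ⊆ U, IsOpen W ∧ x ∈ W ∧ ∃ φ', S.IsPhiOn W φ' ∧ ∀ y ∈ W, φ y = φ' y) :
    S.IsPhiOn U φ where
  smooth W' hW'U hW' X hX := by
    refine smoothFieldOn_of_locally fun x hx => ?_
    obtain ⟨W, -, hW, hxW, φ', hφ', heq⟩ := h x (hW'U hx)
    refine ⟨W' ∩ W, hW'.inter hW, ⟨hx, hxW⟩, SmoothFieldOn.congr (hφ'.smooth _ inter_subset_right
      (hW'.inter hW) X (hX.mono inter_subset_left)) fun y hy => ?_⟩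
    exact congrArg (fun l : TangentSpace (𝓡 n) y →ₗ[ℝ] S.E y => (l (X y)).1) (heq y hy.2)
  ker_eq x hx := by
    obtain ⟨W, -, -, hxW, φ', hφ', heq⟩ := h x hx
    rw [heq x hxW, hφ'.ker_eq x hxW]
  bracket W' hW'U hW' J hJ X hX x hx := by
    obtain ⟨W, -, hW, hxW, φ', hφ', heq⟩ := h x (hW'U hx)
    rw [heq x hxW]
    exact hφ'.bracket (W' ∩ W) inter_subset_right (hW'.inter hW) J (hJ.mono inter_subset_left) X
      (hX.mono inter_subset_left) x ⟨hx, hxW⟩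

theorem existsUnique_isPhi (hS : S.HasGrowthVector ![2, 3, 5]) :
    ∃! φ : Π x : M, TangentSpace (𝓡 n) x →ₗ[ℝ] S.E x, S.IsPhi φ := by
  obtain ⟨φ, hφ⟩ := exists_of_locally_unique (P := S.IsPhiOn) (U := univ)
    (fun _ _ hWU h => h.mono hWU) (fun hU h h' x hx => h.eq_of_isOpen hS.finrank_E hU h' hx)
    (fun h => isPhiOn_of_locally h) (fun x _ => by
      obtain ⟨W, hWU, hW, hxW, e₀, e₁, h⟩ := exists_isAdapted hS isOpen_univ (mem_univ x)
      exact ⟨W, hWU, hW, hxW, _, h.isPhiOn hS.finrank_E⟩)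
  refine ⟨φ, isPhiOn_univ_iff.1 hφ, fun φ' hφ' => funext fun x => ?_⟩
  exact (isPhiOn_univ_iff.2 hφ').eq_of_isOpen hS.finrank_E isOpen_univ hφ (mem_univ x)

end Phi

end Structure

section Subbundle

variable {U W : Set M} {F : Π x : M, Submodule ℝ (TangentSpace (𝓡 n) x)} {r : ℕ}

theorem IsSubbundleOn.mono (h : IsSubbundleOn U F r) (hW : IsOpen W) (hWU : W ⊆ U) :
    IsSubbundleOn W F r := by
  intro x hx
  obtain ⟨W', hW', hxW', -, X, hX, hspan⟩ := h x (hWU hx)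
  exact ⟨W' ∩ W, hW'.inter hW, ⟨hxW', hx⟩, inter_subset_right, X,
    fun i => (hX i).mono inter_subset_left, fun y hy => hspan y hy.1⟩

theorem isSubbundleOn_of_locally
    (h : ∀ x ∈ U, ∃ W ⊆ U, x ∈ W ∧ ∃ F', IsSubbundleOn W F' r ∧ ∀ y ∈ W, F y = F' y) :
    IsSubbundleOn U F r := by
  intro x hx
  obtain ⟨W, hWU, hxW, F', hF', heq⟩ := h x hx
  obtain ⟨W', hW', hxW', hW'W, X, hX, hspan⟩ := hF' x hxW
  exact ⟨W', hW', hxW', hW'W.trans hWU, X, hX,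
    fun y hy => ⟨(hspan y hy).1, (hspan y hy).2.trans (heq y (hW'W hy)).symm⟩⟩

theorem isSubbundleOn_span_image {ι : Type*} [Finite ι] (hW : IsOpen W)
    {X : ι → Π x : M, TangentSpace (𝓡 n) x} (hX : ∀ i, SmoothFieldOn W (X i))
    (hli : ∀ x ∈ W, LinearIndependent ℝ (X · x)) (s : Set ι) :
    IsSubbundleOn W (fun x => Submodule.span ℝ ((X · x) '' s)) (Nat.card s) := fun x hx =>
  ⟨W, hW, hx, subset_rfl, fun i => X ((Finite.equivFin s).symm i), fun _ => hX _, fun y hy =>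
    ⟨(hli y hy).comp _ (Subtype.val_injective.comp (Equiv.injective _)), by
      simp only [image_eq_range]
      exact congrArg _ ((Finite.equivFin s).symm.surjective.range_comp fun i : s => X i y)⟩⟩

end Subbundle

namespace Structure

variable {S : Structure n M} {U W : Set M} {x : M} {s : ℕ}

section Grading

variable {V V' : Fin s → Π x : M, Submodule ℝ (TangentSpace (𝓡 n) x)}

theorem IsGradingOn.mono (h : S.IsGradingOn U V) (hW : IsOpen W) (hWU : W ⊆ U) :
    S.IsGradingOn W V where
  isSubbundle i := (h.isSubbundle i).imp fun _ hr => hr.mono hW hWU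
  isInternal x hx := h.isInternal x (hWU hx)
  flag_eq x hx := h.flag_eq x (hWU hx)

theorem IsGradingOn.flag_eq_biSup (h : S.IsGradingOn U V) (hx : x ∈ U) {k : ℕ} (hk : k ≤ s) :
    S.flag k x = ⨆ i ∈ {i : Fin s | i < k}, V i x := by
  rw [h.flag_eq x hx k hk, iSup_subtype]
  rfl

theorem IsGradingOn.flag_succ (h : S.IsGradingOn U V) (hx : x ∈ U) (k : Fin s) :
    S.flag (k + 1) x = S.flag k x ⊔ V k x := by
  have hinsert : {i : Fin s | (i : ℕ) < k + 1} = insert k {i : Fin s | (i : ℕ) < k} := by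
    ext i
    simp only [mem_ofPred_eq, mem_insert_iff, Fin.ext_iff]
    omega
  rw [h.flag_eq_biSup hx k.2, h.flag_eq_biSup hx k.2.le, hinsert, iSup_insert, sup_comm]

theorem IsGradingOn.disjoint_flag (h : S.IsGradingOn U V) (hx : x ∈ U) (k : Fin s) :
    Disjoint (S.flag k x) (V k x) := by
  rw [h.flag_eq_biSup hx k.2.le]
  have hindep := (h.isInternal x hx).submodule_iSupIndep
  exact (hindep.disjoint_biSup (y := {i : Fin s | (i : ℕ) < k}) (lt_irrefl (k : ℕ))).symm

theorem IsGradingOn.finrank_add (h : S.IsGradingOn U V) (hx : x ∈ U) (k : Fin s) :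
    finrank ℝ (S.flag k x) + finrank ℝ (V k x) = finrank ℝ (S.flag (k + 1) x) := by
  rw [← Submodule.finrank_sup_add_finrank_inf_eq, (h.disjoint_flag hx k).eq_bot, finrank_bot,
    h.flag_succ hx k, add_zero]

theorem HasGrowthVector.finrank_flag_eq {r : Fin s → ℕ} (hS : S.HasGrowthVector r) {k : ℕ}
    (hk : k ≤ s) (x y : M) : finrank ℝ (S.flag k x) = finrank ℝ (S.flag k y) := by
  cases k with
  | zero => rw [flag_zero, flag_zero, finrank_bot, finrank_bot]
  | succ k => exact (hS.finrank_flag ⟨k, hk⟩ x).trans (hS.finrank_flag ⟨k, hk⟩ y).symm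

theorem isGradingOn_of_locally {r : Fin s → ℕ} (hS : S.HasGrowthVector r)
    (h : ∀ x ∈ U, ∃ W ⊆ U, x ∈ W ∧ ∃ V', S.IsGradingOn W V' ∧ ∀ y ∈ W, (V · y) = (V' · y)) :
    S.IsGradingOn U V where
  isSubbundle i := by
    obtain rfl | ⟨x₀, hx₀⟩ := U.eq_empty_or_nonempty
    · exact ⟨0, fun _ hx => hx.elim⟩
    refine ⟨finrank ℝ (V i x₀), isSubbundleOn_of_locally fun x hx => ?_⟩
    obtain ⟨W₀, -, hxW₀, V₀, hV₀, heq₀⟩ := h x₀ hx₀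
    obtain ⟨W, hWU, hxW, V', hV', heq⟩ := h x hx
    obtain ⟨m, hm⟩ := hV'.isSubbundle i
    have hrank : finrank ℝ (V i x₀) = m := by
      have hsum₀ := hV₀.finrank_add hxW₀ i
      have hsum := hV'.finrank_add hxW i
      rw [hS.finrank_flag_eq i.2.le x₀ x, hS.finrank_flag_eq (k := i + 1) i.2 x₀ x] at hsum₀
      rw [congrFun (heq₀ x₀ hxW₀) i, ← hm.finrank_eq hxW]
      omega
    exact ⟨W, hWU, hxW, V' i, hrank ▸ hm, fun y hy => congrFun (heq y hy) i⟩
  isInternal x hx := by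
    obtain ⟨W, -, hxW, V', hV', heq⟩ := h x hx
    exact heq x hxW ▸ hV'.isInternal x hxW
  flag_eq x hx k hk := by
    obtain ⟨W, -, hxW, V', hV', heq⟩ := h x hx
    rw [hV'.flag_eq x hxW k hk]
    exact iSup_congr fun i => (congrFun (heq x hxW) i).symm

theorem isGradingOn_span_preimage {ι : Type*} [Finite ι] (hW : IsOpen W)
    {Z : ι → Π x : M, TangentSpace (𝓡 n) x}
    (hZ : IsLocalFrameOn (𝓡 n) (EuclideanSpace ℝ (Fin n)) ∞ Z W) (c : ι → Fin s)
    (hflag : ∀ x ∈ W, ∀ k ≤ s, S.flag k x = Submodule.span ℝ ((Z · x) '' {i | c i < k})) :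
    S.IsGradingOn W (fun k x => Submodule.span ℝ ((Z · x) '' (c ⁻¹' {k}))) where
  isSubbundle k := ⟨_, isSubbundleOn_span_image hW hZ.contMDiffOn
    (fun _ hx => hZ.linearIndependent hx) _⟩
  isInternal x hx := by
    rw [DirectSum.isInternal_submodule_iff_iSupIndep_and_iSup_eq_top]
    constructor
    · intro k
      refine ((hZ.linearIndependent hx).disjoint_span_image
        (disjoint_compl_right (a := c ⁻¹' {k}))).mono_right (iSup₂_le fun j hj => ?_)
      exact Submodule.span_mono (image_mono fun i hi hik => hj (hi.symm.trans hik))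
    · refine top_le_iff.1 ((hZ.generating hx).trans (Submodule.span_le.2 ?_))
      rintro _ ⟨i, rfl⟩
      exact Submodule.mem_iSup_of_mem (c i) (Submodule.subset_span ⟨i, rfl, rfl⟩)
  flag_eq x hx k hk := by
    rw [hflag x hx k hk, ← Submodule.span_iUnion, ← image_iUnion]
    congr 2
    ext i
    simp

end Grading

section StepThree

variable {V : Fin 3 → Π x : M, Submodule ℝ (TangentSpace (𝓡 n) x)}

theorem IsGradingOn.eq_E (h : S.IsGradingOn U V) (hx : x ∈ U) : V 0 x = S.E x := by
  have hflag := h.flag_succ hx 0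
  rwa [Fin.val_zero, zero_add, flag_one, flag_zero, bot_sup_eq, eq_comm] at hflag

theorem IsGradingOn.flag_two_eq_sup (h : S.IsGradingOn U V) (hx : x ∈ U) :
    S.flag 2 x = S.E x ⊔ V 1 x :=
  S.flag_one x ▸ h.flag_succ hx 1

theorem IsGradingOn.flag_two_sup_eq_top (h : S.IsGradingOn U V) (htop : S.flag 3 x = ⊤)
    (hx : x ∈ U) : S.flag 2 x ⊔ V 2 x = ⊤ :=
  (h.flag_succ hx 2).symm.trans htop

end StepThree

end Structure

section Unitriangular

variable {ι K T : Type*} [LinearOrder ι] [WellFoundedLT ι] [DivisionRing K] [AddCommGroup T]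
  [Module K T] {v w : ι → T}

theorem span_image_eq_of_sub_mem_span_Iio (h : ∀ i, w i - v i ∈ Submodule.span K (v '' Iio i))
    {s : Set ι} (hs : IsLowerSet s) : Submodule.span K (w '' s) = Submodule.span K (v '' s) := by
  have hIio : ∀ i ∈ s, Submodule.span K (v '' Iio i) ≤ Submodule.span K (v '' s) := fun i hi =>
    Submodule.span_mono (image_mono fun j hj => hs hj.le hi)
  apply le_antisymm <;> rw [Submodule.span_le] <;> rintro _ ⟨i, hi, rfl⟩
  · rw [← sub_add_cancel (w i) (v i)]
    exact add_mem (hIio i hi (h i)) (Submodule.subset_span ⟨i, hi, rfl⟩)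
  · induction i using WellFoundedLT.induction with
    | _ i ih =>
      have hle : Submodule.span K (v '' Iio i) ≤ Submodule.span K (w '' s) :=
        Submodule.span_le.2 fun _ ⟨j, hj, hvj⟩ => hvj ▸ ih j hj (hs hj.le hi)
      rw [← sub_sub_cancel (w i) (v i)]
      exact sub_mem (Submodule.subset_span ⟨i, hi, rfl⟩) (hle (h i))

end Unitriangular

theorem ker_eq_of_le_of_sup_span_singleton_eq_top {K T : Type*} [DivisionRing K] [AddCommGroup T]
    [Module K T] {f : T →ₗ[K] K} {F : Submodule K T} {a : T} (hF : F ≤ LinearMap.ker f)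
    (htop : F ⊔ Submodule.span K {a} = ⊤) (ha : f a ≠ 0) : LinearMap.ker f = F := by
  refine le_antisymm (fun v hv => ?_) hF
  obtain ⟨w, hw, _, hc, rfl⟩ := Submodule.mem_sup.1 (htop.ge (Submodule.mem_top (x := v)))
  obtain ⟨c, rfl⟩ := Submodule.mem_span_singleton.1 hc
  have hzero : c * f a = 0 := by
    simpa [LinearMap.mem_ker.1 (hF hw)] using LinearMap.mem_ker.1 hv
  rwa [(mul_eq_zero_iff_right ha).1 hzero, zero_smul, add_zero]

theorem smoothFormOn_of_locally {k : ℕ} {U : Set M}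
    {α : Π x : M, TangentSpace (𝓡 n) x [⋀^Fin k]→L[ℝ] ℝ}
    (h : ∀ x ∈ U, ∃ W ⊆ U, IsOpen W ∧ x ∈ W ∧ ∃ β, SmoothFormOn W β ∧ ∀ y ∈ W, α y = β y) :
    SmoothFormOn U α := by
  intro W hWU hW X hX x hx
  obtain ⟨W', -, hW', hxW', β, hβ, heq⟩ := h x (hWU hx)
  have hβX := hβ (W' ∩ W) inter_subset_left (hW'.inter hW) X
    (fun i => (hX i).mono inter_subset_right)
  refine ((hβX x ⟨hxW', hx⟩).contMDiffAt ((hW'.inter hW).mem_nhds ⟨hxW', hx⟩)).congr_of_eventuallyEq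
    ?_ |>.contMDiffWithinAt
  filter_upwards [hW'.mem_nhds hxW'] with y hy
  rw [heq y hy]

namespace Structure

variable {S : Structure n M} {U W : Set M} {e₀ e₁ : Π y : M, S.E y} {x : M}

section AdaptedRotation

theorem IsRotationOn.exists_isAdapted (hS : S.HasGrowthVector ![2, 3, 5]) (hU : IsOpen U)
    {J : Π x : M, S.E x →ₗ[ℝ] S.E x} (hJ : S.IsRotationOn U J) (hx : x ∈ U) :
    ∃ W ⊆ U, IsOpen W ∧ x ∈ W ∧ ∃ e₀ e₁ : Π y : M, S.E y,
      S.IsAdapted W e₀ e₁ ∧ ∀ y ∈ W, J y = S.rotation e₀ e₁ y := by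
  have : Nontrivial (S.E x) := nontrivial_of_finrank_eq_succ (hS.finrank_E x)
  obtain ⟨W, hWU, hW, hxW, e₀, h⟩ := hJ.exists_isOrthonormalOn hU hx
  exact ⟨W, hWU, hW, hxW, e₀, _, h.isAdapted hS hW,
    fun y hy => hJ.eq_rotation (hS.finrank_E y) hWU h hy⟩

theorem IsAdapted.flag_two_eq_sup (h : S.IsAdapted W e₀ e₁) (hx : x ∈ W) :
    S.flag 2 x = S.E x ⊔ Submodule.span ℝ {derivedFrame e₀ e₁ 2 x} := by
  have hinsert : Iio (3 : Fin 5) = insert 2 (Iio 2) := by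
    ext i
    simp only [mem_Iio, mem_insert_iff]
    omega
  rw [h.flag_two_eq_span x hx, h.E_eq_span x hx, hinsert, image_insert_eq, Submodule.span_insert,
    sup_comm]

theorem IsAdapted.bilin_mextDeriv_of_E_le_ker (hE : finrank ℝ (S.E x) = 2)
    (h : S.IsAdapted W e₀ e₁) {α : Π x : M, TangentSpace (𝓡 n) x [⋀^Fin 1]→L[ℝ] ℝ}
    (hα : SmoothFormOn W α) (hker : ∀ y ∈ W, S.E y ≤ LinearMap.ker (lin (α y))) (hx : x ∈ W)
    (u v : S.E x) :
    bilin (mextDeriv α x) (u : TangentSpace (𝓡 n) x) (v : TangentSpace (𝓡 n) x) =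
      lin (α x) (derivedFrame e₀ e₁ 2 x) * S.g x u (S.rotation e₀ e₁ x v) := by
  have hzero : ∀ e : Π y : M, S.E y, ∀ y ∈ W, α y ![field e y] = 0 := fun e y hy => by
    rw [← lin_apply]
    exact hker y hy (e y).2
  have hX₂ : lin (α x) (derivedFrame e₀ e₁ 2 x) =
      -bilin (mextDeriv α x) (derivedFrame e₀ e₁ 0 x) (derivedFrame e₀ e₁ 1 x) := by
    rw [lin_apply, bilin_apply]
    exact hα.apply_mlieBracket_of_const h.isOpen h.isSection₀ h.isSection₁ hx (hzero e₀) (hzero e₁)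
  have hswap := (bilin_isAlt (mextDeriv α x)).neg (derivedFrame e₀ e₁ 0 x)
    (derivedFrame e₀ e₁ 1 x)
  conv_lhs => rw [h.eq_sum_of_mem_E hx u.2, h.eq_sum_of_mem_E hx v.2]
  simp only [h.coeff_zero_coe hE hx, h.coeff_one_coe hE hx, map_add, map_smul, map_sub,
    LinearMap.add_apply, LinearMap.sub_apply, LinearMap.smul_apply,
    (bilin_isAlt _).self_eq_zero, smul_eq_mul, hX₂, ← hswap, rotation_apply, S.symm x u]
  ring

end AdaptedRotation

section Theta

variable {J : Π x : M, S.E x →ₗ[ℝ] S.E x} {V : Fin 3 → Π x : M, Submodule ℝ (TangentSpace (𝓡 n) x)}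
  {θ θ' : Π x : M, TangentSpace (𝓡 n) x [⋀^Fin 1]→L[ℝ] ℝ}

theorem IsThetaOn.mono (h : S.IsThetaOn U J V θ) (hWU : W ⊆ U) : S.IsThetaOn W J V θ where
  smooth := h.smooth.mono hWU
  ker_eq x hx := h.ker_eq x (hWU hx)
  normalized x hx := h.normalized x (hWU hx)

theorem IsThetaOn.ker_lin (h : S.IsThetaOn U J V θ) (hV : S.IsGradingOn U V) (hx : x ∈ U) :
    LinearMap.ker (lin (θ x)) = V 2 x ⊔ S.E x := by
  ext w
  rw [LinearMap.mem_ker, lin_apply, h.ker_eq x hx, hV.eq_E hx]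

theorem IsThetaOn.bilin_mextDeriv (h : S.IsThetaOn U J V θ) (hx : x ∈ U) (u v : S.E x) :
    bilin (mextDeriv θ x) (u : TangentSpace (𝓡 n) x) (v : TangentSpace (𝓡 n) x) =
      S.g x u (J x v) := by
  rw [bilin_apply, h.normalized x hx]

theorem isThetaOn_of_locally
    (h : ∀ x ∈ U, ∃ W ⊆ U, IsOpen W ∧ x ∈ W ∧ ∃ θ', S.IsThetaOn W J V θ' ∧ ∀ y ∈ W, θ y = θ' y) :
    S.IsThetaOn U J V θ where
  smooth := smoothFormOn_of_locally fun x hx => by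
    obtain ⟨W, hWU, hW, hxW, θ', hθ', heq⟩ := h x hx
    exact ⟨W, hWU, hW, hxW, θ', hθ'.smooth, heq⟩
  ker_eq x hx w := by
    obtain ⟨W, -, -, hxW, θ', hθ', heq⟩ := h x hx
    rw [heq x hxW, hθ'.ker_eq x hxW]
  normalized x hx u v := by
    obtain ⟨W, -, hW, hxW, θ', hθ', heq⟩ := h x hx
    rw [mextDeriv_congr (eventually_of_mem (hW.mem_nhds hxW) heq), hθ'.normalized x hxW]

theorem IsAdapted.lin_theta_two (hE : finrank ℝ (S.E x) = 2) (h : S.IsAdapted W e₀ e₁)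
    (hV : S.IsGradingOn W V) (hθ : S.IsThetaOn W J V θ) (hx : x ∈ W)
    (hJ : J x = S.rotation e₀ e₁ x) : lin (θ x) (derivedFrame e₀ e₁ 2 x) = 1 := by
  have hnorm := hθ.bilin_mextDeriv hx (e₁ x) (e₀ x)
  have hJe₀ : S.rotation e₀ e₁ x (e₀ x) = e₁ x := by
    rw [rotation_apply, h.norm₀ x hx, h.orth' hx, one_smul, zero_smul, sub_zero]
  rwa [h.bilin_mextDeriv_of_E_le_ker hE hθ.smooth
    (fun y hy => hθ.ker_lin hV hy ▸ le_sup_right) hx, hJ, hJe₀, h.norm₁ x hx, mul_one] at hnorm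

theorem IsThetaOn.eq_of_isOpen (hS : S.HasGrowthVector ![2, 3, 5]) (hU : IsOpen U)
    (hJ : S.IsRotationOn U J) (hV : S.IsGradingOn U V) (hθ : S.IsThetaOn U J V θ)
    (hθ' : S.IsThetaOn U J V θ') (hx : x ∈ U) : θ x = θ' x := by
  obtain ⟨W, hWU, hW, hxW, e₀, e₁, h, hJW⟩ := hJ.exists_isAdapted hS hU hx
  have hVW := hV.mono hW hWU
  have hker : V 2 x ⊔ S.E x ≤ LinearMap.eqLocus (lin (θ x)) (lin (θ' x)) := fun v hv => by
    rw [LinearMap.mem_eqLocus, LinearMap.mem_ker.1 ((hθ.ker_lin hV hx).ge hv),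
      LinearMap.mem_ker.1 ((hθ'.ker_lin hV hx).ge hv)]
  have htwo : lin (θ x) (derivedFrame e₀ e₁ 2 x) = lin (θ' x) (derivedFrame e₀ e₁ 2 x) := by
    rw [h.lin_theta_two (hS.finrank_E x) hVW (hθ.mono hWU) hxW (hJW x hxW),
      h.lin_theta_two (hS.finrank_E x) hVW (hθ'.mono hWU) hxW (hJW x hxW)]
  refine lin_injective (LinearMap.eqLocus_eq_top.1 (top_le_iff.1 ?_))
  rw [← hV.flag_two_sup_eq_top (hS.2.1 x) hx, h.flag_two_eq_sup hxW]
  exact sup_le (sup_le (le_sup_right.trans hker)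
    ((Submodule.span_singleton_le_iff_mem _ _).2 htwo)) (le_sup_left.trans hker)

theorem IsAdapted.isThetaOn (hE : ∀ x, finrank ℝ (S.E x) = 2) (h : S.IsAdapted W e₀ e₁)
    (hV : S.IsGradingOn W V) (hJ : ∀ y ∈ W, J y = S.rotation e₀ e₁ y) (hθ : SmoothFormOn W θ)
    (hker : ∀ y ∈ W, LinearMap.ker (lin (θ y)) = V 2 y ⊔ S.E y)
    (htwo : ∀ y ∈ W, lin (θ y) (derivedFrame e₀ e₁ 2 y) = 1) : S.IsThetaOn W J V θ where
  smooth := hθ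
  ker_eq y hy w := by
    rw [← lin_apply, ← LinearMap.mem_ker, hker y hy, hV.eq_E hy]
  normalized y hy u v := by
    rw [← bilin_apply, h.bilin_mextDeriv_of_E_le_ker (hE y) hθ
      (fun z hz => hker z hz ▸ le_sup_right) hy, htwo y hy, one_mul, hJ y hy]

theorem IsAdapted.exists_isLocalFrameOn_sumElim (htop : ∀ y, S.flag 3 y = ⊤)
    (h : S.IsAdapted W e₀ e₁) (hV : S.IsGradingOn W V) (hx : x ∈ W) :
    ∃ W' ⊆ W, IsOpen W' ∧ x ∈ W' ∧ ∃ (r : ℕ) (Y : Fin r → Π y : M, TangentSpace (𝓡 n) y),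
      (∀ y ∈ W', Submodule.span ℝ (range (Y · y)) = V 2 y) ∧
      IsLocalFrameOn (𝓡 n) (EuclideanSpace ℝ (Fin n)) ∞
        (Sum.elim (fun i : Iio (3 : Fin 5) => derivedFrame e₀ e₁ i) Y) W' := by
  obtain ⟨r, hr⟩ := hV.isSubbundle 2
  obtain ⟨W', hW', hxW', hW'W, Y, hY, hYspan⟩ := hr x hx
  have hflag : ∀ y ∈ W', Submodule.span ℝ
      (range fun i : Iio (3 : Fin 5) => derivedFrame e₀ e₁ i y) = S.flag 2 y := fun y hy => by
    rw [h.flag_two_eq_span y (hW'W hy), image_eq_range]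
  have helim : ∀ y, (Sum.elim (fun i : Iio (3 : Fin 5) => derivedFrame e₀ e₁ i) Y · y) =
      Sum.elim (fun i : Iio (3 : Fin 5) => derivedFrame e₀ e₁ i y) (Y · y) := fun y => by
    ext1 i
    cases i <;> rfl
  refine ⟨W', hW'W, hW', hxW', r, Y, fun y hy => (hYspan y hy).2, ?_, ?_, ?_⟩
  · intro y hy
    rw [helim]
    refine ((h.frame.linearIndependent (hW'W hy)).comp _ Subtype.val_injective).sum_type
      (hYspan y hy).1 ?_
    exact (hflag y hy).symm ▸ (hYspan y hy).2.symm ▸ hV.disjoint_flag (hW'W hy) 2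
  · intro y hy
    rw [helim, Sum.elim_range, Submodule.span_union, hflag y hy, (hYspan y hy).2,
      hV.flag_two_sup_eq_top (htop y) (hW'W hy)]
  · rintro (i | i)
    exacts [(h.frame.contMDiffOn i).mono hW'W, hY i]

theorem IsAdapted.exists_isThetaOn (hS : S.HasGrowthVector ![2, 3, 5]) (h : S.IsAdapted W e₀ e₁)
    (hV : S.IsGradingOn W V) (hJ : ∀ y ∈ W, J y = S.rotation e₀ e₁ y) (hx : x ∈ W) :
    ∃ W' ⊆ W, IsOpen W' ∧ x ∈ W' ∧ ∃ θ, S.IsThetaOn W' J V θ := by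
  classical
  obtain ⟨W', hW'W, hW', hxW', r, Y, hYspan, hframe⟩ :=
    h.exists_isLocalFrameOn_sumElim hS.2.1 hV hx
  have hadapted := (h.toIsOrthonormalOn.mono hW'W).isAdapted hS hW'
  have hVW' := hV.mono hW' hW'W
  let two : Iio (3 : Fin 5) := ⟨2, by decide⟩
  let θ := oneForm (hframe.coeff (.inl two))
  have htwo : ∀ y ∈ W', lin (θ y) (derivedFrame e₀ e₁ 2 y) = 1 := fun y hy =>
    (coeff_apply_self hframe hy (.inl two) (.inl two)).trans (if_pos rfl)
  refine ⟨W', hW'W, hW', hxW', θ, hadapted.isThetaOn hS.finrank_E hVW'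
    (fun y hy => hJ y (hW'W hy)) (smoothFormOn_oneForm fun W'' hW'' hW''o _ hZ =>
      contMDiffOn_coeff hframe hW' hW''o hW'' hZ _) (fun y hy => ?_) htwo⟩
  refine ker_eq_of_le_of_sup_span_singleton_eq_top (a := derivedFrame e₀ e₁ 2 y)
    (sup_le ?_ ?_) ?_ (by rw [htwo y hy]; exact one_ne_zero)
  · rw [← hYspan y hy, Submodule.span_le]
    rintro _ ⟨i, rfl⟩
    exact coeff_apply_self hframe hy (.inl two) (.inr i)
  · rw [hadapted.E_eq_span y hy, Submodule.span_le]
    rintro _ ⟨i, hi, rfl⟩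
    exact (coeff_apply_self hframe hy (.inl two)
      (.inl ⟨i, lt_trans hi (by decide : (2 : Fin 5) < 3)⟩)).trans
      (if_neg fun heq => hi.ne (congrArg Subtype.val (Sum.inl_injective heq)))
  · rw [sup_assoc, ← hadapted.flag_two_eq_sup hy, sup_comm,
      hVW'.flag_two_sup_eq_top (hS.2.1 y) hy]

theorem IsGradingOn.exists_isThetaOn (hS : S.HasGrowthVector ![2, 3, 5]) (hU : IsOpen U)
    (hJ : S.IsRotationOn U J) (hV : S.IsGradingOn U V) : ∃ θ, S.IsThetaOn U J V θ := by
  suffices hglue : ∃ θ, U ⊆ U ∧ S.IsThetaOn U J V θ from hglue.imp fun _ hθ => hθ.2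
  refine exists_of_locally_unique (P := fun W θ => W ⊆ U ∧ S.IsThetaOn W J V θ)
    (fun _ _ hWU h => ⟨hWU.trans h.1, h.2.mono hWU⟩)
    (fun hW h h' x hx => h.2.eq_of_isOpen hS hW (hJ.mono h.1) (hV.mono hW h.1) h'.2 hx)
    (fun h => ⟨fun x hx => ?glue_subset, isThetaOn_of_locally fun x hx => ?glue_theta⟩)
    (fun x hx => ?exists_local)
  case glue_subset =>
    obtain ⟨W, -, -, hxW, θ', hθ', -⟩ := h x hx
    exact hθ'.1 hxW
  case glue_theta =>
    obtain ⟨W, hWU, hW, hxW, θ', hθ', heq⟩ := h x hx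
    exact ⟨W, hWU, hW, hxW, θ', hθ'.2, heq⟩
  case exists_local =>
    obtain ⟨W, hWU, hW, hxW, e₀, e₁, h, hJW⟩ := hJ.exists_isAdapted hS hU hx
    obtain ⟨W', hW'W, hW', hxW', θ, hθ⟩ := h.exists_isThetaOn hS (hV.mono hW hWU) hJW hxW
    exact ⟨W', hW'W.trans hWU, hW', hxW', θ, hW'W.trans hWU, hθ⟩

end Theta

end Structure

section WedgeProducts

variable {U W : Set M} {x : M} {X Y Z : Π x : M, TangentSpace (𝓡 n) x}
  {α β : Π x : M, TangentSpace (𝓡 n) x [⋀^Fin 1]→L[ℝ] ℝ}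
  {Ω : Π x : M, TangentSpace (𝓡 n) x [⋀^Fin 2]→L[ℝ] ℝ}

theorem SmoothFormOn.contMDiffOn_lin (hα : SmoothFormOn U α) (hWU : W ⊆ U) (hW : IsOpen W)
    (hX : SmoothFieldOn W X) :
    ContMDiffOn (𝓡 n) 𝓘(ℝ, ℝ) ∞ (fun y => lin (α y) (X y)) W := by
  refine (hα W hWU hW (fun _ => X) fun _ => hX).congr fun y _ => ?_
  rw [lin_apply]
  exact congrArg (α y) (funext fun i => by rw [Subsingleton.elim i 0]; rfl)

/-- Over `U`, the two-form `Ω` is the wedge product `α ∧ β`. -/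
def IsWedgeOn (U : Set M) (α β : Π x : M, TangentSpace (𝓡 n) x [⋀^Fin 1]→L[ℝ] ℝ)
    (Ω : Π x : M, TangentSpace (𝓡 n) x [⋀^Fin 2]→L[ℝ] ℝ) : Prop :=
  ∀ x ∈ U, ∀ v w : TangentSpace (𝓡 n) x,
    bilin (Ω x) v w = lin (α x) v * lin (β x) w - lin (β x) v * lin (α x) w

omit [IsManifold (𝓡 n) ∞ M] in
theorem IsWedgeOn.mono (hΩ : IsWedgeOn U α β Ω) (hWU : W ⊆ U) : IsWedgeOn W α β Ω :=
  fun x hx => hΩ x (hWU hx)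

theorem IsWedgeOn.smoothFormOn (hΩ : IsWedgeOn U α β Ω) (hα : SmoothFormOn U α)
    (hβ : SmoothFormOn U β) : SmoothFormOn U Ω := by
  intro W hWU hW X hX
  have hαX := fun i => hα.contMDiffOn_lin hWU hW (hX i)
  have hβX := fun i => hβ.contMDiffOn_lin hWU hW (hX i)
  refine (((hαX 0).mul (hβX 1)).sub ((hβX 0).mul (hαX 1))).congr fun y hy => ?_
  refine .trans ?_ (hΩ y (hWU hy) (X 0 y) (X 1 y))
  rw [bilin_apply]
  exact congrArg (Ω y) (funext (Fin.forall_fin_two.2 ⟨rfl, rfl⟩))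

theorem IsWedgeOn.mvfderiv_apply (hΩ : IsWedgeOn U α β Ω) (hU : IsOpen U) (hα : SmoothFormOn U α)
    (hβ : SmoothFormOn U β) (hX : SmoothFieldOn U X) (hY : SmoothFieldOn U Y) (hx : x ∈ U)
    (v : TangentSpace (𝓡 n) x) :
    mvfderiv (𝓡 n) (fun y => Ω y ![X y, Y y]) x v =
      lin (α x) (X x) * mvfderiv (𝓡 n) (fun y => lin (β y) (Y y)) x v +
      lin (β x) (Y x) * mvfderiv (𝓡 n) (fun y => lin (α y) (X y)) x v -
      (lin (β x) (X x) * mvfderiv (𝓡 n) (fun y => lin (α y) (Y y)) x v +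
      lin (α x) (Y x) * mvfderiv (𝓡 n) (fun y => lin (β y) (X y)) x v) := by
  have hdiff : ∀ {γ : Π x : M, TangentSpace (𝓡 n) x [⋀^Fin 1]→L[ℝ] ℝ}
      {Z : Π x : M, TangentSpace (𝓡 n) x}, SmoothFormOn U γ → SmoothFieldOn U Z →
      MDifferentiableAt (𝓡 n) 𝓘(ℝ, ℝ) (fun y => lin (γ y) (Z y)) x := fun hγ hZ =>
    ((hγ.contMDiffOn_lin subset_rfl hU hZ).contMDiffAt (hU.mem_nhds hx)).mdifferentiableAt (by simp)
  have heq : (fun y => Ω y ![X y, Y y]) =ᶠ[𝓝 x]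
      (fun y => lin (α y) (X y)) * (fun y => lin (β y) (Y y)) -
        (fun y => lin (β y) (X y)) * fun y => lin (α y) (Y y) := by
    filter_upwards [hU.mem_nhds hx] with y hy
    exact (bilin_apply (Ω y) _ _).symm.trans (hΩ y hy (X y) (Y y))
  have hprod : mvfderiv (𝓡 n) (fun y => Ω y ![X y, Y y]) x = mvfderiv (𝓡 n)
      ((fun y => lin (α y) (X y)) * (fun y => lin (β y) (Y y)) -
        (fun y => lin (β y) (X y)) * fun y => lin (α y) (Y y)) x := by
    rw [mvfderiv, mvfderiv, heq.mfderiv_eq]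
    rfl
  rw [hprod, mvfderiv_sub ((hdiff hα hX).mul (hdiff hβ hY)) ((hdiff hβ hX).mul (hdiff hα hY)),
    mvfderiv_mul (hdiff hα hX) (hdiff hβ hY), mvfderiv_mul (hdiff hβ hX) (hdiff hα hY)]
  rfl

theorem IsWedgeOn.trilin_mextDeriv (hΩ : IsWedgeOn U α β Ω) (hU : IsOpen U)
    (hα : SmoothFormOn U α) (hβ : SmoothFormOn U β) (hx : x ∈ U) (u v w : TangentSpace (𝓡 n) x) :
    trilin (mextDeriv Ω x) u v w =
      bilin (mextDeriv α x) u v * lin (β x) w - bilin (mextDeriv α x) u w * lin (β x) v +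
        bilin (mextDeriv α x) v w * lin (β x) u -
      (bilin (mextDeriv β x) u v * lin (α x) w - bilin (mextDeriv β x) u w * lin (α x) v +
        bilin (mextDeriv β x) v w * lin (α x) u) := by
  obtain ⟨X, hX, rfl⟩ := exists_smoothFieldOn_eq x u
  obtain ⟨Y, hY, rfl⟩ := exists_smoothFieldOn_eq x v
  obtain ⟨Z, hZ, rfl⟩ := exists_smoothFieldOn_eq x w
  set W := U ∩ (extChartAt (𝓡 n) x).source
  have hW : IsOpen W := hU.inter (isOpen_extChartAt_source x)
  have hxW : x ∈ W := ⟨hx, mem_extChartAt_source x⟩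
  have hWU : W ⊆ U := inter_subset_left
  replace hX := hX.mono (inter_subset_right : W ⊆ _)
  replace hY := hY.mono (inter_subset_right : W ⊆ _)
  replace hZ := hZ.mono (inter_subset_right : W ⊆ _)
  replace hα := hα.mono hWU
  replace hβ := hβ.mono hWU
  replace hΩ := hΩ.mono hWU
  have hΩ_apply := fun v w => (bilin_apply (Ω x) v w).symm.trans (hΩ x hxW v w)
  rw [trilin_apply, mextDeriv_twoForm hW (hΩ.smoothFormOn hα hβ) hX hY hZ hxW]
  simp only [bilin_apply, hΩ_apply, mextDeriv_oneForm hW hα hX hY hxW,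
    mextDeriv_oneForm hW hα hX hZ hxW, mextDeriv_oneForm hW hα hY hZ hxW,
    mextDeriv_oneForm hW hβ hX hY hxW, mextDeriv_oneForm hW hβ hX hZ hxW,
    mextDeriv_oneForm hW hβ hY hZ hxW, hΩ.mvfderiv_apply hW hα hβ hY hZ hxW,
    hΩ.mvfderiv_apply hW hα hβ hX hZ hxW, hΩ.mvfderiv_apply hW hα hβ hX hY hxW, lin_apply]
  ring

end WedgeProducts

namespace Structure

variable {S : Structure n M} {U W : Set M} {e₀ e₁ : Π y : M, S.E y} {x : M}

section Psi

variable {J : Π x : M, S.E x →ₗ[ℝ] S.E x} {φ : Π x : M, TangentSpace (𝓡 n) x →ₗ[ℝ] S.E x}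
  {Ω : Π x : M, TangentSpace (𝓡 n) x [⋀^Fin 2]→L[ℝ] ℝ}

theorem bilin_Psi (hJ : S.IsRotationOn U J) (hx : x ∈ U) (v w : TangentSpace (𝓡 n) x) :
    bilin (S.Psi hJ φ x) v w = S.g x (J x (φ x v)) (φ x w) := by
  rw [bilin_apply, Psi, dif_pos hx]
  rfl

theorem IsAdapted.isWedgeOn_Psi (hE : ∀ x, finrank ℝ (S.E x) = 2) (h : S.IsAdapted W e₀ e₁)
    (hWU : W ⊆ U) (hJ : S.IsRotationOn U J) (hJW : ∀ y ∈ W, J y = S.rotation e₀ e₁ y)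
    (hφ : S.IsPhiOn W φ) : IsWedgeOn W (h.coform 3) (h.coform 4) (S.Psi hJ φ) := by
  intro x hx v w
  rw [bilin_Psi hJ (hWU hx) v w, hφ.eq_of_isOpen hE h.isOpen (h.isPhiOn hE) hx, hJW x hx]
  simp only [h.phi_apply, rotation_apply, map_sub, map_smul, LinearMap.sub_apply,
    LinearMap.smul_apply, smul_eq_mul, h.norm₀ x hx, h.norm₁ x hx, h.orth x hx, h.orth' hx,
    lin_apply, h.coform_apply]
  ring

theorem IsAdapted.trilin_mextDeriv_of_mem_flag_two (h : S.IsAdapted W e₀ e₁)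
    (hΩ : IsWedgeOn W (h.coform 3) (h.coform 4) Ω) (hx : x ∈ W) {u v : TangentSpace (𝓡 n) x}
    (hu : u ∈ S.E x) (hv : v ∈ S.flag 2 x) (w : TangentSpace (𝓡 n) x) :
    trilin (mextDeriv Ω x) u v w = h.frame.coeff 2 x v *
      (h.frame.coeff 1 x u * h.frame.coeff 3 x w - h.frame.coeff 0 x u * h.frame.coeff 4 x w) := by
  have hu' := (h.mem_E_iff hx).1 hu
  have hv' := (h.mem_flag_two_iff hx).1 hv
  rw [hΩ.trilin_mextDeriv h.isOpen (h.smoothFormOn_coform 3) (h.smoothFormOn_coform 4) hx,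
    h.bilin_mextDeriv_coform_of_mem 3 hx hu hv, h.bilin_mextDeriv_coform_of_mem 4 hx hu hv]
  simp only [lin_apply, h.coform_apply, hu' 3 (by decide), hu' 4 (by decide), hv' 3 le_rfl,
    hv' 4 (by decide), map_add, map_smul, coeff_apply_self h.frame hx, smul_eq_mul,
    Fin.reduceEq, reduceIte]
  ring

theorem IsAdapted.trilin_mextDeriv_of_mem_E (h : S.IsAdapted W e₀ e₁)
    (hΩ : IsWedgeOn W (h.coform 3) (h.coform 4) Ω) (hx : x ∈ W) {u : TangentSpace (𝓡 n) x}
    (hu : u ∈ S.E x) (v w : TangentSpace (𝓡 n) x) :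
    trilin (mextDeriv Ω x) u v w =
      h.frame.coeff 1 x u * (h.frame.coeff 2 x v * h.frame.coeff 3 x w -
          h.frame.coeff 3 x v * h.frame.coeff 2 x w) -
        h.frame.coeff 0 x u * (h.frame.coeff 2 x v * h.frame.coeff 4 x w -
          h.frame.coeff 4 x v * h.frame.coeff 2 x w) +
      (h.frame.coeff 3 x v * h.frame.coeff 4 x w - h.frame.coeff 4 x v * h.frame.coeff 3 x w) *
        trilin (mextDeriv Ω x) u (derivedFrame e₀ e₁ 3 x) (derivedFrame e₀ e₁ 4 x) := by
  set T := trilin (mextDeriv Ω x) u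
  have hT : T.IsAlt := trilin_isAlt _ u
  have hflag : ∀ i ≤ 2, ∀ w, T (derivedFrame e₀ e₁ i x) w = h.frame.coeff 2 x
      (derivedFrame e₀ e₁ i x) * (h.frame.coeff 1 x u * h.frame.coeff 3 x w -
        h.frame.coeff 0 x u * h.frame.coeff 4 x w) := fun i hi =>
    h.trilin_mextDeriv_of_mem_flag_two hΩ hx hu (h.flag_two_eq_span x hx ▸
      Submodule.subset_span ⟨i, lt_of_le_of_lt hi (by decide), rfl⟩)
  have hneg : ∀ i j, T (derivedFrame e₀ e₁ i x) (derivedFrame e₀ e₁ j x) =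
      -T (derivedFrame e₀ e₁ j x) (derivedFrame e₀ e₁ i x) := fun i j => (hT.neg _ _).symm
  conv_lhs => rw [eq_sum_coeff_smul h.frame hx v, eq_sum_coeff_smul h.frame hx w]
  simp only [Fin.sum_univ_five, map_add, map_smul, LinearMap.add_apply, LinearMap.smul_apply,
    smul_eq_mul, hflag 0 (by decide), hflag 1 (by decide), hflag 2 le_rfl,
    coeff_apply_self h.frame hx, hneg 3 0, hneg 3 1, hneg 3 2, hneg 4 0, hneg 4 1, hneg 4 2,
    hneg 4 3, hT.self_eq_zero, Fin.reduceEq, reduceIte]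
  ring

theorem IsAdapted.trilin_mextDeriv_of_mem_ker (h : S.IsAdapted W e₀ e₁)
    (hΩ : IsWedgeOn W (h.coform 3) (h.coform 4) Ω) (hx : x ∈ W) {l : TangentSpace (𝓡 n) x →ₗ[ℝ] ℝ}
    (hlE : S.E x ≤ LinearMap.ker l) (hl : l (derivedFrame e₀ e₁ 2 x) = 1)
    {u v w : TangentSpace (𝓡 n) x} (hu : u ∈ S.E x) (hv : l v = 0) (hw : l w = 0) :
    trilin (mextDeriv Ω x) u v w =
      (h.frame.coeff 3 x v * h.frame.coeff 4 x w - h.frame.coeff 4 x v * h.frame.coeff 3 x w) *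
        (trilin (mextDeriv Ω x) u (derivedFrame e₀ e₁ 3 x) (derivedFrame e₀ e₁ 4 x) +
          h.frame.coeff 0 x u * l (derivedFrame e₀ e₁ 3 x) +
          h.frame.coeff 1 x u * l (derivedFrame e₀ e₁ 4 x)) := by
  have hl₀ : l (derivedFrame e₀ e₁ 0 x) = 0 := hlE (e₀ x).2
  have hl₁ : l (derivedFrame e₀ e₁ 1 x) = 0 := hlE (e₁ x).2
  have hsolve : ∀ {v}, l v = 0 → h.frame.coeff 2 x v =
      -(h.frame.coeff 3 x v * l (derivedFrame e₀ e₁ 3 x) +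
        h.frame.coeff 4 x v * l (derivedFrame e₀ e₁ 4 x)) := fun {v} hv => by
    rw [eq_sum_coeff_smul h.frame hx v] at hv
    simp only [Fin.sum_univ_five, map_add, map_smul, smul_eq_mul, hl₀, hl₁, hl] at hv
    linarith
  rw [h.trilin_mextDeriv_of_mem_E hΩ hx hu, hsolve hv, hsolve hw]
  ring

/-- The values on an adapted frame of the one-form `θ` of the canonical grading. -/
def canonicalCoeff (Ω : Π x : M, TangentSpace (𝓡 n) x [⋀^Fin 2]→L[ℝ] ℝ) (e₀ e₁ : Π y : M, S.E y) :
    Fin 5 → M → ℝ :=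
  ![0, 0, 1,
    fun x => -mextDeriv Ω x ![field e₀ x, derivedFrame e₀ e₁ 3 x, derivedFrame e₀ e₁ 4 x],
    fun x => -mextDeriv Ω x ![field e₁ x, derivedFrame e₀ e₁ 3 x, derivedFrame e₀ e₁ 4 x]]

/-- The one-form `θ` of the canonical grading, described in an adapted frame in terms of `Ω = Ψ`:
it is the only candidate with kernel containing `E` for which condition (i) can hold. -/
def IsAdapted.canonicalForm (h : S.IsAdapted W e₀ e₁)
    (Ω : Π x : M, TangentSpace (𝓡 n) x [⋀^Fin 2]→L[ℝ] ℝ) :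
    Π x : M, TangentSpace (𝓡 n) x [⋀^Fin 1]→L[ℝ] ℝ :=
  oneForm fun x => ∑ i, canonicalCoeff Ω e₀ e₁ i x • h.frame.coeff i x

theorem IsAdapted.lin_canonicalForm (h : S.IsAdapted W e₀ e₁) (hx : x ∈ W) (i : Fin 5) :
    lin (h.canonicalForm Ω x) (derivedFrame e₀ e₁ i x) = canonicalCoeff Ω e₀ e₁ i x := by
  rw [lin_apply, canonicalForm, oneForm_apply]
  simp [coeff_apply_self h.frame hx]

theorem IsAdapted.smoothFormOn_canonicalForm (h : S.IsAdapted W e₀ e₁) (hΩ : SmoothFormOn W Ω) :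
    SmoothFormOn W (h.canonicalForm Ω) := by
  refine smoothFormOn_oneForm_sum_smul_coeff h.isOpen h.frame fun i => ?_
  have htorsion : ∀ i : Fin 5, ContMDiffOn (𝓡 n) 𝓘(ℝ, ℝ) ∞ (fun x => -mextDeriv Ω x
      ![derivedFrame e₀ e₁ i x, derivedFrame e₀ e₁ 3 x, derivedFrame e₀ e₁ 4 x]) W := fun i => by
    refine ((hΩ.mextDeriv W subset_rfl h.isOpen (fun j => derivedFrame e₀ e₁ (![i, 3, 4] j))
      fun j => h.frame.contMDiffOn _).neg).congr fun y _ => ?_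
    congr 2
    ext1 j
    fin_cases j <;> rfl
  fin_cases i
  exacts [contMDiffOn_const, contMDiffOn_const, contMDiffOn_const, htorsion 0, htorsion 1]

theorem IsAdapted.lin_canonicalForm_eq (h : S.IsAdapted W e₀ e₁)
    (hΩ : IsWedgeOn W (h.coform 3) (h.coform 4) Ω) (hx : x ∈ W) {l : TangentSpace (𝓡 n) x →ₗ[ℝ] ℝ}
    (hlE : S.E x ≤ LinearMap.ker l) (hl : l (derivedFrame e₀ e₁ 2 x) = 1)
    {F : Submodule ℝ (TangentSpace (𝓡 n) x)} (hlF : F ≤ LinearMap.ker l)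
    (hF : S.flag 2 x ⊔ F = ⊤)
    (hclosed : ∀ u ∈ S.E x, ∀ w₁ ∈ F, ∀ w₂ ∈ F, trilin (mextDeriv Ω x) u w₁ w₂ = 0) :
    lin (h.canonicalForm Ω x) = l := by
  have hproj : ∀ i, ∃ f ∈ F, ∀ j ≥ 3, h.frame.coeff j x f = if i = j then 1 else 0 := fun i => by
    obtain ⟨v, hv, f, hf, hvf⟩ :=
      Submodule.mem_sup.1 (hF.ge (Submodule.mem_top (x := derivedFrame e₀ e₁ i x)))
    refine ⟨f, hf, fun j hj => ?_⟩
    rw [← coeff_apply_self h.frame hx, ← hvf, map_add, (h.mem_flag_two_iff hx).1 hv j hj, zero_add]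
  obtain ⟨f₃, hf₃, hcoeff₃⟩ := hproj 3
  obtain ⟨f₄, hf₄, hcoeff₄⟩ := hproj 4
  have hsolve : ∀ u ∈ S.E x,
      trilin (mextDeriv Ω x) u (derivedFrame e₀ e₁ 3 x) (derivedFrame e₀ e₁ 4 x) +
        h.frame.coeff 0 x u * l (derivedFrame e₀ e₁ 3 x) +
        h.frame.coeff 1 x u * l (derivedFrame e₀ e₁ 4 x) = 0 := fun u hu => by
    have hzero := hclosed u hu f₃ hf₃ f₄ hf₄
    rw [h.trilin_mextDeriv_of_mem_ker hΩ hx hlE hl hu (hlF hf₃) (hlF hf₄), hcoeff₃ 3 le_rfl,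
      hcoeff₄ 4 (by decide), hcoeff₃ 4 (by decide), hcoeff₄ 3 le_rfl] at hzero
    simpa only [Fin.reduceEq, reduceIte, mul_one, mul_zero, sub_zero, one_mul] using hzero
  have hX₀ := hsolve (derivedFrame e₀ e₁ 0 x) (e₀ x).2
  have hX₁ := hsolve (derivedFrame e₀ e₁ 1 x) (e₁ x).2
  simp only [coeff_apply_self h.frame hx, Fin.reduceEq, reduceIte, one_mul, zero_mul, add_zero,
    trilin_apply] at hX₀ hX₁
  refine (h.frame.toBasisAt hx).ext fun i => ?_
  rw [h.frame.toBasisAt_coe hx, h.lin_canonicalForm hx]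
  fin_cases i
  · exact (hlE (e₀ x).2).symm
  · exact (hlE (e₁ x).2).symm
  · exact hl.symm
  · exact neg_eq_of_add_eq_zero_right hX₀
  · exact neg_eq_of_add_eq_zero_right hX₁

end Psi

end Structure

theorem eq_inf_of_sup_eq_of_inf_eq_bot {α : Type*} [Lattice α] [IsModularLattice α] [OrderBot α]
    {a b c d : α} (hsup : a ⊔ b = c) (hbd : b ≤ d) (hinf : a ⊓ d = ⊥) : b = c ⊓ d := by
  rw [← hsup, sup_comm, sup_inf_assoc_of_le a hbd, hinf, sup_bot_eq]

namespace Structure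

variable {S : Structure n M} {U W : Set M} {e₀ e₁ : Π y : M, S.E y} {x : M}
  {V V' : Fin 3 → Π x : M, Submodule ℝ (TangentSpace (𝓡 n) x)}
  {J : Π x : M, S.E x →ₗ[ℝ] S.E x} {φ : Π x : M, TangentSpace (𝓡 n) x →ₗ[ℝ] S.E x}
  {θ θ' : Π x : M, TangentSpace (𝓡 n) x [⋀^Fin 1]→L[ℝ] ℝ}

section Uniqueness

/-- Over `U`, oriented by `J`, the `E`-grading `V` satisfies the conditions (i) and (ii) that
characterize the canonical grading. -/
structure IsCanonicalOn (S : Structure n M) {U : Set M} {J : Π x : M, S.E x →ₗ[ℝ] S.E x}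
    (hJ : S.IsRotationOn U J) (φ : Π x : M, TangentSpace (𝓡 n) x →ₗ[ℝ] S.E x)
    (V : Fin 3 → Π x : M, Submodule ℝ (TangentSpace (𝓡 n) x)) : Prop where
  isGradingOn : S.IsGradingOn U V
  condI : S.CondI hJ φ V
  condII : ∀ θ, S.IsThetaOn U J V θ → S.CondII U V θ

theorem IsThetaOn.E_inf_orthogonal (hS : S.HasGrowthVector ![2, 3, 5]) (hU : IsOpen U)
    (hJ : S.IsRotationOn U J) (hθ : S.IsThetaOn U J V θ) (hx : x ∈ U) :
    S.E x ⊓ (S.E x).orthogonalBilin (bilin (mextDeriv θ x)) = ⊥ := by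
  obtain ⟨W, -, -, hxW, e₀, e₁, h, hJW⟩ := hJ.exists_isAdapted hS hU hx
  refine (Submodule.eq_bot_iff _).2 fun w hw => ?_
  obtain ⟨hwE, hworth⟩ := Submodule.mem_inf.1 hw
  lift w to S.E x using hwE
  have hzero := Submodule.mem_orthogonalBilin_iff.1 hworth _ (J x w).2
  rw [hθ.bilin_mextDeriv hx, hJW x hxW, h.g_rotation (hS.finrank_E x) hxW] at hzero
  by_contra hne
  exact (S.pos x w fun h₀ => hne (by rw [h₀, Submodule.coe_zero])).ne' hzero

theorem CondII.le_orthogonal (hII : S.CondII U V θ) (hx : x ∈ U) :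
    V 1 x ⊔ V 2 x ≤ (S.E x).orthogonalBilin (bilin (mextDeriv θ x)) := fun w hw u hu => by
  rw [bilin_apply, hII x hx u hu w hw]

theorem IsThetaOn.grading_one_eq (hS : S.HasGrowthVector ![2, 3, 5]) (hU : IsOpen U)
    (hJ : S.IsRotationOn U J) (hV : S.IsGradingOn U V) (hθ : S.IsThetaOn U J V θ)
    (hII : S.CondII U V θ) (hx : x ∈ U) :
    V 1 x = S.flag 2 x ⊓ (S.E x).orthogonalBilin (bilin (mextDeriv θ x)) :=
  eq_inf_of_sup_eq_of_inf_eq_bot (hV.flag_two_eq_sup hx).symm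
    (le_sup_left.trans (hII.le_orthogonal hx)) (hθ.E_inf_orthogonal hS hU hJ hx)

theorem IsThetaOn.grading_two_eq (hS : S.HasGrowthVector ![2, 3, 5]) (hU : IsOpen U)
    (hJ : S.IsRotationOn U J) (hV : S.IsGradingOn U V) (hθ : S.IsThetaOn U J V θ)
    (hII : S.CondII U V θ) (hx : x ∈ U) :
    V 2 x = LinearMap.ker (lin (θ x)) ⊓ (S.E x).orthogonalBilin (bilin (mextDeriv θ x)) :=
  eq_inf_of_sup_eq_of_inf_eq_bot ((sup_comm _ _).trans (hθ.ker_lin hV hx).symm)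
    (le_sup_right.trans (hII.le_orthogonal hx)) (hθ.E_inf_orthogonal hS hU hJ hx)

theorem IsAdapted.canonicalForm_eq (hS : S.HasGrowthVector ![2, 3, 5]) (h : S.IsAdapted W e₀ e₁)
    (hWU : W ⊆ U) (hJ : S.IsRotationOn U J) (hJW : ∀ y ∈ W, J y = S.rotation e₀ e₁ y)
    (hφ : S.IsPhiOn W φ) (hV : S.IsGradingOn U V) (hI : S.CondI hJ φ V)
    (hθ : S.IsThetaOn U J V θ) (hx : x ∈ W) : h.canonicalForm (S.Psi hJ φ) x = θ x := by
  have hker := hθ.ker_lin hV (hWU hx)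
  refine lin_injective (h.lin_canonicalForm_eq (F := V 2 x)
    (h.isWedgeOn_Psi hS.finrank_E hWU hJ hJW hφ) hx (hker ▸ le_sup_right)
    (h.lin_theta_two (hS.finrank_E x) (hV.mono h.isOpen hWU) (hθ.mono hWU) hx (hJW x hx))
    (hker ▸ le_sup_left) (hV.flag_two_sup_eq_top (hS.2.1 x) (hWU hx)) fun u hu w₁ hw₁ w₂ hw₂ => ?_)
  rw [trilin_apply, hI x (hWU hx) u hu w₁ hw₁ w₂ hw₂]

theorem IsCanonicalOn.theta_eq (hS : S.HasGrowthVector ![2, 3, 5]) (hU : IsOpen U)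
    {hJ : S.IsRotationOn U J} (hφ : S.IsPhiOn U φ) (h : S.IsCanonicalOn hJ φ V)
    (h' : S.IsCanonicalOn hJ φ V') (hθ : S.IsThetaOn U J V θ) (hθ' : S.IsThetaOn U J V' θ')
    (hx : x ∈ U) : θ x = θ' x := by
  obtain ⟨W, hWU, -, hxW, e₀, e₁, hframe, hJW⟩ := hJ.exists_isAdapted hS hU hx
  rw [← hframe.canonicalForm_eq hS hWU hJ hJW (hφ.mono hWU) h.isGradingOn h.condI hθ hxW,
    hframe.canonicalForm_eq hS hWU hJ hJW (hφ.mono hWU) h'.isGradingOn h'.condI hθ' hxW]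

theorem IsCanonicalOn.eq_of_isOpen (hS : S.HasGrowthVector ![2, 3, 5]) (hU : IsOpen U)
    {hJ : S.IsRotationOn U J} (hφ : S.IsPhiOn U φ) (h : S.IsCanonicalOn hJ φ V)
    (h' : S.IsCanonicalOn hJ φ V') (i : Fin 3) (hx : x ∈ U) : V i x = V' i x := by
  obtain ⟨θ, hθ⟩ := h.isGradingOn.exists_isThetaOn hS hU hJ
  obtain ⟨θ', hθ'⟩ := h'.isGradingOn.exists_isThetaOn hS hU hJ
  have heq : ∀ y ∈ U, θ y = θ' y := fun y hy => h.theta_eq hS hU hφ h' hθ hθ' hy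
  have hd := mextDeriv_congr (eventually_of_mem (hU.mem_nhds hx) heq)
  fin_cases i
  · exact (h.isGradingOn.eq_E hx).trans (h'.isGradingOn.eq_E hx).symm
  · exact (hθ.grading_one_eq hS hU hJ h.isGradingOn (h.condII θ hθ) hx).trans <| hd ▸
      (hθ'.grading_one_eq hS hU hJ h'.isGradingOn (h'.condII θ' hθ') hx).symm
  · exact (hθ.grading_two_eq hS hU hJ h.isGradingOn (h.condII θ hθ) hx).trans <| hd ▸ heq x hx ▸
      (hθ'.grading_two_eq hS hU hJ h'.isGradingOn (h'.condII θ' hθ') hx).symm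

end Uniqueness

end Structure

theorem SmoothFormOn.contMDiffOn_bilin {U W : Set M} {X Y : Π x : M, TangentSpace (𝓡 n) x}
    {Ω : Π x : M, TangentSpace (𝓡 n) x [⋀^Fin 2]→L[ℝ] ℝ} (hΩ : SmoothFormOn U Ω) (hWU : W ⊆ U)
    (hW : IsOpen W) (hX : SmoothFieldOn W X) (hY : SmoothFieldOn W Y) :
    ContMDiffOn (𝓡 n) 𝓘(ℝ, ℝ) ∞ (fun y => bilin (Ω y) (X y) (Y y)) W := by
  refine ((hΩ.mono hWU).contMDiffOn_vecCons hW hX (V := fun _ => Y) fun _ => hY).congr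
    fun y _ => ?_
  rw [bilin_apply]
  exact congrArg (Ω y ∘ Matrix.vecCons (X y)) (funext fun i => by rw [Subsingleton.elim i 0]; rfl)

namespace Structure

variable {S : Structure n M} {U W : Set M} {e₀ e₁ : Π y : M, S.E y} {x : M}
  {J : Π x : M, S.E x →ₗ[ℝ] S.E x} {θ : Π x : M, TangentSpace (𝓡 n) x [⋀^Fin 1]→L[ℝ] ℝ}
  {Ω : Π x : M, TangentSpace (𝓡 n) x [⋀^Fin 2]→L[ℝ] ℝ}

section ShearedFrame

/-- The vector field `Z` modified by a section of `E` so as to become orthogonal to `E` with respect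
to `dθ`. The coefficients are chosen for `dθ(e₀, e₁) = -1`. -/
def horizontalShift (θ : Π x : M, TangentSpace (𝓡 n) x [⋀^Fin 1]→L[ℝ] ℝ) (e₀ e₁ : Π y : M, S.E y)
    (Z : Π x : M, TangentSpace (𝓡 n) x) (x : M) : TangentSpace (𝓡 n) x :=
  Z x + (bilin (mextDeriv θ x) (Z x) (field e₁ x) • field e₀ x +
    bilin (mextDeriv θ x) (field e₀ x) (Z x) • field e₁ x)

theorem horizontalShift_sub_mem (Z : Π x : M, TangentSpace (𝓡 n) x) :
    horizontalShift θ e₀ e₁ Z x - Z x ∈ S.E x := by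
  rw [horizontalShift, add_sub_cancel_left]
  exact (S.E x).add_mem ((S.E x).smul_mem _ (e₀ x).2) ((S.E x).smul_mem _ (e₁ x).2)

theorem IsAdapted.smoothFieldOn_horizontalShift (h : S.IsAdapted W e₀ e₁) (hθ : SmoothFormOn W θ)
    {Z : Π x : M, TangentSpace (𝓡 n) x} (hZ : SmoothFieldOn W Z) :
    SmoothFieldOn W (horizontalShift θ e₀ e₁ Z) :=
  hZ.add ((SmoothFieldOn.smul
      (hθ.mextDeriv.contMDiffOn_bilin subset_rfl h.isOpen hZ h.isSection₁) h.isSection₀).add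
    (SmoothFieldOn.smul
      (hθ.mextDeriv.contMDiffOn_bilin subset_rfl h.isOpen h.isSection₀ hZ) h.isSection₁))

theorem IsAdapted.bilin_mextDeriv_horizontalShift (h : S.IsAdapted W e₀ e₁) (hx : x ∈ W)
    (hθ : bilin (mextDeriv θ x) (field e₀ x) (field e₁ x) = -1) {u : TangentSpace (𝓡 n) x}
    (hu : u ∈ S.E x) (Z : Π x : M, TangentSpace (𝓡 n) x) :
    bilin (mextDeriv θ x) u (horizontalShift θ e₀ e₁ Z x) = 0 := by
  have halt := bilin_isAlt (mextDeriv θ x)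
  have hθ' : bilin (mextDeriv θ x) (field e₁ x) (field e₀ x) = 1 := by
    rw [← halt.neg, hθ, neg_neg]
  have hX₀ : bilin (mextDeriv θ x) (field e₀ x) (horizontalShift θ e₀ e₁ Z x) = 0 := by
    simp only [horizontalShift, map_add, map_smul, halt.self_eq_zero, hθ, smul_eq_mul]
    ring
  have hX₁ : bilin (mextDeriv θ x) (field e₁ x) (horizontalShift θ e₀ e₁ Z x) = 0 := by
    simp only [horizontalShift, map_add, map_smul, halt.self_eq_zero, hθ', smul_eq_mul,
      ← halt.neg (field e₁ x) (Z x)]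
    ring
  rw [h.eq_sum_of_mem_E hx hu, map_add, map_smul, map_smul, LinearMap.add_apply,
    LinearMap.smul_apply, LinearMap.smul_apply]
  exact (congrArg₂ (_ • · + _ • ·) hX₀ hX₁).trans (by simp only [smul_zero, add_zero])

/-- The frame obtained from the derived frame by making the last two fields tangent to `ker θ` and
the last three fields `dθ`-orthogonal to `E`. -/
def shearedFrame (θ : Π x : M, TangentSpace (𝓡 n) x [⋀^Fin 1]→L[ℝ] ℝ) (e₀ e₁ : Π y : M, S.E y) :
    Fin 5 → Π x : M, TangentSpace (𝓡 n) x :=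
  ![field e₀, field e₁, horizontalShift θ e₀ e₁ (derivedFrame e₀ e₁ 2),
    horizontalShift θ e₀ e₁ fun x => derivedFrame e₀ e₁ 3 x +
      -lin (θ x) (derivedFrame e₀ e₁ 3 x) • derivedFrame e₀ e₁ 2 x,
    horizontalShift θ e₀ e₁ fun x => derivedFrame e₀ e₁ 4 x +
      -lin (θ x) (derivedFrame e₀ e₁ 4 x) • derivedFrame e₀ e₁ 2 x]

theorem IsAdapted.shearedFrame_sub_mem (h : S.IsAdapted W e₀ e₁) (hx : x ∈ W) (i : Fin 5) :
    shearedFrame θ e₀ e₁ i x - derivedFrame e₀ e₁ i x ∈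
      Submodule.span ℝ ((derivedFrame e₀ e₁ · x) '' Iio i) := by
  have hshift : ∀ (Z : Π x : M, TangentSpace (𝓡 n) x) {i : Fin 5}, 2 ≤ i →
      horizontalShift θ e₀ e₁ Z x - Z x ∈
        Submodule.span ℝ ((derivedFrame e₀ e₁ · x) '' Iio i) := fun Z i hi =>
    Submodule.span_mono (image_mono (Iio_subset_Iio hi))
      (h.E_eq_span x hx ▸ horizontalShift_sub_mem Z)
  have hcorrected : ∀ (c : M → ℝ) {i : Fin 5}, 3 ≤ i →
      horizontalShift θ e₀ e₁ (fun x => derivedFrame e₀ e₁ i x + c x • derivedFrame e₀ e₁ 2 x) x -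
        derivedFrame e₀ e₁ i x ∈ Submodule.span ℝ ((derivedFrame e₀ e₁ · x) '' Iio i) := by
    intro c i hi
    have htwo : c x • derivedFrame e₀ e₁ 2 x ∈
        Submodule.span ℝ ((derivedFrame e₀ e₁ · x) '' Iio i) :=
      Submodule.smul_mem _ _ (Submodule.subset_span ⟨2, lt_of_lt_of_le (by decide) hi, rfl⟩)
    have hsum := add_mem (hshift (fun x => derivedFrame e₀ e₁ i x + c x • derivedFrame e₀ e₁ 2 x)
      ((by decide : (2 : Fin 5) ≤ 3).trans hi)) htwo
    rwa [sub_add_eq_add_sub, add_sub_add_right_eq_sub] at hsum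
  fin_cases i
  · exact (sub_self (field e₀ x)).symm ▸ zero_mem _
  · exact (sub_self (field e₁ x)).symm ▸ zero_mem _
  exacts [hshift (derivedFrame e₀ e₁ 2) le_rfl,
    hcorrected (fun x => -lin (θ x) (derivedFrame e₀ e₁ 3 x)) le_rfl,
    hcorrected (fun x => -lin (θ x) (derivedFrame e₀ e₁ 4 x)) (by decide)]

theorem IsAdapted.span_shearedFrame_image (h : S.IsAdapted W e₀ e₁) (hx : x ∈ W) {s : Set (Fin 5)}
    (hs : IsLowerSet s) : Submodule.span ℝ ((shearedFrame θ e₀ e₁ · x) '' s) =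
      Submodule.span ℝ ((derivedFrame e₀ e₁ · x) '' s) :=
  span_image_eq_of_sub_mem_span_Iio (h.shearedFrame_sub_mem hx) hs

theorem IsAdapted.smoothFieldOn_shearedFrame (h : S.IsAdapted W e₀ e₁) (hθ : SmoothFormOn W θ)
    (i : Fin 5) : SmoothFieldOn W (shearedFrame θ e₀ e₁ i) := by
  have hX := h.frame.contMDiffOn
  have hcorrected : ∀ i, SmoothFieldOn W (horizontalShift θ e₀ e₁ fun x =>
      derivedFrame e₀ e₁ i x +
        -lin (θ x) (derivedFrame e₀ e₁ i x) • derivedFrame e₀ e₁ 2 x) := fun i =>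
    h.smoothFieldOn_horizontalShift hθ (SmoothFieldOn.add (hX i)
      (SmoothFieldOn.smul (hθ.contMDiffOn_lin subset_rfl h.isOpen (hX i)).neg (hX 2)))
  fin_cases i
  exacts [hX 0, hX 1, h.smoothFieldOn_horizontalShift hθ (hX 2), hcorrected 3, hcorrected 4]

theorem IsAdapted.isLocalFrameOn_shearedFrame (h : S.IsAdapted W e₀ e₁) (hθ : SmoothFormOn W θ) :
    IsLocalFrameOn (𝓡 n) (EuclideanSpace ℝ (Fin n)) ∞ (shearedFrame θ e₀ e₁) W := by
  have htop : ∀ x ∈ W, ⊤ ≤ Submodule.span ℝ (range (shearedFrame θ e₀ e₁ · x)) := fun x hx => by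
    rw [← image_univ, h.span_shearedFrame_image hx isLowerSet_univ, image_univ]
    exact h.frame.generating hx
  refine ⟨fun {x} hx => ?_, fun {x} => htop x, h.smoothFieldOn_shearedFrame hθ⟩
  exact linearIndependent_of_top_le_span_of_card_eq_finrank (htop x hx)
    (finrank_eq_card_basis (h.frame.toBasisAt hx)).symm

theorem lin_shearedFrame (hker : S.E x ≤ LinearMap.ker (lin (θ x)))
    (htwo : lin (θ x) (derivedFrame e₀ e₁ 2 x) = 1) (i : Fin 5) :
    lin (θ x) (shearedFrame θ e₀ e₁ i x) = if i = 2 then 1 else 0 := by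
  have hshift : ∀ Z, lin (θ x) (horizontalShift θ e₀ e₁ Z x) = lin (θ x) (Z x) := fun Z =>
    sub_eq_zero.1 (by rw [← map_sub]; exact hker (horizontalShift_sub_mem Z))
  have hcorrected : ∀ i, lin (θ x) (horizontalShift θ e₀ e₁ (fun x => derivedFrame e₀ e₁ i x +
      -lin (θ x) (derivedFrame e₀ e₁ i x) • derivedFrame e₀ e₁ 2 x) x) = 0 := fun i => by
    rw [hshift, map_add, map_smul, htwo, smul_eq_mul, mul_one, add_neg_cancel]
  fin_cases i
  exacts [hker (e₀ x).2, hker (e₁ x).2, (hshift _).trans htwo, hcorrected 3, hcorrected 4]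

theorem IsAdapted.bilin_mextDeriv_shearedFrame (h : S.IsAdapted W e₀ e₁) (hx : x ∈ W)
    (hθ : bilin (mextDeriv θ x) (field e₀ x) (field e₁ x) = -1) {u : TangentSpace (𝓡 n) x}
    (hu : u ∈ S.E x) {i : Fin 5} (hi : 2 ≤ i) :
    bilin (mextDeriv θ x) u (shearedFrame θ e₀ e₁ i x) = 0 := by
  have hshift := h.bilin_mextDeriv_horizontalShift hx hθ hu
  have hcorrected : ∀ i, bilin (mextDeriv θ x) u (horizontalShift θ e₀ e₁ (fun x =>
      derivedFrame e₀ e₁ i x + -lin (θ x) (derivedFrame e₀ e₁ i x) • derivedFrame e₀ e₁ 2 x) x) =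
        0 := fun i => hshift _
  fin_cases i
  exacts [absurd hi (by decide), absurd hi (by decide), hshift (derivedFrame e₀ e₁ 2),
    hcorrected 3, hcorrected 4]

end ShearedFrame

section GradingOfForm

/-- The `E`-grading attached to a one-form `θ` with `E ⊆ ker θ` and `θ([e₀, e₁]) = 1`, for which
`(TM)_{-2} ⊕ (TM)_{-3}` is the `dθ`-orthogonal complement of `E`. -/
def gradingOfForm (θ : Π x : M, TangentSpace (𝓡 n) x [⋀^Fin 1]→L[ℝ] ℝ) (e₀ e₁ : Π y : M, S.E y)
    (k : Fin 3) (x : M) : Submodule ℝ (TangentSpace (𝓡 n) x) :=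
  Submodule.span ℝ ((shearedFrame θ e₀ e₁ · x) '' (![0, 0, 1, 2, 2] ⁻¹' {k}))

theorem IsAdapted.isGradingOn_gradingOfForm (hS : S.HasGrowthVector ![2, 3, 5])
    (h : S.IsAdapted W e₀ e₁) (hθ : SmoothFormOn W θ) :
    S.IsGradingOn W (gradingOfForm θ e₀ e₁) := by
  refine isGradingOn_span_preimage h.isOpen (h.isLocalFrameOn_shearedFrame hθ) ![0, 0, 1, 2, 2]
    fun x hx k hk => ?_
  have hmono : Monotone (![0, 0, 1, 2, 2] : Fin 5 → Fin 3) := by decide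
  have hlower : IsLowerSet {i : Fin 5 | ((![0, 0, 1, 2, 2] : Fin 5 → Fin 3) i : ℕ) < k} :=
    fun i j hji hi => lt_of_le_of_lt (Fin.val_fin_le.2 (hmono hji)) hi
  rw [h.span_shearedFrame_image hx hlower]
  interval_cases k
  · simp only [flag_zero, not_lt_zero, ofPred_false, image_empty, Submodule.span_empty]
  · rw [flag_one, h.E_eq_span x hx]
    congr 2
    ext i
    fin_cases i <;> decide
  · rw [h.flag_two_eq_span x hx]
    congr 2
    ext i
    fin_cases i <;> decide
  · simp only [Fin.is_lt, ofPred_true, image_univ]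
    rw [hS.2.1 x]
    exact (top_le_iff.1 (h.frame.generating hx)).symm

theorem IsAdapted.ker_lin_eq_gradingOfForm (hS : S.HasGrowthVector ![2, 3, 5])
    (h : S.IsAdapted W e₀ e₁) (hθ : SmoothFormOn W θ) (hx : x ∈ W)
    (hker : S.E x ≤ LinearMap.ker (lin (θ x))) (htwo : lin (θ x) (derivedFrame e₀ e₁ 2 x) = 1) :
    LinearMap.ker (lin (θ x)) = gradingOfForm θ e₀ e₁ 2 x ⊔ S.E x := by
  have hle : gradingOfForm θ e₀ e₁ 2 x ≤ LinearMap.ker (lin (θ x)) := by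
    refine Submodule.span_le.2 ?_
    rintro _ ⟨i, hi, rfl⟩
    have hne : i ≠ 2 := by
      rintro rfl
      exact absurd (mem_singleton_iff.1 hi) (by decide)
    exact (lin_shearedFrame hker htwo i).trans (if_neg hne)
  refine ker_eq_of_le_of_sup_span_singleton_eq_top (sup_le hle hker) ?_
    (htwo.trans_ne one_ne_zero)
  rw [sup_assoc, ← h.flag_two_eq_sup hx, sup_comm]
  exact (h.isGradingOn_gradingOfForm hS hθ).flag_two_sup_eq_top (hS.2.1 x) hx

theorem IsAdapted.isThetaOn_gradingOfForm (hS : S.HasGrowthVector ![2, 3, 5])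
    (h : S.IsAdapted W e₀ e₁) (hJ : ∀ y ∈ W, J y = S.rotation e₀ e₁ y) (hθ : SmoothFormOn W θ)
    (hker : ∀ y ∈ W, S.E y ≤ LinearMap.ker (lin (θ y)))
    (htwo : ∀ y ∈ W, lin (θ y) (derivedFrame e₀ e₁ 2 y) = 1) :
    S.IsThetaOn W J (gradingOfForm θ e₀ e₁) θ :=
  h.isThetaOn hS.finrank_E (h.isGradingOn_gradingOfForm hS hθ) hJ hθ
    (fun y hy => h.ker_lin_eq_gradingOfForm hS hθ hy (hker y hy) (htwo y hy)) htwo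

theorem IsAdapted.condII_gradingOfForm (hE : ∀ x, finrank ℝ (S.E x) = 2) (h : S.IsAdapted W e₀ e₁)
    (hθ : SmoothFormOn W θ) (hker : ∀ y ∈ W, S.E y ≤ LinearMap.ker (lin (θ y)))
    (htwo : ∀ y ∈ W, lin (θ y) (derivedFrame e₀ e₁ 2 y) = 1) :
    S.CondII W (gradingOfForm θ e₀ e₁) θ := by
  intro x hx u hu w hw
  have hnorm : bilin (mextDeriv θ x) (field e₀ x) (field e₁ x) = -1 := by
    refine (h.bilin_mextDeriv_of_E_le_ker (hE x) hθ hker hx (e₀ x) (e₁ x)).trans ?_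
    rw [htwo x hx, rotation_apply, h.norm₁ x hx, h.orth x hx, zero_smul, zero_sub, one_smul,
      map_neg, h.norm₀ x hx, one_mul]
  have horth : ∀ k, 1 ≤ k → gradingOfForm θ e₀ e₁ k x ≤
      LinearMap.ker (bilin (mextDeriv θ x) u) := fun k hk => by
    refine Submodule.span_le.2 ?_
    rintro _ ⟨i, hi, rfl⟩
    refine h.bilin_mextDeriv_shearedFrame hx hnorm hu ?_
    by_contra! hlt
    obtain rfl | rfl : i = 0 ∨ i = 1 := by omega
    all_goals exact absurd (hi ▸ hk) (by decide)
  rw [← bilin_apply]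
  exact sup_le (horth 1 le_rfl) (horth 2 (by decide)) hw

end GradingOfForm

section Existence

theorem IsAdapted.E_le_ker_canonicalForm (h : S.IsAdapted W e₀ e₁) (hx : x ∈ W) :
    S.E x ≤ LinearMap.ker (lin (h.canonicalForm Ω x)) := by
  rw [h.E_eq_span x hx, Submodule.span_le]
  rintro _ ⟨i, hi, rfl⟩
  obtain rfl | rfl : i = 0 ∨ i = 1 := by
    rw [mem_Iio] at hi
    omega
  exacts [h.lin_canonicalForm hx 0, h.lin_canonicalForm hx 1]

theorem IsAdapted.trilin_mextDeriv_of_mem_ker_canonicalForm (h : S.IsAdapted W e₀ e₁)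
    (hΩ : IsWedgeOn W (h.coform 3) (h.coform 4) Ω) (hx : x ∈ W) {u v w : TangentSpace (𝓡 n) x}
    (hu : u ∈ S.E x) (hv : lin (h.canonicalForm Ω x) v = 0)
    (hw : lin (h.canonicalForm Ω x) w = 0) : trilin (mextDeriv Ω x) u v w = 0 := by
  rw [h.trilin_mextDeriv_of_mem_ker hΩ hx (h.E_le_ker_canonicalForm hx) (h.lin_canonicalForm hx 2)
    hu hv hw]
  have hX₃ : lin (h.canonicalForm Ω x) (derivedFrame e₀ e₁ 3 x) = -trilin (mextDeriv Ω x)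
      (derivedFrame e₀ e₁ 0 x) (derivedFrame e₀ e₁ 3 x) (derivedFrame e₀ e₁ 4 x) := by
    rw [h.lin_canonicalForm hx, trilin_apply]
    rfl
  have hX₄ : lin (h.canonicalForm Ω x) (derivedFrame e₀ e₁ 4 x) = -trilin (mextDeriv Ω x)
      (derivedFrame e₀ e₁ 1 x) (derivedFrame e₀ e₁ 3 x) (derivedFrame e₀ e₁ 4 x) := by
    rw [h.lin_canonicalForm hx, trilin_apply]
    rfl
  conv_lhs => enter [2, 1, 1]; rw [h.eq_sum_of_mem_E hx hu]
  rw [hX₃, hX₄]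
  simp only [map_add, map_smul, LinearMap.add_apply, LinearMap.smul_apply, smul_eq_mul]
  ring

theorem IsAdapted.isCanonicalOn (hS : S.HasGrowthVector ![2, 3, 5]) (h : S.IsAdapted W e₀ e₁)
    {φ : Π x : M, TangentSpace (𝓡 n) x →ₗ[ℝ] S.E x} (hφ : S.IsPhiOn W φ)
    (hJ : S.IsRotationOn W J) (hJW : ∀ y ∈ W, J y = S.rotation e₀ e₁ y) :
    S.IsCanonicalOn hJ φ (gradingOfForm (h.canonicalForm (S.Psi hJ φ)) e₀ e₁) := by
  have hΨ := h.isWedgeOn_Psi hS.finrank_E subset_rfl hJ hJW hφ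
  have hθ := h.smoothFormOn_canonicalForm
    (hΨ.smoothFormOn (h.smoothFormOn_coform 3) (h.smoothFormOn_coform 4))
  have hker : ∀ y ∈ W, S.E y ≤ LinearMap.ker (lin (h.canonicalForm (S.Psi hJ φ) y)) :=
    fun y hy => h.E_le_ker_canonicalForm hy
  have htwo : ∀ y ∈ W, lin (h.canonicalForm (S.Psi hJ φ) y) (derivedFrame e₀ e₁ 2 y) = 1 :=
    fun y hy => h.lin_canonicalForm hy 2
  have hV := h.isGradingOn_gradingOfForm hS hθ
  have htheta := h.isThetaOn_gradingOfForm hS hJW hθ hker htwo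
  refine ⟨hV, fun x hx u hu w₁ hw₁ w₂ hw₂ => ?_, fun θ hθ' x hx u hu w hw => ?_⟩
  · have hle := le_sup_left.trans (htheta.ker_lin hV hx).ge
    rw [← trilin_apply]
    exact h.trilin_mextDeriv_of_mem_ker_canonicalForm hΨ hx hu (hle hw₁) (hle hw₂)
  · rw [mextDeriv_congr (eventually_of_mem (h.isOpen.mem_nhds hx) fun y hy =>
      hθ'.eq_of_isOpen hS h.isOpen hJ hV htheta hy)]
    exact h.condII_gradingOfForm hS.finrank_E hθ hker htwo x hx u hu w hw

end Existence

end Structure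

namespace Structure

variable {S : Structure n M} {U W : Set M} {x : M}
  {V V' : Fin 3 → Π x : M, Submodule ℝ (TangentSpace (𝓡 n) x)}
  {J J' : Π x : M, S.E x →ₗ[ℝ] S.E x} {φ : Π x : M, TangentSpace (𝓡 n) x →ₗ[ℝ] S.E x}
  {θ : Π x : M, TangentSpace (𝓡 n) x [⋀^Fin 1]→L[ℝ] ℝ} {c : ℝ}

section Orientation

theorem exists_orientation (hS : S.HasGrowthVector ![2, 3, 5]) (x : M) : ∃ U : Set M, IsOpen U ∧
    x ∈ U ∧ ∃ J : Π y : M, S.E y →ₗ[ℝ] S.E y, S.IsRotationOn U J := by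
  obtain ⟨U, hU, hxU, e₀, e₁, h⟩ := exists_isOrthonormalOn (hS.finrank_E x)
  exact ⟨U, hU, hxU, _, h.isRotationOn hS.finrank_E⟩

theorem IsRotationOn.exists_eq_smul (hS : S.HasGrowthVector ![2, 3, 5]) (hU : IsOpen U)
    (hJ : S.IsRotationOn U J) (hJ' : S.IsRotationOn U J') (hx : x ∈ U) :
    ∃ W ⊆ U, IsOpen W ∧ x ∈ W ∧ ∃ c : ℝ, c * c = 1 ∧ ∀ y ∈ W, J' y = c • J y := by
  obtain ⟨W, hWU, hW, hxW, e₀, e₁, h, -⟩ := hJ.exists_isAdapted hS hU hx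
  let f : M → ℝ := fun y => S.g y (J y (e₀ y)) (J' y (e₀ y))
  have hsign : ∀ y ∈ W, f y * f y = 1 ∧ J' y = f y • J y := by
    intro y hy
    have hnorm := (hJ.orthonormal y (hWU hy) _ (h.norm₀ y hy)).2
    obtain heq | heq := hJ.eq_or_eq_neg (hS.finrank_E y) hU hU hJ' (hWU hy) (hWU hy)
    · have hf : f y = 1 := by simp only [f, heq, hnorm]
      rw [hf, mul_one, one_smul, heq]
      exact ⟨rfl, rfl⟩
    · have hf : f y = -1 := by simp only [f, heq, LinearMap.neg_apply, map_neg, hnorm]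
      rw [hf, neg_mul_neg, mul_one, heq]
      exact ⟨rfl, (neg_one_smul ℝ (J y)).symm⟩
  have hcont : ContinuousAt f x := ((S.smooth W hW _ _ (hJ.smooth W hWU hW e₀ h.isSection₀)
    (hJ'.smooth W hWU hW e₀ h.isSection₀)).contMDiffAt (hW.mem_nhds hxW)).continuousAt
  have hpos : ∀ᶠ y in 𝓝 x, 0 < f y * f x := (hcont.mul continuousAt_const).eventually
    (lt_mem_nhds (one_pos.trans_eq (hsign x hxW).1.symm))
  obtain ⟨W', hposW', hW', hxW'⟩ := eventually_nhds_iff.1 hpos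
  refine ⟨W ∩ W', inter_subset_left.trans hWU, hW.inter hW', ⟨hxW, hxW'⟩, f x, (hsign x hxW).1,
    fun y hy => ?_⟩
  have hsq : f y * f y = f x * f x := (hsign y hy.1).1.trans (hsign x hxW).1.symm
  obtain heq | heq := mul_self_eq_mul_self_iff.1 hsq
  · exact heq ▸ (hsign y hy.1).2
  · have hneg := hposW' y hy.2
    rw [heq, neg_mul, (hsign x hxW).1] at hneg
    exact absurd hneg (by norm_num)

theorem Psi_eq_smul (hJ : S.IsRotationOn U J) (hJ' : S.IsRotationOn W J') (hxU : x ∈ U)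
    (hxW : x ∈ W) (hc : J' x = c • J x) : S.Psi hJ' φ x = c • S.Psi hJ φ x := by
  ext v
  simp only [Psi, dif_pos hxU, dif_pos hxW, hc]
  exact LinearMap.congr_fun (map_smul (S.g x) c _) _

theorem IsThetaOn.const_smul (hθ : S.IsThetaOn U J' V θ) (hc : c * c = 1)
    (hJ : ∀ y ∈ U, J' y = c • J y) : S.IsThetaOn U J V fun y => c • θ y where
  smooth W hWU hW X hX := contMDiffOn_const.mul (hθ.smooth W hWU hW X hX)
  ker_eq y hy w := by
    rw [← hθ.ker_eq y hy]
    exact mul_eq_zero_iff_left (left_ne_zero_of_mul_eq_one hc)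
  normalized y hy u v := by
    rw [mextDeriv_const_smul, ContinuousAlternatingMap.smul_apply, hθ.normalized y hy, hJ y hy,
      LinearMap.smul_apply, map_smul, smul_smul, hc, one_smul]

theorem IsCanonicalOn.of_eq_smul (hS : S.HasGrowthVector ![2, 3, 5]) (hU : IsOpen U)
    (hW : IsOpen W) (hWU : W ⊆ U) {hJ : S.IsRotationOn U J} (hJ' : S.IsRotationOn W J')
    (h : S.IsCanonicalOn hJ φ V) (hc : c * c = 1) (hcJ : ∀ y ∈ W, J' y = c • J y) :
    S.IsCanonicalOn hJ' φ V := by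
  have hVW := h.isGradingOn.mono hW hWU
  refine ⟨hVW, fun x hx u hu w₁ hw₁ w₂ hw₂ => ?_, fun θ hθ x hx u hu w hw => ?_⟩
  · have hΨ : ∀ y ∈ W, S.Psi hJ' φ y = c • S.Psi hJ φ y := fun y hy =>
      Psi_eq_smul hJ hJ' (hWU hy) hy (hcJ y hy)
    rw [mextDeriv_congr (eventually_of_mem (hW.mem_nhds hx) hΨ), mextDeriv_const_smul,
      ContinuousAlternatingMap.smul_apply, h.condI x (hWU hx) u hu w₁ hw₁ w₂ hw₂, smul_zero]
  · obtain ⟨θ₀, hθ₀⟩ := h.isGradingOn.exists_isThetaOn hS hU hJ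
    have heq : ∀ y ∈ W, θ₀ y = c • θ y := fun y hy =>
      (hθ₀.mono hWU).eq_of_isOpen hS hW (hJ.mono hWU) hVW (hθ.const_smul hc hcJ) hy
    have hzero := h.condII θ₀ hθ₀ x (hWU hx) u hu w hw
    rw [mextDeriv_congr (eventually_of_mem (hW.mem_nhds hx) heq), mextDeriv_const_smul] at hzero
    exact (smul_eq_zero_iff_right (left_ne_zero_of_mul_eq_one hc)).1 hzero

end Orientation

section GlobalGrading

theorem IsThetaOn.congr_grading (hθ : S.IsThetaOn U J V θ) (h : ∀ y ∈ U, (V · y) = (V' · y)) :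
    S.IsThetaOn U J V' θ where
  smooth := hθ.smooth
  ker_eq y hy w := by
    rw [hθ.ker_eq y hy, congrFun (h y hy) 2, congrFun (h y hy) 0]
  normalized := hθ.normalized

theorem isCanonicalOn_of_locally (hS : S.HasGrowthVector ![2, 3, 5]) (hJ : S.IsRotationOn U J)
    (h : ∀ x ∈ U, ∃ W ⊆ U, IsOpen W ∧ x ∈ W ∧ ∃ V', (∀ hJW : S.IsRotationOn W J,
      S.IsCanonicalOn hJW φ V') ∧ ∀ y ∈ W, (V · y) = (V' · y)) : S.IsCanonicalOn hJ φ V := by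
  refine ⟨isGradingOn_of_locally hS fun x hx => ?_, fun x hx u hu w₁ hw₁ w₂ hw₂ => ?_,
    fun θ hθ x hx => ?_⟩
  all_goals
    obtain ⟨W, hWU, hW, hxW, V', hV', heq⟩ := h x hx
    have hJW := hJ.mono hWU
  · exact ⟨W, hWU, hxW, V', (hV' hJW).isGradingOn, heq⟩
  · have hΨ : ∀ y ∈ W, S.Psi hJ φ y = S.Psi hJW φ y := fun y hy => by
      rw [Psi_eq_smul hJW hJ hy (hWU hy) (one_smul ℝ (J y)).symm, one_smul]
    rw [mextDeriv_congr (eventually_of_mem (hW.mem_nhds hxW) hΨ)]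
    rw [congrFun (heq x hxW) 2] at hw₁ hw₂
    exact (hV' hJW).condI x hxW u hu w₁ hw₁ w₂ hw₂
  · rw [congrFun (heq x hxW) 1, congrFun (heq x hxW) 2]
    exact (hV' hJW).condII θ ((hθ.mono hWU).congr_grading heq) x hxW

/-- Over `W`, the grading `V` satisfies (i) and (ii) for every orientation of `E` over every open
subset of `W`; unlike `IsCanonicalOn`, this makes sense when `E` is not orientable over `W`. -/
def IsCanonicalForAllOrientationsOn (S : Structure n M)
    (φ : Π x : M, TangentSpace (𝓡 n) x →ₗ[ℝ] S.E x) (W : Set M)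
    (V : Fin 3 → Π x : M, Submodule ℝ (TangentSpace (𝓡 n) x)) : Prop :=
  ∀ U ⊆ W, IsOpen U → ∀ (J : Π x : M, S.E x →ₗ[ℝ] S.E x) (hJ : S.IsRotationOn U J),
    S.IsCanonicalOn hJ φ V

theorem IsCanonicalForAllOrientationsOn.mono (h : S.IsCanonicalForAllOrientationsOn φ U V)
    (hWU : W ⊆ U) : S.IsCanonicalForAllOrientationsOn φ W V :=
  fun U' hU'W => h U' (hU'W.trans hWU)

theorem IsCanonicalForAllOrientationsOn.eq_of_isOpen (hS : S.HasGrowthVector ![2, 3, 5])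
    (hφ : S.IsPhi φ) (hU : IsOpen U) (h : S.IsCanonicalForAllOrientationsOn φ U V)
    (h' : S.IsCanonicalForAllOrientationsOn φ U V') (i : Fin 3) (hx : x ∈ U) :
    V i x = V' i x := by
  obtain ⟨W, hW, hxW, J, hJ⟩ := exists_orientation hS x
  have hJ' := hJ.mono (inter_subset_left (t := U))
  exact (h _ inter_subset_right (hW.inter hU) J hJ').eq_of_isOpen hS (hW.inter hU)
    ((isPhiOn_univ_iff.2 hφ).mono (subset_univ _))
    (h' _ inter_subset_right (hW.inter hU) J hJ') i ⟨hxW, hx⟩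

theorem IsCanonicalForAllOrientationsOn.isGradingOn (hS : S.HasGrowthVector ![2, 3, 5])
    (hU : IsOpen U) (h : S.IsCanonicalForAllOrientationsOn φ U V) : S.IsGradingOn U V := by
  refine isGradingOn_of_locally hS fun x hx => ?_
  obtain ⟨W, hW, hxW, J, hJ⟩ := exists_orientation hS x
  exact ⟨W ∩ U, inter_subset_right, ⟨hxW, hx⟩, V, (h _ inter_subset_right (hW.inter hU) J
    (hJ.mono inter_subset_left)).isGradingOn, fun _ _ => rfl⟩

theorem isCanonicalForAllOrientationsOn_of_locally (hS : S.HasGrowthVector ![2, 3, 5])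
    (h : ∀ x ∈ U, ∃ W ⊆ U, IsOpen W ∧ x ∈ W ∧ ∃ V', S.IsCanonicalForAllOrientationsOn φ W V' ∧
      ∀ y ∈ W, (V · y) = (V' · y)) : S.IsCanonicalForAllOrientationsOn φ U V := by
  refine fun U' hU'U hU' J hJ => isCanonicalOn_of_locally hS hJ fun x hx => ?_
  obtain ⟨W, -, hW, hxW, V', hV', heq⟩ := h x (hU'U hx)
  exact ⟨U' ∩ W, inter_subset_left, hU'.inter hW, ⟨hx, hxW⟩, V',
    hV' _ inter_subset_right (hU'.inter hW) J, fun y hy => heq y hy.2⟩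

theorem IsCanonicalOn.isCanonicalForAllOrientationsOn (hS : S.HasGrowthVector ![2, 3, 5])
    (hU : IsOpen U) {hJ : S.IsRotationOn U J} (h : S.IsCanonicalOn hJ φ V) :
    S.IsCanonicalForAllOrientationsOn φ U V := by
  refine fun W hWU hW J' hJ' => isCanonicalOn_of_locally hS hJ' fun x hx => ?_
  obtain ⟨W', hW'W, hW', hxW', c, hc, hcJ⟩ := (hJ.mono hWU).exists_eq_smul hS hW hJ' hx
  exact ⟨W', hW'W, hW', hxW', V,
    fun hJW' => h.of_eq_smul hS hU hW' (hW'W.trans hWU) hJW' hc hcJ, fun _ _ => rfl⟩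

theorem exists_isCanonicalForAllOrientationsOn (hS : S.HasGrowthVector ![2, 3, 5])
    (hφ : S.IsPhi φ) : ∃ V, S.IsCanonicalForAllOrientationsOn φ univ V := by
  suffices hglue : ∃ V : Π x : M, Fin 3 → Submodule ℝ (TangentSpace (𝓡 n) x),
      S.IsCanonicalForAllOrientationsOn φ univ fun i x => V x i from hglue.imp' _ fun _ => id
  refine exists_of_locally_unique
    (A := fun x => Fin 3 → Submodule ℝ (TangentSpace (𝓡 n) x))
    (P := fun W V => S.IsCanonicalForAllOrientationsOn φ W fun i x => V x i)
    (fun _ _ hWU h => h.mono hWU)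
    (fun hU h h' x hx => funext fun i => h.eq_of_isOpen hS hφ hU h' i hx)
    (fun h => isCanonicalForAllOrientationsOn_of_locally hS fun x hx => ?glue)
    (fun x _ => ?exists_local)
  case glue =>
    obtain ⟨W, hWU, hW, hxW, V', hV', heq⟩ := h x hx
    exact ⟨W, hWU, hW, hxW, _, hV', heq⟩
  case exists_local =>
    obtain ⟨U, hU, hxU, J, hJ⟩ := exists_orientation hS x
    obtain ⟨W, hWU, hW, hxW, e₀, e₁, h, hJW⟩ := hJ.exists_isAdapted hS hU hxU
    have hcanonical := h.isCanonicalOn hS ((isPhiOn_univ_iff.2 hφ).mono (subset_univ W))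
      (hJ.mono hWU) hJW
    exact ⟨W, subset_univ W, hW, hxW, fun x i => gradingOfForm _ e₀ e₁ i x,
      hcanonical.isCanonicalForAllOrientationsOn hS hW⟩

end GlobalGrading

end Structure

end SubRiem

end

theorem mainTheorem6_general {n : ℕ} {M : Type*} [TopologicalSpace M]
    [ChartedSpace (EuclideanSpace ℝ (Fin n)) M] [IsManifold (𝓡 n) ∞ M]
    (S : SubRiem.Structure n M) (hS : S.HasGrowthVector ![2, 3, 5]) :
    (∀ x : M, ∃ U : Set M, IsOpen U ∧ x ∈ U ∧
      ∃ J : Π y : M, S.E y →ₗ[ℝ] S.E y, S.IsRotationOn U J) ∧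
    (∃! φ : Π x : M, TangentSpace (𝓡 n) x →ₗ[ℝ] S.E x, S.IsPhi φ) ∧
    (∀ U : Set M, IsOpen U → ∀ J : Π x : M, S.E x →ₗ[ℝ] S.E x, S.IsRotationOn U J →
      ∀ V : Fin 3 → Π x : M, Submodule ℝ (TangentSpace (𝓡 n) x), S.IsGradingOn U V →
        ∃ θ, S.IsThetaOn U J V θ ∧
          ∀ θ', S.IsThetaOn U J V θ' → ∀ x ∈ U, θ' x = θ x) ∧
    ∀ φ : Π x : M, TangentSpace (𝓡 n) x →ₗ[ℝ] S.E x, S.IsPhi φ →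
      (∀ U : Set M, IsOpen U → ∀ (J : Π x : M, S.E x →ₗ[ℝ] S.E x) (hJ : S.IsRotationOn U J),
        ∃ V : Fin 3 → Π x : M, Submodule ℝ (TangentSpace (𝓡 n) x),
          (S.IsGradingOn U V ∧ S.CondI hJ φ V ∧ ∀ θ, S.IsThetaOn U J V θ → S.CondII U V θ) ∧
          ∀ V' : Fin 3 → Π x : M, Submodule ℝ (TangentSpace (𝓡 n) x),
            (S.IsGradingOn U V' ∧ S.CondI hJ φ V' ∧
              ∀ θ, S.IsThetaOn U J V' θ → S.CondII U V' θ) →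
            ∀ i, ∀ x ∈ U, V' i x = V i x) ∧
      ∃! V : Fin 3 → Π x : M, Submodule ℝ (TangentSpace (𝓡 n) x),
        S.IsGradingOn Set.univ V ∧
        ∀ U : Set M, IsOpen U → ∀ (J : Π x : M, S.E x →ₗ[ℝ] S.E x) (hJ : S.IsRotationOn U J),
          S.CondI hJ φ V ∧ ∀ θ, S.IsThetaOn U J V θ → S.CondII U V θ := by
  refine ⟨SubRiem.Structure.exists_orientation hS, SubRiem.Structure.existsUnique_isPhi hS,
    fun U hU J hJ V hV => ?_, fun φ hφ => ?_⟩
  · obtain ⟨θ, hθ⟩ := hV.exists_isThetaOn hS hU hJ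
    exact ⟨θ, hθ, fun θ' hθ' x hx => hθ'.eq_of_isOpen hS hU hJ hV hθ hx⟩
  obtain ⟨V, hV⟩ := SubRiem.Structure.exists_isCanonicalForAllOrientationsOn hS hφ
  refine ⟨fun U hU J hJ => ⟨V, ?_, fun V' hV' i x hx => ?_⟩,
    V, ⟨hV.isGradingOn hS isOpen_univ, fun U hU J hJ => ?_⟩,
    fun V' hV' => funext fun i => funext fun x => ?_⟩
  · have hVU := hV U U.subset_univ hU J hJ
    exact ⟨hVU.isGradingOn, hVU.condI, hVU.condII⟩
  · have hV'U : S.IsCanonicalOn hJ φ V' := ⟨hV'.1, hV'.2.1, hV'.2.2⟩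
    have hφU := (SubRiem.Structure.isPhiOn_univ_iff.2 hφ).mono U.subset_univ
    exact hV'U.eq_of_isOpen hS hU hφU (hV U U.subset_univ hU J hJ) i hx
  · have hVU := hV U U.subset_univ hU J hJ
    exact ⟨hVU.condI, hVU.condII⟩
  · have hV'univ : S.IsCanonicalForAllOrientationsOn φ Set.univ V' := fun U hUM hU J hJ =>
      ⟨hV'.1.mono hU hUM, (hV'.2 U hU J hJ).1, (hV'.2 U hU J hJ).2⟩
    exact hV'univ.eq_of_isOpen hS hφ isOpen_univ hV i (Set.mem_univ x)

theorem mainTheorem6 {n : ℕ} {M : Type*} [TopologicalSpace M] [T2Space M]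
    [SecondCountableTopology M] [ChartedSpace (EuclideanSpace ℝ (Fin n)) M]
    [IsManifold (𝓡 n) ∞ M] (S : SubRiem.Structure n M) (hS : S.HasGrowthVector ![2, 3, 5]) :
    -- `E` is locally orientable
    (∀ x : M, ∃ U : Set M, IsOpen U ∧ x ∈ U ∧
      ∃ J : Π y : M, S.E y →ₗ[ℝ] S.E y, S.IsRotationOn U J) ∧
    -- the one-form `φ` is well defined on all of `M`, and `θ` is well defined for each grading
    (∃! φ : Π x : M, TangentSpace (𝓡 n) x →ₗ[ℝ] S.E x, S.IsPhi φ) ∧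
    (∀ U : Set M, IsOpen U → ∀ J : Π x : M, S.E x →ₗ[ℝ] S.E x, S.IsRotationOn U J →
      ∀ V : Fin 3 → Π x : M, Submodule ℝ (TangentSpace (𝓡 n) x), S.IsGradingOn U V →
        ∃ θ, S.IsThetaOn U J V θ ∧
          ∀ θ', S.IsThetaOn U J V θ' → ∀ x ∈ U, θ' x = θ x) ∧
    ∀ φ : Π x : M, TangentSpace (𝓡 n) x →ₗ[ℝ] S.E x, S.IsPhi φ →
      -- on each oriented open set there is a unique grading with the two properties
      (∀ U : Set M, IsOpen U → ∀ (J : Π x : M, S.E x →ₗ[ℝ] S.E x) (hJ : S.IsRotationOn U J),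
        ∃ V : Fin 3 → Π x : M, Submodule ℝ (TangentSpace (𝓡 n) x),
          (S.IsGradingOn U V ∧ S.CondI hJ φ V ∧ ∀ θ, S.IsThetaOn U J V θ → S.CondII U V θ) ∧
          ∀ V' : Fin 3 → Π x : M, Submodule ℝ (TangentSpace (𝓡 n) x),
            (S.IsGradingOn U V' ∧ S.CondI hJ φ V' ∧
              ∀ θ, S.IsThetaOn U J V' θ → S.CondII U V' θ) →
            ∀ i, ∀ x ∈ U, V' i x = V i x) ∧
      -- these gradings do not depend on the orientation and form one unique grading of `TM`
      ∃! V : Fin 3 → Π x : M, Submodule ℝ (TangentSpace (𝓡 n) x),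
        S.IsGradingOn Set.univ V ∧
        ∀ U : Set M, IsOpen U → ∀ (J : Π x : M, S.E x →ₗ[ℝ] S.E x) (hJ : S.IsRotationOn U J),
          S.CondI hJ φ V ∧ ∀ θ, S.IsThetaOn U J V θ → S.CondII U V θ := by
  exact mainTheorem6_general S hS
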